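/- Let $k$ be a field of characteristic $0$. Let $U_q(\mathfrak b_+)$ be the Hopf algebra over $k(q)$ generated by $X,g,g^{-1}$ with $Xg=qgX$, $\Delta X=X\otimes 1+g\otimes X$, $\Delta g=g\otimes g$, $\varepsilon(X)=0$, $\varepsilon(g)=1$, $SX=-g^{-1}X$, $Sg=g^{-1}$; it is paired with itself by $\langle X^ng^m,X^rg^s\rangle=\delta_{n,r}[n]_q!\,q^{-n(n-1)/2}q^{-ms}$, and as a function algebra it is also denoted $C_q(B_+)$. Let $C(B_+)$ be the Hopf algebra over $k$ given by the same formulas with $q=1$, and let $U(\mathfrak b_+)$ be the enveloping algebra of the Lie algebra with basis $X,H$ and $[H,X]=X$, paired with $C(B_+)$ by $\langle X^rg^s,X^nH^m\rangle=\delta_{n,r}\,n!\,s^m$. A *differential calculus* $(\Gamma,d)$ on a Hopf algebra $A$ is a bicovariant first order differential calculus; it is determined up to isomorphism by the crossed submodule $M_\Gamma=\{a\in\ker\varepsilon: d(a_{(1)})S(a_{(2)})=0\}$ of $\ker\varepsilon$, with $\Gamma\cong(\ker\varepsilon/M_\Gamma)\otimes A$ and $da=[a_{(1)}-\varepsilon(a_{(1)})]\otimes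 a_{(2)}$. Its dimension is that of its space of right invariant forms, $\cong\ker\varepsilon/M_\Gamma$. It is coirreducible if it is nonzero and has no quotient calculus other than $0$ and itself. If $A$ is paired with a Hopf algebra $H$, a *quantum tangent space* is a subspace $L\subseteq\ker\varepsilon\subset H$ invariant under the adjoint action $h\triangleright x=h_{(1)}xS(h_{(2)})$ and under the coregular action $a\triangleright x=\langle x_{(1)},a\rangle x_{(2)}$ followed by $y\mapsto y-\varepsilon(y)1$; it is irreducible if it is nonzero and contains no quantum tangent space other than $0$ and itself. The quantum tangent space of $\Gamma$ is $L_\Gamma=\{x\in\ker\varepsilon\subset H:\langle x,M_\Gamma\rangle=0\}$. For a subspace $M\subseteq U_q(\mathfrak b_+)$ let $\lim M\subseteq U(\mathfrak b_+)$ be the set of lowest order coefficients in $t$ of the elements of $M$ (together with $0$) after substituting $q=e^{-t}$, $g=e^{tH}$. For a subspace $L\subseteq C_q(B_+)$ let $\lim L\subseteq C(B_+)$ be obtained by setting $q=1$ in those elements $\sum_{n,m}c_{n,m}X^ng^m$ of $L$ whose coefficients are regular at $q=1$. **(a)** For every finite dimensional calculus $\Gamma_q$ on $U_q(\mathfrak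 b_+)$ there is a calculus $\Gamma$ on $U(\mathfrak b_+)$, unique up to isomorphism, with $M_\Gamma=\lim M_{\Gamma_q}$. It is finite dimensional with $\dim\Gamma=\dim\Gamma_q$, and non-isomorphic $\Gamma_q$ have non-isomorphic limits. If $M_{\Gamma_q},M_{\Gamma_q'}$ have limits $M_\Gamma,M_{\Gamma'}$, then $M_{\Gamma_q}\cap M_{\Gamma_q'}$ again belongs to a finite dimensional calculus and its limit is $M_\Gamma\cap M_{\Gamma'}$. For every finite dimensional quantum tangent space $L_q$ (of the pairing of $U_q(\mathfrak b_+)$ with itself), $\lim L_q$ is a quantum tangent space in $C(B_+)$ of the same dimension; the map $L_q\mapsto\lim L_q$ is injective and preserves intersections. The assignment $\Gamma_q\mapsto L_{\Gamma_q}$ is a dimension preserving one-to-one correspondence between finite dimensional calculi on $U_q(\mathfrak b_+)$ up to isomorphism and finite dimensional quantum tangent spaces, and if $\Gamma$ is the limit of $\Gamma_q$ then $L_\Gamma=\lim L_{\Gamma_q}$. **(b)** Finite dimensional coirreducible calculi on $U_q(\mathfrak b_+)$ exist in every dimension $n\ge2$ and in no other, and a finite dimensional $\Gamma_q$ is coirreducible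 if and only if $L_{\Gamma_q}$ is irreducible. If $\Gamma$ is the limit of a coirreducible calculus $\Gamma_q$ of finite dimension $n$, then $\Gamma$ has a right invariant basis $\eta_0,\dots,\eta_{n-1}$ with $$dX=\eta_1,\qquad dH=(1-n)\eta_0,\qquad [H,\eta_i]=(1-n+i)\eta_i\quad\forall i,\qquad [X,\eta_i]=\begin{cases}\eta_{i+1}& i<n-1\\ 0& i=n-1,\end{cases}$$ and, for the dual basis $\phi_0,\dots,\phi_{n-1}$ of $L_\Gamma=\lim L_{\Gamma_q}$, the braided derivations $\partial_i(a)=\langle\phi_i,a_{(1)}\rangle a_{(2)}$ of $U(\mathfrak b_+)$ are $$\partial_i{:}f{:}={:}\,T_{1-n+i,H}\tfrac1{i!}\Big(\tfrac{\partial}{\partial X}\Big)^i f\,{:}\quad(1\le i\le n-1),\qquad \partial_0{:}f{:}={:}\,T_{1-n,H}f-f\,{:}$$ for $f\in k[X,H]$, where $(T_{a,H}f)(X,H)=f(X,H+a)$ and the normal ordering $k[X,H]\to U(\mathfrak b_+)$ sends $H^nX^m$ to $H^nX^m$. -/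

import Mathlib

open scoped TensorProduct

noncomputable section

namespace BorelCalculi

universe u

/-! ### Hopf algebras from an antipode given on generators -/

section Generators

variable {R A : Type u} [CommRing R] [Ring A] [Bialgebra R A]

/-- An algebra map `A → Aᵐᵒᵖ`, regarded as a linear endomorphism of `A`. -/
def antiLinear (S : A →ₐ[R] Aᵐᵒᵖ) : A →ₗ[R] A :=
  (MulOpposite.opLinearEquiv R).symm.toLinearMap ∘ₗ S.toLinearMap

lemma antiLinear_apply (S : A →ₐ[R] Aᵐᵒᵖ) (a : A) : antiLinear S a = (S a).unop := rfl

lemma antiLinear_mul (S : A →ₐ[R] Aᵐᵒᵖ) (a b : A) :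
    antiLinear S (a * b) = antiLinear S b * antiLinear S a := by
  simp [antiLinear_apply]

lemma left_aux (S : A →ₐ[R] Aᵐᵒᵖ) (s t : A ⊗[R] A) (c : R)
    (hs : LinearMap.mul' R A ((antiLinear S).rTensor A s) = algebraMap R A c) :
    LinearMap.mul' R A ((antiLinear S).rTensor A (s * t)) =
      c • LinearMap.mul' R A ((antiLinear S).rTensor A t) := by
  induction t with
  | zero => simp
  | add x y hx hy => simp [mul_add, hx, hy]
  | tmul b b' =>
    have key : LinearMap.mul' R A ((antiLinear S).rTensor A (s * b ⊗ₜ[R] b')) =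
        antiLinear S b * LinearMap.mul' R A ((antiLinear S).rTensor A s) * b' := by
      clear hs
      induction s with
      | zero => simp
      | add x y hx hy => simp [add_mul, mul_add, hx, hy]
      | tmul a a' => simp [antiLinear_mul, mul_assoc]
    rw [key, hs, ← Algebra.commutes, mul_assoc, ← Algebra.smul_def]
    simp

lemma right_aux (S : A →ₐ[R] Aᵐᵒᵖ) (s t : A ⊗[R] A) (c : R)
    (ht : LinearMap.mul' R A ((antiLinear S).lTensor A t) = algebraMap R A c) :
    LinearMap.mul' R A ((antiLinear S).lTensor A (s * t)) =
      c • LinearMap.mul' R A ((antiLinear S).lTensor A s) := by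
  induction s with
  | zero => simp
  | add x y hx hy => simp [add_mul, hx, hy]
  | tmul b b' =>
    have key : LinearMap.mul' R A ((antiLinear S).lTensor A (b ⊗ₜ[R] b' * t)) =
        b * LinearMap.mul' R A ((antiLinear S).lTensor A t) * antiLinear S b' := by
      clear ht
      induction t with
      | zero => simp
      | add x y hx hy => simp [add_mul, mul_add, hx, hy]
      | tmul a a' => simp [antiLinear_mul, mul_assoc]
    rw [key, ht, ← Algebra.commutes, mul_assoc, ← Algebra.smul_def]
    simp

lemma antipode_left (S : A →ₐ[R] Aᵐᵒᵖ) (s : Set A) (hs : Algebra.adjoin R s = ⊤)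
    (h : ∀ a ∈ s, LinearMap.mul' R A ((antiLinear S).rTensor A (Coalgebra.comul a)) =
      algebraMap R A (Coalgebra.counit a)) (a : A) :
    LinearMap.mul' R A ((antiLinear S).rTensor A (Coalgebra.comul a)) =
      algebraMap R A (Coalgebra.counit a) := by
  have ha : a ∈ Algebra.adjoin R s := hs ▸ Algebra.mem_top
  induction ha using Algebra.adjoin_induction with
  | mem x hx => exact h x hx
  | algebraMap r => simp [Algebra.TensorProduct.algebraMap_apply, antiLinear_apply]
  | add x y _ _ hx hy => simp [hx, hy]
  | mul x y _ _ hx hy =>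
    rw [Bialgebra.comul_mul, left_aux S _ _ _ hx, hy, Bialgebra.counit_mul, map_mul,
      Algebra.smul_def]

lemma antipode_right (S : A →ₐ[R] Aᵐᵒᵖ) (s : Set A) (hs : Algebra.adjoin R s = ⊤)
    (h : ∀ a ∈ s, LinearMap.mul' R A ((antiLinear S).lTensor A (Coalgebra.comul a)) =
      algebraMap R A (Coalgebra.counit a)) (a : A) :
    LinearMap.mul' R A ((antiLinear S).lTensor A (Coalgebra.comul a)) =
      algebraMap R A (Coalgebra.counit a) := by
  have ha : a ∈ Algebra.adjoin R s := hs ▸ Algebra.mem_top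
  induction ha using Algebra.adjoin_induction with
  | mem x hx => exact h x hx
  | algebraMap r => simp [Algebra.TensorProduct.algebraMap_apply, antiLinear_apply]
  | add x y _ _ hx hy => simp [hx, hy]
  | mul x y _ _ hx hy =>
    rw [Bialgebra.comul_mul, right_aux S _ _ _ hy, hx, Bialgebra.counit_mul, mul_comm, map_mul,
      Algebra.smul_def]

/-- The Hopf algebra with antipode `S`, an algebra map to the opposite algebra for which the
antipode axioms hold on a set of algebra generators. -/
abbrev hopfOfGenerators (S : A →ₐ[R] Aᵐᵒᵖ) (s : Set A) (hs : Algebra.adjoin R s = ⊤)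
    (hl : ∀ a ∈ s, LinearMap.mul' R A ((antiLinear S).rTensor A (Coalgebra.comul a)) =
      algebraMap R A (Coalgebra.counit a))
    (hr : ∀ a ∈ s, LinearMap.mul' R A ((antiLinear S).lTensor A (Coalgebra.comul a)) =
      algebraMap R A (Coalgebra.counit a)) : HopfAlgebra R A where
  antipode := antiLinear S
  mul_antipode_rTensor_comul := LinearMap.ext fun a => antipode_left S s hs hl a
  mul_antipode_lTensor_comul := LinearMap.ext fun a => antipode_right S s hs hr a

end Generators

/-! ### The Hopf algebra `K⟨X, g, g⁻¹⟩` with `X g = q g X` -/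

/-- Names of the generators. -/
inductive QGen : Type
  | X
  | g
  | gInv

section QBorel

variable (K : Type u) [Field K] (q : Kˣ)

/-- The relations `g g⁻¹ = 1`, `g⁻¹ g = 1`, `X g = q g X`. -/
inductive QRel : FreeAlgebra K QGen → FreeAlgebra K QGen → Prop
  | g_gInv : QRel (FreeAlgebra.ι K QGen.g * FreeAlgebra.ι K QGen.gInv) 1
  | gInv_g : QRel (FreeAlgebra.ι K QGen.gInv * FreeAlgebra.ι K QGen.g) 1
  | X_g : QRel (FreeAlgebra.ι K QGen.X * FreeAlgebra.ι K QGen.g)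
      ((q : K) • (FreeAlgebra.ι K QGen.g * FreeAlgebra.ι K QGen.X))

/-- The algebra generated by `X, g, g⁻¹` with `X g = q g X`. -/
def QBorel : Type u := RingQuot (QRel K q)

instance : Ring (QBorel K q) := inferInstanceAs (Ring (RingQuot (QRel K q)))

instance : Algebra K (QBorel K q) := inferInstanceAs (Algebra K (RingQuot (QRel K q)))

namespace QBorel

/-- The quotient map from the free algebra. -/
def mk : FreeAlgebra K QGen →ₐ[K] QBorel K q := RingQuot.mkAlgHom K (QRel K q)

/-- The generator `X`. -/
def X : QBorel K q := mk K q (FreeAlgebra.ι K QGen.X)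

/-- The generator `g`, as a unit with inverse the generator `g⁻¹`. -/
def g : (QBorel K q)ˣ where
  val := mk K q (FreeAlgebra.ι K QGen.g)
  inv := mk K q (FreeAlgebra.ι K QGen.gInv)
  val_inv := by
    rw [← map_mul]
    exact (RingQuot.mkAlgHom_rel K (QRel.g_gInv (K := K) (q := q))).trans (map_one _)
  inv_val := by
    rw [← map_mul]
    exact (RingQuot.mkAlgHom_rel K (QRel.gInv_g (K := K) (q := q))).trans (map_one _)

lemma X_mul_g : X K q * (g K q : QBorel K q) = (q : K) • ((g K q : QBorel K q) * X K q) := by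
  have h : mk K q (FreeAlgebra.ι K QGen.X * FreeAlgebra.ι K QGen.g) =
      mk K q ((q : K) • (FreeAlgebra.ι K QGen.g * FreeAlgebra.ι K QGen.X)) :=
    RingQuot.mkAlgHom_rel K (QRel.X_g (K := K) (q := q))
  rwa [map_mul, map_smul, map_mul] at h

/-- The algebra map out of `QBorel K q` with prescribed values on the generators. -/
def lift {B : Type u} [Ring B] [Algebra K B] (x : B) (y : Bˣ)
    (h : x * (y : B) = (q : K) • ((y : B) * x)) : QBorel K q →ₐ[K] B :=
  RingQuot.liftAlgHom K (s := QRel K q)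
    ⟨FreeAlgebra.lift K (fun i : QGen =>
        match i with
        | QGen.X => x
        | QGen.g => (y : B)
        | QGen.gInv => ((y⁻¹ : Bˣ) : B)), by
      intro a b hab
      cases hab with
      | g_gInv => simp
      | gInv_g => simp
      | X_g => simpa using h⟩

variable {K q}

section lift

variable {B : Type u} [Ring B] [Algebra K B] (x : B) (y : Bˣ)
    (h : x * (y : B) = (q : K) • ((y : B) * x))

@[simp] lemma lift_X : lift K q x y h (X K q) = x := by
  unfold lift X mk
  exact (RingQuot.liftAlgHom_mkAlgHom_apply K _ _ _).trans (by simp)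

@[simp] lemma lift_g : lift K q x y h (g K q : QBorel K q) = (y : B) := by
  unfold lift g mk
  exact (RingQuot.liftAlgHom_mkAlgHom_apply K _ _ _).trans (by simp)

@[simp] lemma lift_gInv : lift K q x y h ((g K q)⁻¹ : (QBorel K q)ˣ) = ((y⁻¹ : Bˣ) : B) := by
  unfold lift g mk
  exact (RingQuot.liftAlgHom_mkAlgHom_apply K _ _ _).trans (by simp)

end lift

lemma adjoin_eq_top : Algebra.adjoin K
    ({X K q, (g K q : QBorel K q), (((g K q)⁻¹ : (QBorel K q)ˣ) : QBorel K q)} :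
      Set (QBorel K q)) = ⊤ := by
  have hsurj : Function.Surjective (mk K q) := RingQuot.mkAlgHom_surjective K (QRel K q)
  have h1 : (Algebra.adjoin K (Set.range (FreeAlgebra.ι K : QGen → FreeAlgebra K QGen))).map
      (mk K q) = ⊤ := by
    rw [FreeAlgebra.adjoin_range_ι, Algebra.map_top]
    exact (AlgHom.range_eq_top _).2 hsurj
  rw [eq_top_iff, ← h1, AlgHom.map_adjoin]
  apply Algebra.adjoin_mono
  rintro _ ⟨_, ⟨i, rfl⟩, rfl⟩
  cases i
  · exact Or.inl rfl
  · exact Or.inr (Or.inl rfl)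
  · exact Or.inr (Or.inr rfl)

lemma hom_ext {B : Type u} [Ring B] [Algebra K B] {f f' : QBorel K q →ₐ[K] B}
    (hX : f (X K q) = f' (X K q)) (hg : f (g K q : QBorel K q) = f' (g K q : QBorel K q)) :
    f = f' := by
  refine AlgHom.ext_of_adjoin_eq_top adjoin_eq_top ?_
  rintro a (rfl | rfl | rfl)
  · exact hX
  · exact hg
  · have h1 : Units.map (f : QBorel K q →* B) (g K q) = Units.map (f' : QBorel K q →* B) (g K q) :=
      Units.ext hg
    have h2 := congrArg (fun w : Bˣ => ((w⁻¹ : Bˣ) : B)) h1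
    simpa using h2

variable (K q)

/-- The unit `g ⊗ g`. -/
def gTensor : (QBorel K q ⊗[K] QBorel K q)ˣ where
  val := (g K q : QBorel K q) ⊗ₜ (g K q : QBorel K q)
  inv := ((g K q)⁻¹ : (QBorel K q)ˣ) ⊗ₜ ((g K q)⁻¹ : (QBorel K q)ˣ)
  val_inv := by simp [Algebra.TensorProduct.one_def]
  inv_val := by simp [Algebra.TensorProduct.one_def]

/-- The coproduct `Δ X = X ⊗ 1 + g ⊗ X`, `Δ g = g ⊗ g`. -/
def comulHom : QBorel K q →ₐ[K] QBorel K q ⊗[K] QBorel K q :=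
  lift K q (X K q ⊗ₜ 1 + (g K q : QBorel K q) ⊗ₜ X K q) (gTensor K q) (by
    simp [gTensor, add_mul, mul_add, X_mul_g, TensorProduct.smul_tmul'])

/-- The counit `ε X = 0`, `ε g = 1`. -/
def counitHom : QBorel K q →ₐ[K] K := lift K q 0 1 (by simp)

lemma X_mul_gInv : (q : K) • (X K q * (((g K q)⁻¹ : (QBorel K q)ˣ) : QBorel K q)) =
    (((g K q)⁻¹ : (QBorel K q)ˣ) : QBorel K q) * X K q := by
  rw [Units.eq_inv_mul_iff_mul_eq, mul_smul_comm, ← mul_assoc, ← smul_mul_assoc, ← X_mul_g,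
    mul_assoc, Units.mul_inv, mul_one]

/-- The antipode `S X = -g⁻¹ X`, `S g = g⁻¹`. -/
def antipodeHom : QBorel K q →ₐ[K] (QBorel K q)ᵐᵒᵖ :=
  lift K q (MulOpposite.op (-((((g K q)⁻¹ : (QBorel K q)ˣ) : QBorel K q) * X K q)))
    (Units.opEquiv.symm (MulOpposite.op (g K q)⁻¹)) (by
      rw [Units.coe_opEquiv_symm, MulOpposite.unop_op, ← MulOpposite.op_mul, ← MulOpposite.op_mul,
        ← MulOpposite.op_smul, neg_mul, smul_neg, mul_assoc, ← mul_smul_comm, X_mul_gInv, mul_neg])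

instance : Bialgebra K (QBorel K q) :=
  Bialgebra.ofAlgHom (comulHom K q) (counitHom K q)
    (by
      apply hom_ext
      · simp [comulHom, gTensor, TensorProduct.add_tmul, TensorProduct.tmul_add,
          Algebra.TensorProduct.one_def, add_assoc]
      · simp [comulHom, gTensor])
    (by
      apply hom_ext
      · simp [comulHom, counitHom, gTensor]
      · simp [comulHom, counitHom, gTensor])
    (by
      apply hom_ext
      · simp [comulHom, counitHom, gTensor]
      · simp [comulHom, counitHom, gTensor])

lemma comul_X : Coalgebra.comul (R := K) (X K q) =
    X K q ⊗ₜ 1 + (g K q : QBorel K q) ⊗ₜ X K q :=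
  lift_X _ _ _

lemma comul_g : Coalgebra.comul (R := K) (g K q : QBorel K q) =
    (g K q : QBorel K q) ⊗ₜ (g K q : QBorel K q) :=
  lift_g _ _ _

lemma comul_gInv : Coalgebra.comul (R := K) (((g K q)⁻¹ : (QBorel K q)ˣ) : QBorel K q) =
    (((g K q)⁻¹ : (QBorel K q)ˣ) : QBorel K q) ⊗ₜ (((g K q)⁻¹ : (QBorel K q)ˣ) : QBorel K q) :=
  lift_gInv _ _ _

lemma counit_X : Coalgebra.counit (R := K) (X K q) = 0 := lift_X _ _ _

lemma counit_g : Coalgebra.counit (R := K) (g K q : QBorel K q) = 1 := lift_g _ _ _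

lemma counit_gInv :
    Coalgebra.counit (R := K) (((g K q)⁻¹ : (QBorel K q)ˣ) : QBorel K q) = 1 :=
  (lift_gInv _ _ _).trans (by simp)

lemma antiLinear_antipodeHom_X : antiLinear (antipodeHom K q) (X K q) =
    -((((g K q)⁻¹ : (QBorel K q)ˣ) : QBorel K q) * X K q) := by
  simp [antiLinear_apply, antipodeHom]

lemma antiLinear_antipodeHom_g : antiLinear (antipodeHom K q) (g K q : QBorel K q) =
    (((g K q)⁻¹ : (QBorel K q)ˣ) : QBorel K q) := by
  rw [antiLinear_apply, antipodeHom, lift_g]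
  rfl

lemma antiLinear_antipodeHom_gInv :
    antiLinear (antipodeHom K q) (((g K q)⁻¹ : (QBorel K q)ˣ) : QBorel K q) =
    (g K q : QBorel K q) := by
  rw [antiLinear_apply, antipodeHom, lift_gInv]
  rfl

instance : HopfAlgebra K (QBorel K q) :=
  hopfOfGenerators (antipodeHom K q) _ adjoin_eq_top
    (by
      rintro a (rfl | rfl | rfl)
      · simp [comul_X, counit_X, antiLinear_antipodeHom_X, antiLinear_antipodeHom_g]
      · simp [comul_g, counit_g, antiLinear_antipodeHom_g]
      · rw [comul_gInv, counit_gInv, LinearMap.rTensor_tmul, antiLinear_antipodeHom_gInv]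
        simp)
    (by
      rintro a (rfl | rfl | rfl)
      · simp [comul_X, counit_X, antiLinear_antipodeHom_X, antiLinear_apply (antipodeHom K q) 1]
      · simp [comul_g, counit_g, antiLinear_antipodeHom_g]
      · rw [comul_gInv, counit_gInv, LinearMap.lTensor_tmul, antiLinear_antipodeHom_gInv]
        simp)

/-- The monomial `X ^ n g ^ m`. -/
def monomial (p : ℕ × ℤ) : QBorel K q := X K q ^ p.1 * ((g K q ^ p.2 : (QBorel K q)ˣ) : QBorel K q)

/-- The operator `e(n, m) ↦ q ^ (-n) e(n, m + 1)`, left multiplication by `g` on monomials. -/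
def regG : (Module.End K (ℕ × ℤ →₀ K))ˣ where
  val := Finsupp.linearCombination K fun p =>
    Finsupp.single (p.1, p.2 + 1) ((q ^ (-(p.1 : ℤ)) : Kˣ) : K)
  inv := Finsupp.linearCombination K fun p =>
    Finsupp.single (p.1, p.2 - 1) ((q ^ (p.1 : ℤ) : Kˣ) : K)
  val_inv := by ext p; simp
  inv_val := by ext p; simp

/-- The operator `e(n, m) ↦ e(n + 1, m)`, left multiplication by `X` on monomials. -/
def regX : Module.End K (ℕ × ℤ →₀ K) :=
  Finsupp.linearCombination K fun p => Finsupp.single (p.1 + 1, p.2) 1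

/-- The left regular representation in terms of monomials. -/
def reg : QBorel K q →ₐ[K] Module.End K (ℕ × ℤ →₀ K) :=
  lift K q (regX K) (regG K q) (by
    refine Finsupp.lhom_ext' fun p => LinearMap.ext_ring ?_
    simp [regX, regG, pow_succ, -Finsupp.single_mul])

/-- The coordinates with respect to the monomials `X ^ n g ^ m`. -/
def coord : QBorel K q →ₗ[K] (ℕ × ℤ →₀ K) :=
  (LinearMap.applyₗ (Finsupp.single (0, 0) (1 : K))) ∘ₗ (reg K q).toLinearMap

lemma reg_X (p : ℕ × ℤ) (c : K) :
    reg K q (X K q) (Finsupp.single p c) = Finsupp.single (p.1 + 1, p.2) c := by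
  simp [reg, regX]

lemma regG_zpow (m m' : ℤ) :
    ((regG K q ^ m : (Module.End K (ℕ × ℤ →₀ K))ˣ) : Module.End K (ℕ × ℤ →₀ K))
      (Finsupp.single (0, m') (1 : K)) = Finsupp.single (0, m' + m) 1 := by
  induction m generalizing m' with
  | zero => simp
  | succ i ih =>
    rw [zpow_add_one, Units.val_mul, Module.End.mul_apply]
    have : ((regG K q : (Module.End K (ℕ × ℤ →₀ K))ˣ) : Module.End K (ℕ × ℤ →₀ K))
        (Finsupp.single (0, m') (1 : K)) = Finsupp.single (0, m' + 1) 1 := by simp [regG]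
    rw [this, ih, add_assoc, add_comm 1]
  | pred i ih =>
    rw [zpow_sub_one, Units.val_mul, Module.End.mul_apply]
    have : (((regG K q)⁻¹ : (Module.End K (ℕ × ℤ →₀ K))ˣ) : Module.End K (ℕ × ℤ →₀ K))
        (Finsupp.single (0, m') (1 : K)) = Finsupp.single (0, m' - 1) 1 := by
      change (regG K q).inv _ = _
      simp [regG]
    rw [this, ih]
    congr 2
    ring

lemma reg_g_zpow (m : ℤ) : reg K q ((g K q ^ m : (QBorel K q)ˣ) : QBorel K q) =
    ((regG K q ^ m : (Module.End K (ℕ × ℤ →₀ K))ˣ) : Module.End K (ℕ × ℤ →₀ K)) := by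
  have h : Units.map (reg K q : QBorel K q →* Module.End K (ℕ × ℤ →₀ K)) (g K q) = regG K q :=
    Units.ext (lift_g _ _ _)
  rw [← h, ← map_zpow]
  rfl

/-- The coordinates of `X ^ n g ^ m`; in particular these monomials are linearly independent. -/
lemma coord_monomial (p : ℕ × ℤ) : coord K q (monomial K q p) = Finsupp.single p 1 := by
  have h : ∀ (n : ℕ) (m : ℤ), (reg K q (X K q) ^ n) (Finsupp.single (0, m) (1 : K)) =
      Finsupp.single (n, m) 1 := by
    intro n m
    induction n with
    | zero => simp
    | succ n ih => rw [pow_succ', Module.End.mul_apply, ih, reg_X]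
  simp [coord, monomial, reg_g_zpow, regG_zpow, h]

end QBorel

end QBorel

/-! ### The enveloping algebra of `b₊` -/

section UBorel

variable (k : Type u) [Field k]

/-- The Lie algebra `b₊` with basis `X, H` and bracket `[H, X] = X`;
the element `⟨x, h⟩` stands for `x X + h H`. -/
@[ext] structure BPlus (k : Type u) : Type u where
  /-- the coefficient of `X` -/
  x : k
  /-- the coefficient of `H` -/
  h : k

namespace BPlus

/-- The identification of `b₊` with `k × k` as a set. -/
def equivProd (k : Type u) : BPlus k ≃ k × k where
  toFun a := (a.x, a.h)
  invFun p := ⟨p.1, p.2⟩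
  left_inv _ := rfl
  right_inv _ := rfl

instance : AddCommGroup (BPlus k) := (equivProd k).addCommGroup

instance : Module k (BPlus k) := (equivProd k).module k

variable {k}

@[simp] lemma add_x (a b : BPlus k) : (a + b).x = a.x + b.x := rfl

@[simp] lemma add_h (a b : BPlus k) : (a + b).h = a.h + b.h := rfl

@[simp] lemma zero_x : (0 : BPlus k).x = 0 := rfl

@[simp] lemma zero_h : (0 : BPlus k).h = 0 := rfl

@[simp] lemma smul_x (c : k) (a : BPlus k) : (c • a).x = c * a.x := rfl

@[simp] lemma smul_h (c : k) (a : BPlus k) : (c • a).h = c * a.h := rfl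

instance : Bracket (BPlus k) (BPlus k) := ⟨fun a b => ⟨a.h * b.x - a.x * b.h, 0⟩⟩

@[simp] lemma lie_x (a b : BPlus k) : ⁅a, b⁆.x = a.h * b.x - a.x * b.h := rfl

@[simp] lemma lie_h (a b : BPlus k) : ⁅a, b⁆.h = 0 := rfl

instance : LieRing (BPlus k) where
  add_lie a b c := by ext <;> simp; ring
  lie_add a b c := by ext <;> simp; ring
  lie_self a := by ext <;> simp; ring
  leibniz_lie a b c := by ext <;> simp; ring

instance : LieAlgebra k (BPlus k) where
  lie_smul c a b := by ext <;> simp; ring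

end BPlus

attribute [local instance] LieRing.ofAssociativeRing

/-- The enveloping algebra `U(b₊)`. -/
def UBorel : Type u := UniversalEnvelopingAlgebra k (BPlus k)

instance : Ring (UBorel k) := inferInstanceAs (Ring (UniversalEnvelopingAlgebra k (BPlus k)))

instance : Algebra k (UBorel k) :=
  inferInstanceAs (Algebra k (UniversalEnvelopingAlgebra k (BPlus k)))

namespace UBorel

/-- The canonical Lie algebra map `b₊ → U(b₊)`. -/
def ι : BPlus k →ₗ⁅k⁆ UBorel k := UniversalEnvelopingAlgebra.ι k

/-- The generator `X`. -/
def X : UBorel k := ι k ⟨1, 0⟩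

/-- The generator `H`. -/
def H : UBorel k := ι k ⟨0, 1⟩

lemma ι_apply (a : BPlus k) : ι k a = a.x • X k + a.h • H k := by
  unfold X H
  rw [← map_smul, ← map_smul, ← map_add]
  congr 1
  ext <;> simp

lemma H_mul_X : H k * X k = X k * H k + X k := by
  have h : ι k ⁅(⟨0, 1⟩ : BPlus k), (⟨1, 0⟩ : BPlus k)⁆ = ⁅H k, X k⁆ := LieHom.map_lie _ _ _
  rw [Ring.lie_def] at h
  have h' : ⁅(⟨0, 1⟩ : BPlus k), (⟨1, 0⟩ : BPlus k)⁆ = ⟨1, 0⟩ := by ext <;> simp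
  rw [h'] at h
  change X k = _ at h
  nth_rewrite 3 [h]
  simp

/-- The algebra map out of `U(b₊)` with prescribed values on `X` and `H`. -/
def lift {B : Type u} [Ring B] [Algebra k B] (x h : B) (hx : h * x = x * h + x) :
    UBorel k →ₐ[k] B :=
  UniversalEnvelopingAlgebra.lift k (A := B)
    { toFun := fun a : BPlus k => a.x • x + a.h • h
      map_add' := fun a b => by simp [add_smul]; abel
      map_smul' := fun c a => by simp [smul_smul]
      map_lie' := fun {a b} => by
        simp only [BPlus.lie_x, BPlus.lie_h, Ring.lie_def, add_mul, mul_add, smul_mul_smul, hx]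
        module }

variable {k}

section lift

variable {B : Type u} [Ring B] [Algebra k B] (x h : B) (hx : h * x = x * h + x)

@[simp] lemma lift_X : lift k x h hx (X k) = x := by
  refine (UniversalEnvelopingAlgebra.lift_ι_apply k (A := B) _ _).trans ?_
  change (_ : k) • x + (_ : k) • h = _
  simp

@[simp] lemma lift_H : lift k x h hx (H k) = h := by
  refine (UniversalEnvelopingAlgebra.lift_ι_apply k (A := B) _ _).trans ?_
  change (_ : k) • x + (_ : k) • h = _
  simp

end lift

lemma hom_ext {B : Type u} [Ring B] [Algebra k B] {f f' : UBorel k →ₐ[k] B}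
    (hX : f (X k) = f' (X k)) (hH : f (H k) = f' (H k)) : f = f' := by
  apply UniversalEnvelopingAlgebra.hom_ext
  refine LieHom.ext fun a => ?_
  change f (ι k a) = f' (ι k a)
  simp [ι_apply, hX, hH]

lemma adjoin_eq_top : Algebra.adjoin k ({X k, H k} : Set (UBorel k)) = ⊤ := by
  set S := Algebra.adjoin k ({X k, H k} : Set (UBorel k)) with hS
  have hx : X k ∈ S := Algebra.subset_adjoin (by simp)
  have hh : H k ∈ S := Algebra.subset_adjoin (by simp)
  let f : UBorel k →ₐ[k] S := lift k ⟨X k, hx⟩ ⟨H k, hh⟩ (Subtype.ext (H_mul_X k))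
  have hf : S.val.comp f = AlgHom.id k _ := by
    apply hom_ext <;> simp [f]
  rw [eq_top_iff]
  intro a _
  have h1 : S.val (f a) = a := DFunLike.congr_fun hf a
  rw [← h1]
  exact (f a).2

variable (k)

/-- The coproduct, for which `X` and `H` are primitive. -/
def comulHom : UBorel k →ₐ[k] UBorel k ⊗[k] UBorel k :=
  lift k (X k ⊗ₜ 1 + 1 ⊗ₜ X k) (H k ⊗ₜ 1 + 1 ⊗ₜ H k) (by
    simp [add_mul, mul_add, H_mul_X, TensorProduct.add_tmul, TensorProduct.tmul_add]
    abel)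

/-- The counit, which vanishes on `X` and `H`. -/
def counitHom : UBorel k →ₐ[k] k := lift k 0 0 (by simp)

/-- The antipode `S X = -X`, `S H = -H`. -/
def antipodeHom : UBorel k →ₐ[k] (UBorel k)ᵐᵒᵖ :=
  lift k (MulOpposite.op (-X k)) (MulOpposite.op (-H k)) (by
    rw [← MulOpposite.op_mul, ← MulOpposite.op_mul, ← MulOpposite.op_add]
    congr 1
    simp [H_mul_X])

instance : Bialgebra k (UBorel k) :=
  Bialgebra.ofAlgHom (comulHom k) (counitHom k)
    (by
      apply hom_ext <;>
      simp [comulHom, TensorProduct.add_tmul, TensorProduct.tmul_add,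
          Algebra.TensorProduct.one_def, add_assoc])
    (by apply hom_ext <;> simp [comulHom, counitHom])
    (by apply hom_ext <;> simp [comulHom, counitHom])

lemma comul_X : Coalgebra.comul (R := k) (X k) = X k ⊗ₜ 1 + 1 ⊗ₜ X k :=
  (by simp [comulHom] : comulHom k (X k) = X k ⊗ₜ 1 + 1 ⊗ₜ X k)

lemma comul_H : Coalgebra.comul (R := k) (H k) = H k ⊗ₜ 1 + 1 ⊗ₜ H k :=
  (by simp [comulHom] : comulHom k (H k) = H k ⊗ₜ 1 + 1 ⊗ₜ H k)

lemma counit_X : Coalgebra.counit (R := k) (X k) = 0 :=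
  (by simp [counitHom] : counitHom k (X k) = 0)

lemma counit_H : Coalgebra.counit (R := k) (H k) = 0 :=
  (by simp [counitHom] : counitHom k (H k) = 0)

lemma antiLinear_antipodeHom_X : antiLinear (antipodeHom k) (X k) = -X k := by
  simp [antiLinear_apply, antipodeHom]

lemma antiLinear_antipodeHom_H : antiLinear (antipodeHom k) (H k) = -H k := by
  simp [antiLinear_apply, antipodeHom]

instance : HopfAlgebra k (UBorel k) :=
  hopfOfGenerators (antipodeHom k) _ adjoin_eq_top
    (by
      rintro a (rfl | rfl)
      · simp [comul_X, counit_X, antiLinear_antipodeHom_X, antiLinear_apply (antipodeHom k) 1]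
      · simp [comul_H, counit_H, antiLinear_antipodeHom_H, antiLinear_apply (antipodeHom k) 1])
    (by
      rintro a (rfl | rfl)
      · simp [comul_X, counit_X, antiLinear_antipodeHom_X, antiLinear_apply (antipodeHom k) 1]
      · simp [comul_H, counit_H, antiLinear_antipodeHom_H, antiLinear_apply (antipodeHom k) 1])

/-- The operator `e(n, m) ↦ e(n + 1, m)`, left multiplication by `X` on monomials. -/
def regX : Module.End k (ℕ × ℕ →₀ k) :=
  Finsupp.linearCombination k fun p => Finsupp.single (p.1 + 1, p.2) 1

/-- The operator `e(n, m) ↦ e(n, m + 1) + n e(n, m)`, left multiplication by `H` on monomials. -/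
def regH : Module.End k (ℕ × ℕ →₀ k) :=
  Finsupp.linearCombination k fun p =>
    Finsupp.single (p.1, p.2 + 1) 1 + Finsupp.single p (p.1 : k)

/-- The left regular representation in terms of monomials. -/
def reg : UBorel k →ₐ[k] Module.End k (ℕ × ℕ →₀ k) :=
  lift k (regX k) (regH k) (by
    refine Finsupp.lhom_ext' fun p => LinearMap.ext_ring ?_
    simp [regX, regH, add_assoc, Finsupp.single_add])

/-- The coordinates with respect to the monomials `X ^ n H ^ m`. -/
def coord : UBorel k →ₗ[k] (ℕ × ℕ →₀ k) :=
  (LinearMap.applyₗ (Finsupp.single (0, 0) (1 : k))) ∘ₗ (reg k).toLinearMap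

/-- The coordinates of `X ^ n H ^ m`; in particular these monomials are linearly independent. -/
lemma coord_X_pow_mul_H_pow (n m : ℕ) : coord k (X k ^ n * H k ^ m) = Finsupp.single (n, m) 1 := by
  have h1 : ∀ n m : ℕ, (reg k (X k) ^ n) (Finsupp.single (0, m) (1 : k)) =
      Finsupp.single (n, m) 1 := by
    intro n m
    induction n with
    | zero => simp
    | succ n ih => rw [pow_succ', Module.End.mul_apply, ih]; simp [reg, regX]
  have h2 : ∀ m : ℕ, (reg k (H k) ^ m) (Finsupp.single (0, 0) (1 : k)) =
      Finsupp.single (0, m) 1 := by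
    intro m
    induction m with
    | zero => simp
    | succ n ih => rw [pow_succ', Module.End.mul_apply, ih]; simp [reg, regH]
  simp [coord, h1, h2]

end UBorel

end UBorel

/-! ### Bicovariant first order differential calculi -/

section Calculi

open Coalgebra

/-- A bicovariant first order differential calculus over a Hopf algebra `A`: an `A`-bimodule
`Form` of one-forms with a differential `d` obeying the Leibniz rule, such that the elements
`a • d b` span `Form`, and with left and right coactions of `A` for which
`a • d b ↦ Δ(a) (id ⊗ d) Δ(b)` and `a • d b ↦ Δ(a) (d ⊗ id) Δ(b)`. These two formulas determine the
coactions, and imply that they are coactions which are compatible with each other and with the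
bimodule structure. -/
structure BicovariantCalculus (k A : Type u) [Field k] [Ring A] [HopfAlgebra k A] :
    Type (u + 1) where
  /-- the space of one-forms -/
  Form : Type u
  [addCommGroup : AddCommGroup Form]
  [module : Module k Form]
  [leftModule : Module A Form]
  [rightModule : Module Aᵐᵒᵖ Form]
  [leftTower : IsScalarTower k A Form]
  [rightTower : IsScalarTower k Aᵐᵒᵖ Form]
  [bimodule : SMulCommClass A Aᵐᵒᵖ Form]
  /-- the differential -/
  d : A →ₗ[k] Form
  leibniz : ∀ a b : A, d (a * b) = a • d b + MulOpposite.op b • d a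
  span_d : Submodule.span A (Set.range d) = ⊤
  /-- the left coaction -/
  leftCoaction : Form →ₗ[k] A ⊗[k] Form
  /-- the right coaction -/
  rightCoaction : Form →ₗ[k] Form ⊗[k] A
  leftCoaction_smul_d : ∀ a b : A, leftCoaction (a • d b) =
    TensorProduct.map₂ (LinearMap.mul k A) (Algebra.lsmul k k Form).toLinearMap
      (comul (R := k) a) (d.lTensor A (comul (R := k) b))
  rightCoaction_smul_d : ∀ a b : A, rightCoaction (a • d b) =
    TensorProduct.map₂ (Algebra.lsmul k k Form).toLinearMap (LinearMap.mul k A)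
      (comul (R := k) a) (d.rTensor A (comul (R := k) b))

attribute [instance] BicovariantCalculus.addCommGroup BicovariantCalculus.module
  BicovariantCalculus.leftModule BicovariantCalculus.rightModule BicovariantCalculus.leftTower
  BicovariantCalculus.rightTower BicovariantCalculus.bimodule

namespace BicovariantCalculus

variable {k A : Type u} [Field k] [Ring A] [HopfAlgebra k A]

/-- Bimodule maps between the one-forms that intertwine the differentials. -/
def IsHom (Γ Γ' : BicovariantCalculus k A) (f : Γ.Form →ₗ[A] Γ'.Form) : Prop :=
  (∀ (a : A) (v : Γ.Form), f (MulOpposite.op a • v) = MulOpposite.op a • f v) ∧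
    ∀ a : A, f (Γ.d a) = Γ'.d a

/-- Isomorphism of calculi. -/
def Iso (Γ Γ' : BicovariantCalculus k A) : Prop :=
  ∃ f : Γ.Form →ₗ[A] Γ'.Form, Γ.IsHom Γ' f ∧ Function.Bijective f

/-- A calculus is coirreducible if it is nonzero and has no quotients except zero and itself.
(A morphism of calculi is automatically surjective.) -/
def IsCoirreducible (Γ : BicovariantCalculus k A) : Prop :=
  Nontrivial Γ.Form ∧ ∀ (Γ' : BicovariantCalculus k A) (f : Γ.Form →ₗ[A] Γ'.Form),
    Γ.IsHom Γ' f → Subsingleton Γ'.Form ∨ Function.Injective f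

/-- The space of right invariant one-forms. -/
def rightInvariant (Γ : BicovariantCalculus k A) : Submodule k Γ.Form :=
  LinearMap.eqLocus Γ.rightCoaction ((TensorProduct.mk k Γ.Form A).flip 1)

/-- The dimension of a calculus is the dimension of its space of right invariant one-forms. -/
def IsFiniteDimensional (Γ : BicovariantCalculus k A) : Prop :=
  FiniteDimensional k Γ.rightInvariant

/-- The dimension of a (finite dimensional) calculus. -/
def dim (Γ : BicovariantCalculus k A) : ℕ := Module.finrank k Γ.rightInvariant

/-- A right invariant basis `η 0, …, η (n - 1)`: right invariant one-forms which form a basis of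
the one-forms as a right `A`-module. -/
def IsRightInvariantBasis (Γ : BicovariantCalculus k A) (n : ℕ) (η : ℕ → Γ.Form) : Prop :=
  (∀ i < n, η i ∈ Γ.rightInvariant) ∧
    LinearIndependent Aᵐᵒᵖ (fun i : Fin n => η i) ∧
    Submodule.span Aᵐᵒᵖ (Set.range fun i : Fin n => η i) = ⊤

/-- The right Maurer-Cartan form `ω(a) = d(a₁) S(a₂)`. -/
def maurerCartan (Γ : BicovariantCalculus k A) : A →ₗ[k] Γ.Form :=
  TensorProduct.lift
    (((Algebra.lsmul k k Γ.Form).toLinearMap ∘ₗ (MulOpposite.opLinearEquiv k).toLinearMap ∘ₗ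
      HopfAlgebra.antipode k (A := A)).flip ∘ₗ Γ.d) ∘ₗ comul

/-- The crossed submodule `M ⊆ ker ε` that determines the calculus up to isomorphism:
the one-forms are `(ker ε / M) ⊗ A` with `d a = [a₁ - ε(a₁)] ⊗ a₂`, and `[a] ⊗ 1` is `ω(a)`. -/
def ideal (Γ : BicovariantCalculus k A) : Submodule k A :=
  LinearMap.ker (counit (R := k) (A := A)) ⊓ LinearMap.ker Γ.maurerCartan

end BicovariantCalculus

/-! ### Quantum tangent spaces -/

section Tangent

variable {k A H : Type u} [Field k] [Ring A] [HopfAlgebra k A] [Ring H] [HopfAlgebra k H]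

/-- The map `x ↦ f(x₁) x₂`. -/
def contractLeft (f : H →ₗ[k] k) : H →ₗ[k] H :=
  (TensorProduct.lid k H).toLinearMap ∘ₗ f.rTensor H ∘ₗ comul

/-- The adjoint action `h ▷ x = h₁ x S(h₂)`. -/
def adjointAction (h x : H) : H :=
  LinearMap.mul' k H
    (TensorProduct.map (LinearMap.mulRight k x) (HopfAlgebra.antipode k) (comul (R := k) h))

/-- The coregular action of `a` on `x`, that is `⟨x₁, a⟩ x₂`, followed by the projection
`y ↦ y - ε(y) 1` to `ker ε`. -/
def coregularAction (B : H →ₗ[k] A →ₗ[k] k) (a : A) (x : H) : H :=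
  contractLeft (B.flip a) x - counit (R := k) (contractLeft (B.flip a) x) • (1 : H)

/-- Quantum tangent spaces: subspaces of `ker ε ⊆ H` invariant under the adjoint action of `H`
and the projected coregular action of `A`. Here `B` is the pairing of `H` with `A`. -/
def IsQuantumTangentSpace (B : H →ₗ[k] A →ₗ[k] k) (L : Submodule k H) : Prop :=
  L ≤ LinearMap.ker (counit (R := k) (A := H)) ∧
    (∀ h : H, ∀ x ∈ L, adjointAction (k := k) h x ∈ L) ∧
    ∀ a : A, ∀ x ∈ L, coregularAction B a x ∈ L

/-- Irreducible quantum tangent spaces. -/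
def IsIrreducibleTangentSpace (B : H →ₗ[k] A →ₗ[k] k) (L : Submodule k H) : Prop :=
  IsQuantumTangentSpace B L ∧ L ≠ ⊥ ∧
    ∀ L' ≤ L, IsQuantumTangentSpace B L' → L' = ⊥ ∨ L' = L

/-- The subspace of `ker ε ⊆ H` that annihilates the crossed submodule of the calculus. -/
def BicovariantCalculus.tangentSpace (Γ : BicovariantCalculus k A) (B : H →ₗ[k] A →ₗ[k] k) :
    Submodule k H :=
  LinearMap.ker (counit (R := k) (A := H)) ⊓ Γ.ideal.dualAnnihilator.comap B

/-- The braided derivation `∂_x(a) = ⟨x, a₁⟩ a₂`. -/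
def braidedDerivation (B : H →ₗ[k] A →ₗ[k] k) (x : H) : A →ₗ[k] A := contractLeft (B x)

/-- `φ` is the basis of the subspace `L` dual to the right invariant basis `η`: the `i`-th
coordinate of the right invariant form `ω(a)` with respect to `η` is `⟨φ i, a⟩`. -/
def IsDualBasis (B : H →ₗ[k] A →ₗ[k] k) (Γ : BicovariantCalculus k A) (L : Submodule k H) (n : ℕ)
    (η : ℕ → Γ.Form) (φ : ℕ → H) : Prop :=
  LinearIndependent k (fun i : Fin n => φ i) ∧
    Submodule.span k (Set.range fun i : Fin n => φ i) = L ∧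
    ∀ a : A, counit (R := k) a = 0 →
      Γ.maurerCartan a = ∑ i ∈ Finset.range n, B (φ i) a • η i

end Tangent

end Calculi

/-! ### The algebras, pairings and classical limits -/

section Borel

variable (k : Type u) [Field k]

/-- `U_q(b₊)`, identified with `C_q(B₊)`, over the field `k(q)`. -/
abbrev Uq : Type u :=
  QBorel (RatFunc k) (Units.mk0 (RatFunc.X : RatFunc k) RatFunc.X_ne_zero)

/-- `C(B₊)`, obtained by setting `q = 1`. -/
abbrev CB : Type u := QBorel k 1

/-- The factorial `[n]_q!`. -/
def qFactorial {K : Type u} [Field K] (q : K) (n : ℕ) : K :=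
  ∏ i ∈ Finset.range n, ∑ j ∈ Finset.range (i + 1), q ^ j

/-- The self-pairing
`⟨X ^ n g ^ m, X ^ r g ^ s⟩ = δ_{n, r} [n]_q! q ^ (-n (n - 1) / 2) q ^ (-m s)` of `U_q(b₊)`. -/
def qPairing : Uq k →ₗ[RatFunc k] Uq k →ₗ[RatFunc k] RatFunc k :=
  (Finsupp.linearCombination (RatFunc k) fun p : ℕ × ℤ =>
    Finsupp.linearCombination (RatFunc k) fun r : ℕ × ℤ =>
      if p.1 = r.1 then
        qFactorial (RatFunc.X : RatFunc k) p.1 *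
          (RatFunc.X : RatFunc k) ^ (-((p.1 * (p.1 - 1) / 2 : ℕ) : ℤ)) *
          (RatFunc.X : RatFunc k) ^ (-(p.2 * r.2))
      else 0).compl₁₂ (QBorel.coord _ _) (QBorel.coord _ _)

lemma qPairing_monomial (p r : ℕ × ℤ) :
    qPairing k (QBorel.monomial _ _ p) (QBorel.monomial _ _ r) =
      if p.1 = r.1 then
        qFactorial (RatFunc.X : RatFunc k) p.1 *
          (RatFunc.X : RatFunc k) ^ (-((p.1 * (p.1 - 1) / 2 : ℕ) : ℤ)) *
          (RatFunc.X : RatFunc k) ^ (-(p.2 * r.2))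
      else 0 := by
  simp [qPairing, QBorel.coord_monomial]

/-- The pairing `⟨X ^ r g ^ s, X ^ n H ^ m⟩ = δ_{n, r} n! s ^ m` of `C(B₊)` with `U(b₊)`. -/
def pairing : CB k →ₗ[k] UBorel k →ₗ[k] k :=
  (Finsupp.linearCombination k fun p : ℕ × ℤ =>
    Finsupp.linearCombination k fun r : ℕ × ℕ =>
      if p.1 = r.1 then (p.1.factorial : k) * (p.2 : k) ^ r.2 else 0).compl₁₂
    (QBorel.coord _ _) (UBorel.coord k)

lemma pairing_monomial (p : ℕ × ℤ) (n m : ℕ) :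
    pairing k (QBorel.monomial _ _ p) (UBorel.X k ^ n * UBorel.H k ^ m) =
      if p.1 = n then (p.1.factorial : k) * (p.2 : k) ^ m else 0 := by
  simp [pairing, QBorel.coord_monomial, UBorel.coord_X_pow_mul_H_pow]

variable {k}

/-- The element `∑ c(n, m) X ^ n g ^ m` of `U_q(b₊)`. -/
def ofCoeffs (c : ℕ × ℤ →₀ RatFunc k) : Uq k := c.sum fun p f => f • QBorel.monomial _ _ p

variable (k) in
/-- The Laurent series `e ^ (-t)`. -/
def expNegT : LaurentSeries k :=
  HahnSeries.ofPowerSeries ℤ k (PowerSeries.mk fun j => (-1) ^ j * ((j.factorial : k))⁻¹)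

variable (k) in
/-- The Laurent series `e ^ (m t H)` with coefficients in `U(b₊)`. -/
def expTH (m : ℤ) : HahnSeries ℤ (UBorel k) :=
  HahnSeries.ofPowerSeries ℤ (UBorel k)
    (PowerSeries.mk fun j => ((m : k) ^ j * ((j.factorial : k))⁻¹) • UBorel.H k ^ j)

/-- The Laurent series in `t` with coefficients in `U(b₊)` obtained from `∑ c(n, m) X ^ n g ^ m` by
the substitutions `q = e ^ (-t)` and `g = e ^ (t H)`. -/
def expand (c : ℕ × ℤ →₀ RatFunc k) : HahnSeries ℤ (UBorel k) :=
  c.sum fun p f =>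
    (RatFunc.eval (algebraMap k (LaurentSeries k)) (expNegT k) f).map (algebraMap k (UBorel k)) *
      HahnSeries.C (UBorel.X k ^ p.1) * expTH k p.2

/-- The limit `q → 1` of a subspace of `U_q(b₊)` in `U(b₊)`: substitute `q = e ^ (-t)` and
`g = e ^ (t H)` in its elements and keep the lowest order in `t`. -/
def limitU (M : Submodule (RatFunc k) (Uq k)) : Set (UBorel k) :=
  {y | ∃ c : ℕ × ℤ →₀ RatFunc k, ofCoeffs c ∈ M ∧ (expand c).leadingCoeff = y}

/-- The limit `q → 1` of a subspace of `C_q(B₊)` in `C(B₊)`: set `q = 1` in those of its elements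
whose coefficients with respect to the monomials `X ^ n g ^ m` have no pole at `q = 1`. (Any other
ordering of the monomials changes them by powers of `q` and gives the same limit.) -/
def limitC (L : Submodule (RatFunc k) (Uq k)) : Set (CB k) :=
  {y | ∃ c : ℕ × ℤ →₀ RatFunc k, ofCoeffs c ∈ L ∧ (∀ p, (c p).denom.eval 1 ≠ 0) ∧
    c.sum (fun p f => RatFunc.eval (RingHom.id k) 1 f • QBorel.monomial k 1 p) = y}

/-- The calculus `Γ` on `U(b₊)` is the limit `q → 1` of the calculus `Γq` on `U_q(b₊)`. -/
def IsLimit (Γq : BicovariantCalculus (RatFunc k) (Uq k)) (Γ : BicovariantCalculus k (UBorel k)) :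
    Prop :=
  (Γ.ideal : Set (UBorel k)) = limitU Γq.ideal

/-- The normal ordering `k[X, H] → U(b₊)`, `H ^ n X ^ m ↦ H ^ n X ^ m`, where the variables with
index `0` and `1` are `X` and `H`. -/
def normalOrder : MvPolynomial (Fin 2) k →ₗ[k] UBorel k :=
  (MvPolynomial.basisMonomials (Fin 2) k).constr k fun s => UBorel.H k ^ s 1 * UBorel.X k ^ s 0

/-- The shift `f(X, H) ↦ f(X, H + a)`. -/
def shiftH (a : k) : MvPolynomial (Fin 2) k →ₐ[k] MvPolynomial (Fin 2) k :=
  MvPolynomial.aeval ![MvPolynomial.X 0, MvPolynomial.X 1 + MvPolynomial.C a]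

end Borel

end BorelCalculi

end

open BorelCalculi

/-!
Everything reduces to finite sets `J` of positive integers.

*Calculi and crossed submodules.* Let `ω(a) = d(a₁) S(a₂)` be the right Maurer-Cartan form of a
calculus `Γ` on a Hopf algebra `A`. One-forms can be written as sums of `ω(x) y`, and `ω(x) y` determines
`ω(x) ⊗ y` because `ω(x)` is right invariant (`coords_frame`); so `Γ ≅ (A / ker ω) ⊗ A`. The Galois
map `x ⊗ y ↦ x₁ ⊗ x₂ y`, a surjection of `A ⊗ A`, turns the left action and the coactions into
codiagonal ones, so that morphisms of calculi are governed by inclusions of crossed submodules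
(`exists_isHom`, `iso_iff`), and every left ideal in `ker ε` stable under the adjoint coaction
`a ↦ a₁ S(a₃) ⊗ a₂` comes from a calculus (`exists_calculus`). If it is the annihilator of a finite
dimensional `L ⊆ ker ε` in a Hopf algebra paired nondegenerately with `A`, then the quantum tangent
space is `L` and the right invariant forms are its dual (`finrank_rightInvariant`, `tangentSpace_eq`).

*Classification over `k(q)`.* To `J` belongs the space `tangent K q J` spanned by the `g ^ (-j) - 1` and
the `X ^ n g ^ (-j)` with `1 ≤ n ≤ j`, for `j ∈ J`. Since `q` is not a root of unity, the actions of `g`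
separate monomials, and the actions of `X` move `n` up to `j` and down to `0`; this shows that all
finite dimensional quantum tangent spaces are of this form (`exists_eq_tangent`). On the dual side, a
crossed submodule `M` is graded by the degree in `X`, thus described by the ideals of polynomials `p`
with `X ^ n p(g) ∈ M`. Finite codimension puts a power `X ^ N` into `M`. The component of the adjoint
coaction that lowers the degree shows that these ideals contain explicit products of distinct linear
factors with zeros `q ^ j`, so they are determined by their zeros, and these are given by the set `J`
of exponents of the zeros in degree `0`: `M` is the annihilator of `tangent K q J`
(`exists_eq_annihilator`); conversely all these annihilators occur (`exists_calculus_of_tangent`).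
Inclusions of crossed submodules reverse inclusions of sets, intersections of crossed submodules
correspond to unions of sets, and the coirreducible calculi, like the irreducible tangent spaces,
are those with `J = {j}`; their dimension is `j + 1`.

*Limits.* The space `tangent K q J` is cut out by conditions on the coordinates that do not involve `q`,
so its limit is the space of the same shape in `C(B₊)` (`limitC_tangentQ`). For crossed submodules,
expand an element by `q = e ^ (-t)`, `g = e ^ (t H)`: pairing coefficientwise with `X ^ n g ^ (-j)` gives
a multiple of the expansion of the pairing over `k(q)` (`map_pairing_expand`), so leading coefficients
of elements of the annihilator of `tangent K q J` lie in the classical annihilator. Conversely,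
`(g - q ^ j) / (1 - q)` specializes to `H + j`, which lifts polynomials in `H` vanishing at `-j` to
polynomials in `g` vanishing at `q ^ j`. Hence the limit is the annihilator of the limit of the tangent
space (`limitU_annihilator`). As `U(b₊)` is cocommutative, this left ideal is a crossed submodule.

*The coirreducible limits.* For `J = {j}` the basis `g ^ (-j) - 1`, `X ^ i g ^ (-j) / i!` of the tangent
space is dual to the classes of `-H / j`, `X ^ i` (`basis_of_limit`). The commutators of `H` and `X` with
`ω(a)` are `ω(H a)` and `ω(X a)`, which are evaluated by the pairing, and `X ^ i g ^ s` acts in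
normal ordering by `(∂/∂X) ^ i` followed by the shift `H ↦ H + s + i`
(`contractLeft_pairing_normalOrder`).
-/

noncomputable section

namespace BorelCalculi

universe u

open scoped TensorProduct

/-! ### The adjoint coaction and the Galois map -/

section Hopf

open Coalgebra WithConv

variable {k A : Type u} [Field k] [Ring A] [HopfAlgebra k A]

variable (k A) in
/-- The left adjoint coaction `a ↦ a₁ S(a₃) ⊗ a₂`. -/
def adCoaction : A →ₗ[k] A ⊗[k] A :=
  (toConv (comul (R := k) (A := A)) * toConv ((Algebra.TensorProduct.includeLeft :
    A →ₐ[k] A ⊗[k] A).toLinearMap ∘ₗ HopfAlgebra.antipode k)).ofConv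

variable (k A) in
/-- The Galois map `x ⊗ y ↦ x₁ ⊗ x₂ y`. -/
def galois : A ⊗[k] A →ₗ[k] A ⊗[k] A :=
  TensorProduct.lift ((LinearMap.mul k (A ⊗[k] A)).compl₁₂ comul
    (Algebra.TensorProduct.includeRight : A →ₐ[k] A ⊗[k] A).toLinearMap)

lemma galois_tmul (x y : A) : galois k A (x ⊗ₜ y) = comul (R := k) x * 1 ⊗ₜ y := rfl

lemma conv_apply {B : Type u} [Ring B] [Algebra k B] (f g : A →ₗ[k] B) (a : A) :
    (toConv f * toConv g).ofConv a =
      LinearMap.mul' k B (TensorProduct.map f g (comul (R := k) a)) := rfl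

lemma comul_eq_conv : toConv (comul (R := k) (A := A)) =
    toConv (Algebra.TensorProduct.includeLeft : A →ₐ[k] A ⊗[k] A).toLinearMap *
      toConv (Algebra.TensorProduct.includeRight : A →ₐ[k] A ⊗[k] A).toLinearMap := by
  ext a
  change _ = LinearMap.mul' k _ (TensorProduct.map _ _ (comul (R := k) a))
  generalize comul (R := k) a = t
  induction t with
  | zero => simp
  | add x y hx hy => rw [map_add, map_add, ← hx, ← hy]
  | tmul x y => simp

lemma antipode_conv {B : Type u} [Ring B] [Algebra k B] (f : A →ₐ[k] B) :
    toConv (f.toLinearMap ∘ₗ HopfAlgebra.antipode k) * toConv f.toLinearMap = 1 := by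
  ext a
  have := LinearMap.algHom_comp_convMul_distrib f (toConv (HopfAlgebra.antipode k (A := A)))
    (toConv LinearMap.id)
  rw [LinearMap.antipode_mul_id] at this
  have h2 := LinearMap.congr_fun this a
  simp only [LinearMap.comp_id] at h2
  change _ = (_ : WithConv (A →ₗ[k] B)).ofConv a at h2
  exact h2.symm.trans (by simp [LinearMap.convOne_def])

lemma conv_antipode {B : Type u} [Ring B] [Algebra k B] (f : A →ₐ[k] B) :
    toConv f.toLinearMap * toConv (f.toLinearMap ∘ₗ HopfAlgebra.antipode k) = 1 := by
  ext a
  have := LinearMap.algHom_comp_convMul_distrib f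
    (toConv LinearMap.id) (toConv (HopfAlgebra.antipode k (A := A)))
  rw [LinearMap.id_mul_antipode] at this
  have h2 := LinearMap.congr_fun this a
  simp only [LinearMap.comp_id] at h2
  exact h2.symm.trans (by simp [LinearMap.convOne_def])

lemma galois_mul_tmul (z : A ⊗[k] A) (y : A) :
    galois k A (z * 1 ⊗ₜ y) = galois k A z * 1 ⊗ₜ y := by
  induction z with
  | zero => simp
  | add a b ha hb => simp only [add_mul, map_add, ha, hb]
  | tmul a b => simp [galois_tmul, mul_assoc]

lemma galois_surjective : Function.Surjective (galois k A) := by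
  rw [← LinearMap.range_eq_top, eq_top_iff]
  rintro z -
  induction z with
  | zero => exact zero_mem _
  | add a b ha hb => exact add_mem ha hb
  | tmul x y =>
    -- the preimage `x₁ ⊗ S(x₂) y`
    refine ⟨(HopfAlgebra.antipode k).lTensor A (comul (R := k) x) * 1 ⊗ₜ y, ?_⟩
    rw [galois_mul_tmul]
    have h : galois k A ((HopfAlgebra.antipode k).lTensor A (comul (R := k) x)) =
        (toConv (comul (R := k) (A := A)) * toConv ((Algebra.TensorProduct.includeRight :
          A →ₐ[k] A ⊗[k] A).toLinearMap ∘ₗ HopfAlgebra.antipode k)).ofConv x := by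
      rw [conv_apply]
      generalize comul (R := k) x = t
      induction t with
      | zero => simp
      | add x y hx hy => simp only [map_add, hx, hy]
      | tmul x y => simp [galois_tmul]
    rw [h, comul_eq_conv, mul_assoc, conv_antipode, mul_one]
    simp

variable (k A) in
/-- The map `x ⊗ y ↦ x₁ S(x₃) y₁ ⊗ x₂ ⊗ y₂`, which is the codiagonal left coaction on `A ⊗ A`
for the adjoint coaction on the first factor. -/
def codiag : A ⊗[k] A →ₗ[k] A ⊗[k] (A ⊗[k] A) :=
  TensorProduct.lift ((LinearMap.mul k (A ⊗[k] (A ⊗[k] A))).compl₁₂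
    ((Algebra.TensorProduct.map (AlgHom.id k A)
      (Algebra.TensorProduct.includeLeft : A →ₐ[k] A ⊗[k] A)).toLinearMap ∘ₗ adCoaction k A)
    ((Algebra.TensorProduct.map (AlgHom.id k A)
      (Algebra.TensorProduct.includeRight : A →ₐ[k] A ⊗[k] A)).toLinearMap ∘ₗ comul))

lemma codiag_tmul (x y : A) : codiag k A (x ⊗ₜ y) =
    Algebra.TensorProduct.map (AlgHom.id k A)
      (Algebra.TensorProduct.includeLeft : A →ₐ[k] A ⊗[k] A) (adCoaction k A x) *
    Algebra.TensorProduct.map (AlgHom.id k A)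
      (Algebra.TensorProduct.includeRight : A →ₐ[k] A ⊗[k] A) (comul (R := k) y) := rfl

lemma codiag_mul_tmul (z : A ⊗[k] A) (b : A) : codiag k A (z * 1 ⊗ₜ b) =
    codiag k A z * Algebra.TensorProduct.map (AlgHom.id k A)
      (Algebra.TensorProduct.includeRight : A →ₐ[k] A ⊗[k] A) (comul (R := k) b) := by
  induction z with
  | zero => simp
  | add a b ha hb => simp only [add_mul, map_add, ha, hb]
  | tmul x y =>
    rw [Algebra.TensorProduct.tmul_mul_tmul, mul_one, codiag_tmul, codiag_tmul,
      Bialgebra.comul_mul, map_mul, mul_assoc]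

/-- The codiagonal coaction is transported by the Galois map to
`a ⊗ b ↦ a₁ b₁ ⊗ a₂ ⊗ b₂`. -/
lemma codiag_galois (a b : A) : codiag k A (galois k A (a ⊗ₜ b)) =
    comul.lTensor A (comul (R := k) a) * Algebra.TensorProduct.map (AlgHom.id k A)
      (Algebra.TensorProduct.includeRight : A →ₐ[k] A ⊗[k] A) (comul (R := k) b) := by
  rw [galois_tmul, codiag_mul_tmul]
  congr 1
  set e12 := Algebra.TensorProduct.map (AlgHom.id k A)
      (Algebra.TensorProduct.includeLeft : A →ₐ[k] A ⊗[k] A) with he12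
  set e13 := Algebra.TensorProduct.map (AlgHom.id k A)
      (Algebra.TensorProduct.includeRight : A →ₐ[k] A ⊗[k] A) with he13
  have h1 : codiag k A (comul (R := k) a) =
      (toConv (e12.toLinearMap ∘ₗ adCoaction k A) * toConv (e13.toLinearMap ∘ₗ comul)).ofConv a := by
    rw [conv_apply]
    generalize comul (R := k) a = t
    induction t with
    | zero => simp
    | add x y hx hy => simp only [map_add, hx, hy]
    | tmul x y => rfl
  rw [h1]
  have h2 : toConv (e13.toLinearMap ∘ₗ comul) =
      toConv (e13.comp Algebra.TensorProduct.includeLeft).toLinearMap *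
      toConv (e13.comp Algebra.TensorProduct.includeRight).toLinearMap := by
    have := LinearMap.algHom_comp_convMul_distrib (C := A) e13
      (toConv (Algebra.TensorProduct.includeLeft : A →ₐ[k] A ⊗[k] A).toLinearMap)
      (toConv (Algebra.TensorProduct.includeRight : A →ₐ[k] A ⊗[k] A).toLinearMap)
    rw [← comul_eq_conv] at this
    exact congrArg toConv this
  have h3 : toConv (e12.toLinearMap ∘ₗ adCoaction k A) =
      toConv (e12.toLinearMap ∘ₗ comul) *
      toConv ((e13.comp Algebra.TensorProduct.includeLeft).toLinearMap ∘ₗ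
        HopfAlgebra.antipode k) := by
    have := LinearMap.algHom_comp_convMul_distrib (C := A) e12
      (toConv (comul (R := k) (A := A))) (toConv ((Algebra.TensorProduct.includeLeft :
    A →ₐ[k] A ⊗[k] A).toLinearMap ∘ₗ HopfAlgebra.antipode k))
    refine (congrArg toConv this).trans ?_
    rw [toConv_ofConv]
    congr 2
  rw [h2, h3, mul_assoc, ← mul_assoc (toConv (_ ∘ₗ HopfAlgebra.antipode k)), antipode_conv,
    one_mul, conv_apply, ← Coalgebra.coassoc_apply]
  generalize comul (R := k) a = t
  induction t with
  | zero => simp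
  | add x y hx hy => simp only [map_add, hx, hy]
  | tmul x y =>
    simp only [TensorProduct.map_tmul, LinearMap.rTensor_tmul, LinearMap.mul'_apply,
      LinearMap.comp_apply]
    generalize comul (R := k) x = s
    induction s with
    | zero => simp
    | add x y hx hy => simp only [map_add, add_mul, TensorProduct.add_tmul, hx, hy]
    | tmul x z => simp [e12, e13]

lemma assoc_symm_comul_galois (a b : A) :
    (TensorProduct.assoc k A A A).symm (comul.lTensor A (galois k A (a ⊗ₜ b))) =
      comul.rTensor A (comul (R := k) a) * Algebra.TensorProduct.map
        (Algebra.TensorProduct.includeRight : A →ₐ[k] A ⊗[k] A) (AlgHom.id k A)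
        (comul (R := k) b) := by
  rw [← coassoc_symm_apply, galois_tmul]
  generalize comul (R := k) a = s
  induction s with
  | zero => simp
  | add x y hx hy => simp only [map_add, add_mul, hx, hy]
  | tmul x y =>
    simp only [LinearMap.lTensor_tmul, Algebra.TensorProduct.tmul_mul_tmul, mul_one,
      Bialgebra.comul_mul]
    generalize comul (R := k) b = t
    generalize comul (R := k) y = s
    induction t with
    | zero => simp
    | add x y hx hy => simp only [map_add, mul_add, TensorProduct.tmul_add, hx, hy]
    | tmul x' y' =>
      induction s with
      | zero => simp
      | add x y hx hy => simp only [map_add, add_mul, TensorProduct.tmul_add, hx, hy]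
      | tmul x'' y'' => simp

lemma adCoaction_one : adCoaction k A 1 = 1 ⊗ₜ 1 := by
  simp [adCoaction, Algebra.TensorProduct.one_def]

variable (k) in
/-- The operator `x ⊗ y ↦ Δ(x) t (S(y) ⊗ 1)`. -/
def conjBy (t : A ⊗[k] A) : A ⊗[k] A →ₗ[k] A ⊗[k] A :=
  TensorProduct.lift ((LinearMap.mul k (A ⊗[k] A)).compl₁₂
    (LinearMap.mulRight k t ∘ₗ comul) ((Algebra.TensorProduct.includeLeft :
    A →ₐ[k] A ⊗[k] A).toLinearMap ∘ₗ HopfAlgebra.antipode k))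

lemma conjBy_tmul (t : A ⊗[k] A) (x y : A) : conjBy k t (x ⊗ₜ y) =
    comul (R := k) x * t * HopfAlgebra.antipode k y ⊗ₜ 1 := rfl

/-- `Ad(a b) = Δ(a₁) Ad(b) (S(a₂) ⊗ 1)`. -/
lemma adCoaction_mul (a b : A) :
    adCoaction k A (a * b) = conjBy k (adCoaction k A b) (comul (R := k) a) := by
  rw [adCoaction, conv_apply, conv_apply, Bialgebra.comul_mul]
  generalize comul (R := k) a = s
  generalize comul (R := k) b = t
  induction s with
  | zero => simp
  | add x y hx hy => simp only [map_add, add_mul, hx, hy]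
  | tmul x y =>
    rw [conjBy_tmul]
    induction t with
    | zero => simp
    | add x y hx hy => simp only [map_add, add_mul, mul_add, hx, hy]
    | tmul x' y' =>
      simp [HopfAlgebra.antipode_mul_antidistrib, mul_assoc]

end Hopf

/-! ### The structure of bicovariant calculi -/

lemma exists_comp_eq_of_ker_le {k U V W : Type*} [Field k] [AddCommGroup U] [Module k U]
    [AddCommGroup V] [Module k V] [AddCommGroup W] [Module k W] {f : U →ₗ[k] V} {g : U →ₗ[k] W}
    (h : LinearMap.ker f ≤ LinearMap.ker g) : ∃ e : V →ₗ[k] W, e ∘ₗ f = g := by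
  obtain ⟨e, he⟩ := LinearMap.exists_extend
    ((LinearMap.ker f).liftQ g h ∘ₗ f.quotKerEquivRange.symm.toLinearMap)
  refine ⟨e, LinearMap.ext fun u => ?_⟩
  have h1 := LinearMap.congr_fun he ⟨f u, LinearMap.mem_range_self f u⟩
  refine h1.trans ?_
  have h2 : f.quotKerEquivRange.symm ⟨f u, LinearMap.mem_range_self f u⟩ =
      (LinearMap.ker f).mkQ u := by
    rw [LinearEquiv.symm_apply_eq]
    rfl
  change (LinearMap.ker f).liftQ g h (f.quotKerEquivRange.symm _) = _
  rw [h2]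
  simp

section Structure

open Coalgebra WithConv

namespace BicovariantCalculus

variable {k A : Type u} [Field k] [Ring A] [HopfAlgebra k A] (Γ : BicovariantCalculus k A)

/-- The right action, as a linear map on `Γ ⊗ A`. -/
def rightAct : Γ.Form ⊗[k] A →ₗ[k] Γ.Form :=
  TensorProduct.lift ((Algebra.lsmul k k Γ.Form).toLinearMap ∘ₗ
    (MulOpposite.opLinearEquiv k (M := A)).toLinearMap).flip

@[simp] lemma rightAct_tmul (v : Γ.Form) (a : A) :
    Γ.rightAct (v ⊗ₜ a) = MulOpposite.op a • v := rfl

lemma maurerCartan_apply (a : A) : Γ.maurerCartan a = Γ.rightAct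
    (TensorProduct.map Γ.d (HopfAlgebra.antipode k) (comul (R := k) a)) := by
  unfold maurerCartan
  rw [LinearMap.comp_apply]
  generalize comul (R := k) a = t
  induction t with
  | zero => simp
  | add x y hx hy => simp only [map_add, hx, hy]
  | tmul x y => rfl

@[simp] lemma d_one : Γ.d 1 = 0 := by
  have := Γ.leibniz 1 1
  simpa using this

@[simp] lemma maurerCartan_one : Γ.maurerCartan 1 = 0 := by
  simp [maurerCartan_apply, Algebra.TensorProduct.one_def]

/-- The right Maurer-Cartan form recovers the differential: `d a = ω(a₁) a₂`. -/
lemma d_eq (a : A) : Γ.d a = Γ.rightAct (Γ.maurerCartan.rTensor A (comul (R := k) a)) := by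
  have h : ∀ t : A ⊗[k] A, Γ.rightAct (Γ.maurerCartan.rTensor A t) =
      Γ.rightAct (TensorProduct.map Γ.d (LinearMap.mul' k A ∘ₗ
        (HopfAlgebra.antipode k).rTensor A) (TensorProduct.assoc k A A A (comul.rTensor A t))) := by
    intro t
    induction t with
    | zero => simp
    | add x y hx hy => simp only [map_add, hx, hy]
    | tmul x y =>
      rw [LinearMap.rTensor_tmul, LinearMap.rTensor_tmul, maurerCartan_apply, rightAct_tmul]
      generalize comul (R := k) x = s
      induction s with
      | zero => simp
      | add x y hx hy => simp only [map_add, smul_add, TensorProduct.add_tmul, hx, hy]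
      | tmul x z => simp [mul_smul]
  rw [h, coassoc_apply]
  have h2 : ∀ t : A ⊗[k] A, TensorProduct.map Γ.d (LinearMap.mul' k A ∘ₗ
        (HopfAlgebra.antipode k).rTensor A) (comul.lTensor A t) =
      Γ.d.rTensor A ((Algebra.linearMap k A).lTensor A (counit.lTensor A t)) := by
    intro t
    induction t with
    | zero => simp
    | add x y hx hy => simp only [map_add, hx, hy]
    | tmul x y => simp
  rw [h2, lTensor_counit_comul]
  simp

/-- The map `x ⊗ y ↦ ω(x) y`. -/
def frame : A ⊗[k] A →ₗ[k] Γ.Form := Γ.rightAct ∘ₗ Γ.maurerCartan.rTensor A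

@[simp] lemma frame_tmul (x y : A) :
    Γ.frame (x ⊗ₜ y) = MulOpposite.op y • Γ.maurerCartan x := rfl

/-- The map `x ⊗ y ↦ ε(x) d y - ω(x) y`. -/
def coframe : A ⊗[k] A →ₗ[k] Γ.Form :=
  Γ.d ∘ₗ (TensorProduct.lid k A).toLinearMap ∘ₗ counit.rTensor A - Γ.frame

@[simp] lemma coframe_tmul (x y : A) : Γ.coframe (x ⊗ₜ y) =
    counit (R := k) x • Γ.d y - MulOpposite.op y • Γ.maurerCartan x := by
  simp [coframe]

lemma frame_mul_tmul (z : A ⊗[k] A) (b : A) : Γ.frame (z * 1 ⊗ₜ b) =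
    MulOpposite.op b • Γ.frame z := by
  induction z with
  | zero => simp
  | add x y hx hy => simp only [map_add, add_mul, smul_add, hx, hy]
  | tmul x y => simp [mul_smul]

lemma frame_comul (a : A) : Γ.frame (comul (R := k) a) = Γ.d a := (Γ.d_eq a).symm

/-- In the coordinates provided by the Galois map, `a • d b` is `coframe`. -/
lemma coframe_galois (a b : A) : Γ.coframe (galois k A (a ⊗ₜ b)) = a • Γ.d b := by
  have h : (Γ.d ∘ₗ (TensorProduct.lid k A).toLinearMap ∘ₗ counit.rTensor A)
      (galois k A (a ⊗ₜ b)) = Γ.d (a * b) := by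
    rw [galois_tmul]
    simp only [LinearMap.comp_apply]
    congr 1
    trans (TensorProduct.lid k A (counit.rTensor A (comul (R := k) a))) * b
    · generalize comul (R := k) a = t
      induction t with
      | zero => simp
      | add x y hx hy => simp only [LinearEquiv.coe_coe, map_add, add_mul] at hx hy ⊢; rw [hx, hy]
      | tmul x y => simp
    · simp
  rw [coframe, LinearMap.sub_apply, h, galois_tmul, frame_mul_tmul, frame_comul, leibniz]
  simp

lemma frame_galois (a b : A) : Γ.frame (galois k A (a ⊗ₜ b)) = Γ.d (a * b) - a • Γ.d b := by
  rw [galois_tmul, frame_mul_tmul, frame_comul, leibniz]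
  simp

lemma rightCoaction_coframe (t : A ⊗[k] A) : Γ.rightCoaction (Γ.coframe t) =
    Γ.coframe.rTensor A ((TensorProduct.assoc k A A A).symm (comul.lTensor A t)) := by
  obtain ⟨t, rfl⟩ := galois_surjective t
  induction t with
  | zero => simp
  | add x y hx hy => simp only [map_add, hx, hy]
  | tmul a b =>
    rw [coframe_galois, rightCoaction_smul_d]
    have h : ∀ s t : A ⊗[k] A, TensorProduct.map₂ (Algebra.lsmul k k Γ.Form).toLinearMap
        (LinearMap.mul k A) s (Γ.d.rTensor A t) =
        Γ.coframe.rTensor A (comul.rTensor A s *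
          Algebra.TensorProduct.map (Algebra.TensorProduct.includeRight : A →ₐ[k] A ⊗[k] A)
            (AlgHom.id k A) t) := by
      intro s t
      induction s with
      | zero => simp
      | add x y hx hy => simp only [map_add, LinearMap.add_apply, add_mul, hx, hy]
      | tmul x y =>
        induction t with
        | zero => simp
        | add x y hx hy => simp only [map_add, mul_add, hx, hy]
        | tmul x' y' =>
          have := Γ.coframe_galois x x'
          rw [galois_tmul] at this
          simp [this]
    rw [h, assoc_symm_comul_galois]

lemma leftCoaction_coframe (t : A ⊗[k] A) : Γ.leftCoaction (Γ.coframe t) =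
    Γ.coframe.lTensor A (codiag k A t) := by
  obtain ⟨t, rfl⟩ := galois_surjective t
  induction t with
  | zero => simp
  | add x y hx hy => simp only [map_add, hx, hy]
  | tmul a b =>
    rw [coframe_galois, leftCoaction_smul_d, codiag_galois]
    generalize comul (R := k) a = s
    generalize comul (R := k) b = t
    induction s with
    | zero => simp
    | add x y hx hy => simp only [map_add, LinearMap.add_apply, add_mul, hx, hy]
    | tmul x y =>
      induction t with
      | zero => simp
      | add x y hx hy => simp only [map_add, mul_add, hx, hy]
      | tmul x' y' =>
        have := Γ.coframe_galois y y'
        rw [galois_tmul] at this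
        simp [this]

lemma coframe_eq_neg_frame {x : A} (hx : counit (R := k) x = 0) (y : A) :
    Γ.coframe (x ⊗ₜ y) = - Γ.frame (x ⊗ₜ y) := by simp [hx]

lemma maurerCartan_sub (x : A) :
    Γ.maurerCartan (x - algebraMap k A (counit (R := k) x)) = Γ.maurerCartan x := by
  simp [Algebra.algebraMap_eq_smul_one]

lemma counit_sub (x : A) : counit (R := k) (x - algebraMap k A (counit (R := k) x)) = 0 := by
  simp

lemma rightCoaction_frame (t : A ⊗[k] A) : Γ.rightCoaction (Γ.frame t) =
    Γ.frame.rTensor A ((TensorProduct.assoc k A A A).symm (comul.lTensor A t)) := by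
  induction t with
  | zero => simp
  | add x y hx hy => simp only [map_add, hx, hy]
  | tmul x y =>
    have h := Γ.rightCoaction_coframe ((x - algebraMap k A (counit (R := k) x)) ⊗ₜ y)
    rw [coframe_tmul, counit_sub, maurerCartan_sub, zero_smul, zero_sub, map_neg] at h
    rw [frame_tmul, ← neg_inj, h, LinearMap.lTensor_tmul, LinearMap.lTensor_tmul]
    generalize comul (R := k) y = s
    induction s with
    | zero => simp
    | add x y hx hy => simp only [map_add, TensorProduct.tmul_add, neg_add, hx, hy]
    | tmul y z =>
      simp only [TensorProduct.assoc_symm_tmul, LinearMap.rTensor_tmul, coframe_tmul, counit_sub,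
        maurerCartan_sub, frame_tmul, zero_smul, zero_sub, TensorProduct.neg_tmul]

/-- The right Maurer-Cartan form intertwines the adjoint coaction and the left coaction. -/
lemma leftCoaction_maurerCartan (x : A) : Γ.leftCoaction (Γ.maurerCartan x) =
    Γ.maurerCartan.lTensor A (adCoaction k A x) := by
  have h := Γ.leftCoaction_coframe ((x - algebraMap k A (counit (R := k) x)) ⊗ₜ 1)
  rw [coframe_tmul, counit_sub, maurerCartan_sub, zero_smul, zero_sub, map_neg, MulOpposite.op_one,
    one_smul, codiag_tmul] at h
  rw [← neg_inj, h, Bialgebra.comul_one, map_one, mul_one, map_sub,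
    Algebra.algebraMap_eq_smul_one, map_smul, adCoaction_one]
  have h2 : ∀ t : A ⊗[k] A, Γ.coframe.lTensor A (Algebra.TensorProduct.map (AlgHom.id k A)
      (Algebra.TensorProduct.includeLeft : A →ₐ[k] A ⊗[k] A) t) =
      - Γ.maurerCartan.lTensor A t := by
    intro t
    induction t with
    | zero => simp
    | add x y hx hy => simp only [map_add, neg_add, hx, hy]
    | tmul x y => simp [TensorProduct.tmul_neg]
  rw [h2]
  simp

/-- The map `Γ → Γ ⊗ A` inverse to `ω(x) ⊗ y ↦ ω(x) y`. -/
def coords : Γ.Form →ₗ[k] Γ.Form ⊗[k] A :=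
  Γ.rightAct.rTensor A ∘ₗ ((HopfAlgebra.antipode k).lTensor Γ.Form).rTensor A ∘ₗ
    (TensorProduct.assoc k Γ.Form A A).symm.toLinearMap ∘ₗ comul.lTensor Γ.Form ∘ₗ Γ.rightCoaction

lemma coords_frame (t : A ⊗[k] A) : Γ.coords (Γ.frame t) = Γ.maurerCartan.rTensor A t := by
  induction t with
  | zero => simp
  | add x y hx hy => simp only [map_add, hx, hy]
  | tmul x y =>
    rw [coords, LinearMap.comp_apply, LinearMap.comp_apply, LinearMap.comp_apply,
      LinearMap.comp_apply, rightCoaction_frame, LinearMap.lTensor_tmul]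
    have h : ∀ t : A ⊗[k] A, Γ.rightAct.rTensor A (((HopfAlgebra.antipode k).lTensor Γ.Form).rTensor
        A ((TensorProduct.assoc k Γ.Form A A).symm (comul.lTensor Γ.Form (Γ.frame.rTensor A
        ((TensorProduct.assoc k A A A).symm (x ⊗ₜ t)))))) =
        (Γ.rightAct ∘ₗ TensorProduct.mk k Γ.Form A (Γ.maurerCartan x)).rTensor A
          ((LinearMap.mul' k A ∘ₗ (HopfAlgebra.antipode k).lTensor A).rTensor A
            ((TensorProduct.assoc k A A A).symm (comul.lTensor A t))) := by
      intro t
      induction t with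
      | zero => simp
      | add x y hx hy => simp only [map_add, TensorProduct.tmul_add, hx, hy]
      | tmul x y =>
        simp only [TensorProduct.assoc_symm_tmul, LinearMap.rTensor_tmul, frame_tmul,
          LinearMap.lTensor_tmul]
        generalize comul (R := k) y = t
        induction t with
        | zero => simp
        | add x y hx hy => simp only [map_add, TensorProduct.tmul_add, hx, hy]
        | tmul x y => simp [mul_smul]
    refine (h _).trans ?_
    rw [coassoc_symm_apply]
    have h2 : ∀ t : A ⊗[k] A, (LinearMap.mul' k A ∘ₗ (HopfAlgebra.antipode k).lTensor A).rTensor A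
        (comul.rTensor A t) = (Algebra.linearMap k A).rTensor A (counit.rTensor A t) := by
      intro t
      induction t with
      | zero => simp
      | add x y hx hy => simp only [map_add, hx, hy]
      | tmul x y => simp
    rw [h2, rTensor_counit_comul]
    simp

lemma smul_coframe (c : A) (t : A ⊗[k] A) :
    c • Γ.coframe t = Γ.coframe (comul (R := k) c * t) := by
  obtain ⟨t, rfl⟩ := galois_surjective t
  induction t with
  | zero => simp
  | add x y hx hy => simp only [map_add, smul_add, mul_add, hx, hy]
  | tmul a b =>
    rw [coframe_galois, galois_tmul, ← mul_assoc, ← Bialgebra.comul_mul, ← galois_tmul,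
      coframe_galois, mul_smul]

/-- The left action in terms of right Maurer-Cartan forms: `c (ω(x) y) = ω(c₁ x) c₂ y` if
`ε(x) = 0`. -/
lemma smul_frame (c : A) {x : A} (hx : counit (R := k) x = 0) (y : A) :
    c • Γ.frame (x ⊗ₜ y) = Γ.frame (comul (R := k) c * x ⊗ₜ y) := by
  have h := Γ.smul_coframe c (x ⊗ₜ y)
  rw [coframe_eq_neg_frame Γ hx, smul_neg] at h
  rw [← neg_inj, h]
  generalize comul (R := k) c = t
  induction t with
  | zero => simp
  | add x y hx hy => simp only [map_add, add_mul, neg_add, hx, hy]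
  | tmul x y => simp [hx]

lemma smul_frame_tmul (c x y : A) : c • Γ.frame (x ⊗ₜ y) =
    Γ.frame (comul (R := k) c * (x - algebraMap k A (counit (R := k) x)) ⊗ₜ y) := by
  rw [← smul_frame _ _ (counit_sub x), frame_tmul, frame_tmul, maurerCartan_sub]

/-- The one-forms `ω(x) y` span `Γ`: they contain the exact forms by `d a = ω(a₁) a₂` and are stable
under the left action. -/
lemma frame_surjective : Function.Surjective Γ.frame := by
  intro v
  have hv : v ∈ Submodule.span A (Set.range Γ.d) := Γ.span_d ▸ Submodule.mem_top
  change v ∈ LinearMap.range Γ.frame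
  induction hv using Submodule.span_induction with
  | zero => exact zero_mem _
  | add x y _ _ hx hy => exact add_mem hx hy
  | mem x hx =>
    obtain ⟨a, rfl⟩ := hx
    exact ⟨_, Γ.frame_comul a⟩
  | smul a x h0 hx =>
    obtain ⟨t, rfl⟩ := hx
    clear h0
    induction t with
    | zero => simp
    | add x y hx hy => rw [map_add, smul_add]; exact add_mem hx hy
    | tmul x y => exact ⟨_, (Γ.smul_frame_tmul a x y).symm⟩

lemma maurerCartan_mem (a : A) : Γ.maurerCartan a ∈ Γ.rightInvariant := by
  change Γ.rightCoaction _ = Γ.maurerCartan a ⊗ₜ 1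
  have := Γ.rightCoaction_frame (a ⊗ₜ 1)
  rw [frame_tmul, MulOpposite.op_one, one_smul] at this
  simp [this, Algebra.TensorProduct.one_def]

/-- The right invariant forms are the values of the right Maurer-Cartan form: if `∑ ω(x) y` is right
invariant, then applying `coords` and the counit shows that it equals `∑ ε(y) ω(x)`. -/
lemma rightInvariant_eq : Γ.rightInvariant = LinearMap.range Γ.maurerCartan := by
  apply le_antisymm
  · intro v hv
    have hv' : Γ.rightCoaction v = v ⊗ₜ 1 := hv
    obtain ⟨t, ht⟩ := Γ.frame_surjective v
    have h1 : Γ.coords v = v ⊗ₜ 1 := by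
      simp [coords, hv', Algebra.TensorProduct.one_def]
    rw [← ht, coords_frame] at h1
    have h2 := congrArg ((TensorProduct.rid k Γ.Form).toLinearMap ∘ₗ counit.lTensor Γ.Form) h1
    simp only [LinearMap.comp_apply, LinearMap.lTensor_tmul, Bialgebra.counit_one, ht,
      LinearEquiv.coe_coe, TensorProduct.rid_tmul, one_smul] at h2
    rw [← h2]
    clear h1 h2 ht
    induction t with
    | zero => simp
    | add x y hx hy => simp only [map_add]; exact add_mem hx hy
    | tmul x y => exact ⟨counit (R := k) y • x, by simp⟩
  · rintro _ ⟨a, rfl⟩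
    exact Γ.maurerCartan_mem a

variable {Γ} in
lemma mem_ideal {a : A} : a ∈ Γ.ideal ↔ counit (R := k) a = 0 ∧ Γ.maurerCartan a = 0 := Iff.rfl

lemma sub_mem_ideal {a : A} : a - algebraMap k A (counit (R := k) a) ∈ Γ.ideal ↔
    Γ.maurerCartan a = 0 := by
  rw [mem_ideal, maurerCartan_sub]
  exact and_iff_right (counit_sub a)

lemma ideal_le_iff {Γ' : BicovariantCalculus k A} : Γ.ideal ≤ Γ'.ideal ↔
    LinearMap.ker Γ.maurerCartan ≤ LinearMap.ker Γ'.maurerCartan := by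
  constructor
  · intro h a ha
    exact Γ'.sub_mem_ideal.1 (h (Γ.sub_mem_ideal.2 ha))
  · exact fun h => inf_le_inf_left _ h

lemma mul_mem_ideal (c : A) {m : A} (hm : m ∈ Γ.ideal) : c * m ∈ Γ.ideal := by
  rw [mem_ideal] at hm ⊢
  refine ⟨by simp [hm.1], ?_⟩
  have h := Γ.smul_frame c hm.1 1
  rw [frame_tmul, hm.2, smul_zero, smul_zero] at h
  have h2 := congrArg ((TensorProduct.rid k Γ.Form).toLinearMap ∘ₗ counit.lTensor Γ.Form)
    (congrArg Γ.coords h.symm)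
  rw [coords_frame, map_zero, map_zero] at h2
  rw [← h2]
  have h3 : TensorProduct.rid k A (counit.lTensor A (comul (R := k) c)) = c := by simp
  conv_lhs => rw [← h3]
  generalize comul (R := k) c = t
  induction t with
  | zero => simp
  | add x y hx hy => simp only [map_add, add_mul, hx, hy]
  | tmul x y => simp

/-- The crossed submodule is invariant under the adjoint coaction. -/
lemma maurerCartan_adCoaction (f : A →ₗ[k] k) {m : A} (hm : Γ.maurerCartan m = 0) :
    Γ.maurerCartan (TensorProduct.lid k A (f.rTensor A (adCoaction k A m))) = 0 := by
  have h := Γ.leftCoaction_maurerCartan m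
  rw [hm, map_zero] at h
  have h2 := congrArg ((TensorProduct.lid k Γ.Form).toLinearMap ∘ₗ f.rTensor Γ.Form) h.symm
  rw [map_zero] at h2
  rw [← h2]
  generalize adCoaction k A m = t
  induction t with
  | zero => simp
  | add x y hx hy => simp only [map_add, hx, hy]
  | tmul x y => simp

section Hom

variable {Γ} {Γ' : BicovariantCalculus k A}

lemma IsHom.maurerCartan {f : Γ.Form →ₗ[A] Γ'.Form} (hf : Γ.IsHom Γ' f) (a : A) :
    f (Γ.maurerCartan a) = Γ'.maurerCartan a := by
  rw [maurerCartan_apply, maurerCartan_apply]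
  generalize comul (R := k) a = t
  induction t with
  | zero => simp
  | add x y hx hy => simp only [map_add, hx, hy]
  | tmul x y => simp [hf.1, hf.2]

lemma IsHom.frame {f : Γ.Form →ₗ[A] Γ'.Form} (hf : Γ.IsHom Γ' f) (t : A ⊗[k] A) :
    f (Γ.frame t) = Γ'.frame t := by
  induction t with
  | zero => simp
  | add x y hx hy => simp only [map_add, hx, hy]
  | tmul x y => simp [hf.1, hf.maurerCartan]

lemma IsHom.ideal_le {f : Γ.Form →ₗ[A] Γ'.Form} (hf : Γ.IsHom Γ' f) : Γ.ideal ≤ Γ'.ideal := by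
  intro a ha
  rw [mem_ideal] at ha ⊢
  exact ⟨ha.1, by rw [← hf.maurerCartan, ha.2, map_zero]⟩

lemma ker_frame_le (h : Γ.ideal ≤ Γ'.ideal) : LinearMap.ker Γ.frame ≤ LinearMap.ker Γ'.frame := by
  rw [ideal_le_iff] at h
  obtain ⟨e, he⟩ : ∃ e : Γ.Form →ₗ[k] Γ'.Form, e ∘ₗ Γ.maurerCartan = Γ'.maurerCartan :=
    exists_comp_eq_of_ker_le h
  intro t ht
  have h1 : Γ.maurerCartan.rTensor A t = 0 := by
    rw [← coords_frame, LinearMap.mem_ker.1 ht, map_zero]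
  change Γ'.rightAct (Γ'.maurerCartan.rTensor A t) = 0
  rw [← he, LinearMap.rTensor_comp, LinearMap.comp_apply, h1, map_zero, map_zero]

/-- A calculus is determined by its crossed submodule: there is a morphism of calculi if and only
if the crossed submodules are contained in each other. -/
lemma exists_isHom (h : Γ.ideal ≤ Γ'.ideal) : ∃ f : Γ.Form →ₗ[A] Γ'.Form, Γ.IsHom Γ' f := by
  obtain ⟨f, hf⟩ : ∃ f : Γ.Form →ₗ[k] Γ'.Form, f ∘ₗ Γ.frame = Γ'.frame :=
    exists_comp_eq_of_ker_le (ker_frame_le h)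
  have hf' : ∀ t, f (Γ.frame t) = Γ'.frame t := fun t => LinearMap.congr_fun hf t
  refine ⟨{ f with map_smul' := ?_ }, ?_, ?_⟩
  · intro c v
    obtain ⟨t, rfl⟩ := Γ.frame_surjective v
    change f (c • Γ.frame t) = c • f (Γ.frame t)
    induction t with
    | zero => simp
    | add x y hx hy => simp only [map_add, smul_add, hx, hy]
    | tmul x y => rw [smul_frame_tmul, hf', hf', smul_frame_tmul]
  · intro c v
    obtain ⟨t, rfl⟩ := Γ.frame_surjective v
    change f (_ • Γ.frame t) = _ • f (Γ.frame t)
    rw [← frame_mul_tmul, hf', hf', frame_mul_tmul]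
  · intro a
    change f (Γ.d a) = _
    rw [← frame_comul, hf', frame_comul]

lemma IsHom.surjective {f : Γ.Form →ₗ[A] Γ'.Form} (hf : Γ.IsHom Γ' f) :
    Function.Surjective f := fun v => by
  obtain ⟨t, rfl⟩ := Γ'.frame_surjective v
  exact ⟨_, hf.frame t⟩

lemma IsHom.injective_iff {f : Γ.Form →ₗ[A] Γ'.Form} (hf : Γ.IsHom Γ' f) :
    Function.Injective f ↔ Γ.ideal = Γ'.ideal := by
  constructor
  · intro h
    refine le_antisymm hf.ideal_le fun a ha => ?_
    rw [mem_ideal] at ha ⊢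
    refine ⟨ha.1, h ?_⟩
    rw [hf.maurerCartan, ha.2, map_zero]
  · intro h
    rw [injective_iff_map_eq_zero]
    intro v hv
    obtain ⟨t, rfl⟩ := Γ.frame_surjective v
    rw [hf.frame] at hv
    exact ker_frame_le h.ge hv

lemma iso_iff : Γ.Iso Γ' ↔ Γ.ideal = Γ'.ideal := by
  constructor
  · rintro ⟨f, hf, hb⟩
    exact hf.injective_iff.1 hb.1
  · intro h
    obtain ⟨f, hf⟩ := exists_isHom h.le
    exact ⟨f, hf, hf.injective_iff.2 h, hf.surjective⟩

lemma subsingleton_iff : Subsingleton Γ.Form ↔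
    Γ.ideal = LinearMap.ker (counit (R := k) (A := A)) := by
  constructor
  · intro h
    refine le_antisymm inf_le_left fun a ha => mem_ideal.2 ⟨ha, Subsingleton.elim _ _⟩
  · intro h
    have h1 : ∀ a, Γ.maurerCartan a = 0 := fun a => by
      rw [← sub_mem_ideal, h]
      exact counit_sub a
    refine subsingleton_of_forall_eq 0 fun v => ?_
    obtain ⟨t, rfl⟩ := Γ.frame_surjective v
    induction t with
    | zero => simp
    | add x y hx hy => rw [map_add, hx, hy, add_zero]
    | tmul x y => simp [h1]

end Hom

end BicovariantCalculus
end Structure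

/-! ### The calculus of a crossed submodule -/

section Construction

open Coalgebra

variable {k A : Type u} [Field k] [Ring A] [HopfAlgebra k A]

namespace CrossedQuotient

variable {N : Submodule k A}

/-- The operator `[b] ↦ [c b - ε(b) c]` on `A / N`. -/
def actMap (hmul : ∀ c : A, ∀ m ∈ N, c * m - counit (R := k) m • c ∈ N) (c : A) :
    Module.End k (A ⧸ N) :=
  N.mapQ N (LinearMap.mulLeft k c - (counit (R := k) (A := A)).smulRight c) (hmul c)

lemma actMap_mk (hmul : ∀ c : A, ∀ m ∈ N, c * m - counit (R := k) m • c ∈ N) (c b : A) :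
    actMap hmul c (N.mkQ b) = N.mkQ (c * b - counit (R := k) b • c) := rfl

/-- The left action `c [b] = [c b - ε(b) c]` of `A` on `A / N`. -/
def act (h1 : 1 ∈ N) (hmul : ∀ c : A, ∀ m ∈ N, c * m - counit (R := k) m • c ∈ N) :
    A →ₐ[k] Module.End k (A ⧸ N) :=
  AlgHom.ofLinearMap
    { toFun := actMap hmul
      map_add' := fun c c' => by
        refine Submodule.linearMap_qext _ (LinearMap.ext fun b => ?_)
        simp only [LinearMap.comp_apply, LinearMap.add_apply, actMap_mk, ← map_add]
        congr 1
        rw [add_mul, smul_add]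
        abel
      map_smul' := fun r c => by
        refine Submodule.linearMap_qext _ (LinearMap.ext fun b => ?_)
        simp only [LinearMap.comp_apply, LinearMap.smul_apply, actMap_mk, ← map_smul,
          RingHom.id_apply]
        congr 1
        rw [smul_mul_assoc, smul_sub, smul_comm] }
    (by
      refine Submodule.linearMap_qext _ (LinearMap.ext fun b => ?_)
      change actMap hmul 1 (N.mkQ b) = N.mkQ b
      rw [actMap_mk, one_mul, map_sub, map_smul, (Submodule.Quotient.mk_eq_zero N).2 h1 |>
        (show N.mkQ 1 = 0 from ·), smul_zero, sub_zero])
    (fun c c' => by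
      refine Submodule.linearMap_qext _ (LinearMap.ext fun b => ?_)
      change actMap hmul (c * c') (N.mkQ b) = actMap hmul c (actMap hmul c' (N.mkQ b))
      rw [actMap_mk, actMap_mk, actMap_mk]
      congr 1
      simp [mul_sub, mul_assoc, mul_comm])

/-- The codiagonal left action on `(A / N) ⊗ A`. -/
def leftHom (h1 : 1 ∈ N) (hmul : ∀ c : A, ∀ m ∈ N, c * m - counit (R := k) m • c ∈ N) :
    A →ₐ[k] Module.End k ((A ⧸ N) ⊗[k] A) :=
  (Module.endTensorEndAlgHom (R := k) (S := k) (A := k) (M := A ⧸ N) (N := A)).comp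
    ((Algebra.TensorProduct.map (act h1 hmul) (Algebra.lmul k A)).comp (Bialgebra.comulAlgHom k A))

variable (N) in
/-- The right action on `(A / N) ⊗ A`. -/
def rightHom : Aᵐᵒᵖ →+* Module.End k ((A ⧸ N) ⊗[k] A) where
  toFun b := (LinearMap.mulRight k b.unop).lTensor _
  map_one' := by ext; simp
  map_mul' a b := by ext; simp [mul_assoc]
  map_zero' := by ext; simp
  map_add' a b := by ext; simp [mul_add, TensorProduct.tmul_add]

lemma leftHom_apply (h1 : 1 ∈ N) (hmul : ∀ c : A, ∀ m ∈ N, c * m - counit (R := k) m • c ∈ N)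
    (c x y : A) : leftHom h1 hmul c (N.mkQ x ⊗ₜ y) =
      N.mkQ.rTensor A (comul (R := k) c * x ⊗ₜ y) -
        counit (R := k) x • N.mkQ.rTensor A (comul (R := k) c * 1 ⊗ₜ y) := by
  change Module.endTensorEndAlgHom (R := k) (S := k) (A := k) (M := A ⧸ N) (N := A)
    ((Algebra.TensorProduct.map (act h1 hmul) (Algebra.lmul k A)) (comul (R := k) c)) _ = _
  generalize comul (R := k) c = t
  induction t with
  | zero => simp
  | add a b ha hb =>
    simp only [map_add, LinearMap.add_apply, add_mul, smul_add] at ha hb ⊢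
    rw [ha, hb]
    abel
  | tmul a b =>
    have : act h1 hmul a (N.mkQ x) = N.mkQ (a * x - counit (R := k) x • a) := rfl
    rw [Algebra.TensorProduct.map_tmul, Module.endTensorEndAlgHom_apply,
      TensorProduct.AlgebraTensorModule.map_tmul, this]
    simp [TensorProduct.sub_tmul, TensorProduct.smul_tmul']

lemma leftHom_comul (h1 : 1 ∈ N) (hmul : ∀ c : A, ∀ m ∈ N, c * m - counit (R := k) m • c ∈ N)
    (a b : A) : leftHom h1 hmul a (N.mkQ.rTensor A (comul (R := k) b)) =
      N.mkQ.rTensor A (comul (R := k) (a * b) - galois k A (a ⊗ₜ b)) := by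
  have h : ∀ t : A ⊗[k] A, leftHom h1 hmul a (N.mkQ.rTensor A t) =
      N.mkQ.rTensor A (comul (R := k) a * t -
        comul (R := k) a * 1 ⊗ₜ (TensorProduct.lid k A (counit.rTensor A t))) := by
    intro t
    induction t with
    | zero => simp
    | add x y hx hy =>
      simp only [map_add, mul_add, TensorProduct.tmul_add, map_sub, hx, hy]
      abel
    | tmul x y =>
      rw [LinearMap.rTensor_tmul, leftHom_apply, map_sub]
      simp
  rw [h, Bialgebra.comul_mul, rTensor_counit_comul, galois_tmul]
  simp

/-- The left coaction on `A / N` induced by the adjoint coaction. -/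
def adQuot (had : ∀ m ∈ N, N.mkQ.lTensor A (adCoaction k A m) = 0) : A ⧸ N →ₗ[k] A ⊗[k] (A ⧸ N) :=
  N.liftQ (N.mkQ.lTensor A ∘ₗ adCoaction k A) had

/-- The codiagonal left coaction on `(A / N) ⊗ A`. -/
def leftCo (had : ∀ m ∈ N, N.mkQ.lTensor A (adCoaction k A m) = 0) :
    (A ⧸ N) ⊗[k] A →ₗ[k] A ⊗[k] ((A ⧸ N) ⊗[k] A) :=
  (LinearMap.mul' k A).rTensor _ ∘ₗ (TensorProduct.tensorTensorTensorComm k A (A ⧸ N) A A).toLinearMap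
    ∘ₗ TensorProduct.map (adQuot had) comul

lemma leftCo_mkQ (had : ∀ m ∈ N, N.mkQ.lTensor A (adCoaction k A m) = 0) (t : A ⊗[k] A) :
    leftCo had (N.mkQ.rTensor A t) = (N.mkQ.rTensor A).lTensor A (codiag k A t) := by
  induction t with
  | zero => simp
  | add x y hx hy => simp only [map_add, hx, hy]
  | tmul x y =>
    have h : adQuot had (N.mkQ x) = N.mkQ.lTensor A (adCoaction k A x) := rfl
    rw [LinearMap.rTensor_tmul, leftCo, LinearMap.comp_apply, LinearMap.comp_apply,
      TensorProduct.map_tmul, h, codiag_tmul]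
    generalize adCoaction k A x = s
    generalize comul (R := k) y = t
    induction s with
    | zero => simp
    | add x y hx hy => simp only [map_add, TensorProduct.add_tmul, add_mul, hx, hy]
    | tmul x y =>
      induction t with
      | zero => simp
      | add x y hx hy => simp only [map_add, TensorProduct.tmul_add, mul_add, hx, hy]
      | tmul x' y' => simp

lemma d_span (h1 : 1 ∈ N) (hmul : ∀ c : A, ∀ m ∈ N, c * m - counit (R := k) m • c ∈ N)
    (S : Submodule k ((A ⧸ N) ⊗[k] A)) (hS : ∀ a, ∀ v ∈ S, leftHom h1 hmul a v ∈ S)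
    (hd : ∀ b, N.mkQ.rTensor A (comul (R := k) b) ∈ S) : S = ⊤ := by
  rw [eq_top_iff]
  rintro v -
  obtain ⟨t, rfl⟩ := LinearMap.rTensor_surjective A N.mkQ_surjective v
  obtain ⟨t, rfl⟩ := galois_surjective t
  induction t with
  | zero => simp
  | add x y hx hy => simp only [map_add]; exact add_mem hx hy
  | tmul a b =>
    have := S.sub_mem (hd (a * b)) (hS a _ (hd b))
    rwa [leftHom_comul, map_sub, sub_sub_cancel] at this

/-- The calculus on `(A / N) ⊗ A` with `d a = [a₁] ⊗ a₂`. -/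
def calculus (h1 : 1 ∈ N) (hmul : ∀ c : A, ∀ m ∈ N, c * m - counit (R := k) m • c ∈ N)
    (had : ∀ m ∈ N, N.mkQ.lTensor A (adCoaction k A m) = 0) : BicovariantCalculus k A :=
  letI : Module A ((A ⧸ N) ⊗[k] A) := Module.compHom _ (leftHom h1 hmul).toRingHom
  letI : Module Aᵐᵒᵖ ((A ⧸ N) ⊗[k] A) := Module.compHom _ (rightHom N)
  haveI t1 : IsScalarTower k A ((A ⧸ N) ⊗[k] A) := ⟨fun r a v => by
    change leftHom h1 hmul (r • a) v = r • leftHom h1 hmul a v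
    rw [map_smul, LinearMap.smul_apply]⟩
  haveI t2 : IsScalarTower k Aᵐᵒᵖ ((A ⧸ N) ⊗[k] A) := ⟨fun r a v => by
    change (LinearMap.mulRight k (r • a).unop).lTensor _ v =
      r • (LinearMap.mulRight k a.unop).lTensor _ v
    induction v with
    | zero => simp
    | add x y hx hy => simp only [map_add, smul_add, hx, hy]
    | tmul x y => simp⟩
  haveI t3 : SMulCommClass A Aᵐᵒᵖ ((A ⧸ N) ⊗[k] A) := ⟨fun a b v => by
    change leftHom h1 hmul a ((LinearMap.mulRight k b.unop).lTensor _ v) =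
      (LinearMap.mulRight k b.unop).lTensor _ (leftHom h1 hmul a v)
    induction v with
    | zero => simp
    | add x y hx hy => simp only [map_add, hx, hy]
    | tmul x y =>
      obtain ⟨x, rfl⟩ := N.mkQ_surjective x
      rw [LinearMap.lTensor_tmul, leftHom_apply, leftHom_apply]
      generalize comul (R := k) a = t
      induction t with
      | zero => simp
      | add x y hx hy =>
        simp only [add_mul, map_add, map_sub, smul_add] at hx hy ⊢
        rw [add_sub_add_comm, hx, hy]
        abel
      | tmul a b => simp [mul_assoc]⟩
  have hsmul : ∀ a b : A, a • N.mkQ.rTensor A (comul (R := k) b) =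
    N.mkQ.rTensor A (comul (R := k) (a * b) - galois k A (a ⊗ₜ b)) := leftHom_comul h1 hmul
  { Form := (A ⧸ N) ⊗[k] A
    d := N.mkQ.rTensor A ∘ₗ comul
    leibniz := fun a b => by
      rw [LinearMap.comp_apply, LinearMap.comp_apply, LinearMap.comp_apply, hsmul, map_sub]
      change _ = _ + (LinearMap.mulRight k b).lTensor _ _
      have : ∀ t : A ⊗[k] A, (LinearMap.mulRight k b).lTensor _ (N.mkQ.rTensor A t) =
          N.mkQ.rTensor A (t * 1 ⊗ₜ b) := by
        intro t
        induction t with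
        | zero => simp
        | add x y hx hy => simp only [map_add, add_mul, hx, hy]
        | tmul x y => simp
      rw [this, galois_tmul, sub_add_cancel]
    span_d := by
      have := d_span h1 hmul ((Submodule.span A (Set.range
        (N.mkQ.rTensor A ∘ₗ comul (R := k)))).restrictScalars k)
        (fun a v hv => Submodule.smul_mem _ a hv)
        (fun b => Submodule.subset_span ⟨b, rfl⟩)
      rwa [Submodule.restrictScalars_eq_top_iff] at this
    leftCoaction := leftCo had
    rightCoaction := (TensorProduct.assoc k (A ⧸ N) A A).symm.toLinearMap ∘ₗ comul.lTensor (A ⧸ N)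
    leftCoaction_smul_d := fun a b => by
      have hc : ∀ c : A, codiag k A (comul (R := k) c) = comul.lTensor A (comul (R := k) c) := by
        intro c
        have := codiag_galois (k := k) c 1
        rw [galois_tmul, Bialgebra.comul_one, map_one, mul_one] at this
        rw [← this, ← Algebra.TensorProduct.one_def, mul_one]
      rw [LinearMap.comp_apply, hsmul, leftCo_mkQ, map_sub, codiag_galois, hc,
        Bialgebra.comul_mul]
      generalize comul (R := k) a = s
      generalize comul (R := k) b = t
      induction s with
      | zero => simp
      | add x y hx hy =>
        simp only [map_add, LinearMap.add_apply, add_mul, map_sub] at hx hy ⊢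
        rw [← hx, ← hy]
        abel
      | tmul x y =>
        induction t with
        | zero => simp
        | add x y hx hy =>
          simp only [map_add, mul_add, map_sub] at hx hy ⊢
          rw [← hx, ← hy]
          abel
        | tmul x' y' =>
          have := hsmul y y'
          simp only [map_sub] at this
          simp [this, TensorProduct.tmul_sub, galois_tmul]
    rightCoaction_smul_d := fun a b => by
      have hP : ∀ t : A ⊗[k] A, (TensorProduct.assoc k (A ⧸ N) A A).symm
          (comul.lTensor (A ⧸ N) (N.mkQ.rTensor A t)) =
          (N.mkQ.rTensor A).rTensor A
            ((TensorProduct.assoc k A A A).symm (comul.lTensor A t)) := by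
        intro t
        induction t with
        | zero => simp
        | add x y hx hy => simp only [map_add, hx, hy]
        | tmul x y =>
          simp only [LinearMap.lTensor_tmul, LinearMap.rTensor_tmul]
          generalize comul (R := k) y = t
          induction t with
          | zero => simp
          | add x y hx hy => simp only [map_add, TensorProduct.tmul_add, hx, hy]
          | tmul x y => simp
      rw [LinearMap.comp_apply, LinearMap.comp_apply, hsmul]
      refine (hP _).trans ?_
      rw [map_sub, map_sub, assoc_symm_comul_galois, coassoc_symm_apply, Bialgebra.comul_mul]
      generalize comul (R := k) a = s
      generalize comul (R := k) b = t
      induction s with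
      | zero => simp
      | add x y hx hy =>
        simp only [map_add, LinearMap.add_apply, add_mul, map_sub] at hx hy ⊢
        rw [← hx, ← hy]
        abel
      | tmul x y =>
        induction t with
        | zero => simp
        | add x y hx hy =>
          simp only [map_add, mul_add, map_sub] at hx hy ⊢
          rw [← hx, ← hy]
          abel
        | tmul x' y' =>
          have := hsmul x x'
          simp only [map_sub] at this
          simp [this, TensorProduct.sub_tmul, galois_tmul] }

end CrossedQuotient
end Construction

section Existence

open Coalgebra

variable {k A : Type u} [Field k] [Ring A] [HopfAlgebra k A]

namespace CrossedQuotient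

variable {N : Submodule k A}

lemma maurerCartan_calculus (h1 : 1 ∈ N)
    (hmul : ∀ c : A, ∀ m ∈ N, c * m - counit (R := k) m • c ∈ N)
    (had : ∀ m ∈ N, N.mkQ.lTensor A (adCoaction k A m) = 0) (a : A) :
    (calculus h1 hmul had).maurerCartan a = N.mkQ a ⊗ₜ (1 : A) := by
  have h : ∀ t : A ⊗[k] A, (calculus h1 hmul had).frame t = N.mkQ.rTensor A t := by
    intro t
    obtain ⟨t, rfl⟩ := galois_surjective t
    induction t with
    | zero => rw [map_zero, map_zero, map_zero]; rfl
    | add x y hx hy => rw [map_add, map_add, map_add, hx, hy]; rfl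
    | tmul a b =>
      rw [BicovariantCalculus.frame_galois]
      have h2 : a • (calculus h1 hmul had).d b =
          N.mkQ.rTensor A (comul (R := k) (a * b) - galois k A (a ⊗ₜ b)) :=
        leftHom_comul h1 hmul a b
      rw [h2, map_sub]
      exact sub_sub_cancel _ _
  have := h (a ⊗ₜ 1)
  rwa [BicovariantCalculus.frame_tmul, MulOpposite.op_one, one_smul] at this

end CrossedQuotient

/-- Every left ideal in the kernel of the counit that is a subcomodule for the adjoint coaction is
the crossed submodule of a calculus. -/
theorem exists_calculus (M : Submodule k A) (hM : M ≤ LinearMap.ker (counit (R := k) (A := A)))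
    (hmul : ∀ c : A, ∀ m ∈ M, c * m ∈ M)
    (had : ∀ m ∈ M, adCoaction k A m ∈ LinearMap.range (M.subtype.lTensor A)) :
    ∃ Γ : BicovariantCalculus k A, Γ.ideal = M := by
  -- `N = M ⊕ k 1`, so that `A / N` is isomorphic to `ker ε / M`
  set N : Submodule k A := M.comap (LinearMap.id - (counit (R := k) (A := A)).smulRight 1) with hN
  have hmem : ∀ a, a ∈ N ↔ a - counit (R := k) a • 1 ∈ M := fun a => Iff.rfl
  have hle : M ≤ N := fun m hm => by
    rw [hmem, LinearMap.mem_ker.1 (hM hm), zero_smul, sub_zero]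
    exact hm
  have h1 : (1 : A) ∈ N := by simp [hmem]
  have hmulN : ∀ c : A, ∀ m ∈ N, c * m - counit (R := k) m • c ∈ N := fun c m hm => by
    have := hle (hmul c _ ((hmem m).1 hm))
    rwa [mul_sub, mul_smul_comm, mul_one] at this
  have hadN : ∀ m ∈ N, N.mkQ.lTensor A (adCoaction k A m) = 0 := fun m hm => by
    obtain ⟨t, ht⟩ := had _ ((hmem m).1 hm)
    have h2 : m = (m - counit (R := k) m • 1) + counit (R := k) m • 1 := by abel
    have h3 : N.mkQ ∘ₗ M.subtype = 0 := LinearMap.ext fun x => by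
      simpa using hle x.2
    rw [h2, map_add, map_add, ← ht, ← LinearMap.comp_apply, ← LinearMap.lTensor_comp, h3,
      map_smul, map_smul, adCoaction_one, LinearMap.lTensor_tmul,
      show N.mkQ 1 = 0 from (Submodule.Quotient.mk_eq_zero N).2 h1]
    simp
  refine ⟨CrossedQuotient.calculus h1 hmulN hadN, ?_⟩
  ext a
  rw [BicovariantCalculus.mem_ideal, CrossedQuotient.maurerCartan_calculus]
  have h4 : (N.mkQ a ⊗ₜ[k] (1 : A) = 0) ↔ a ∈ N := by
    constructor
    · intro h
      have := congrArg (TensorProduct.rid k (A ⧸ N) ∘ counit.lTensor (A ⧸ N)) h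
      simpa using this
    · intro h
      rw [show N.mkQ a = 0 from (Submodule.Quotient.mk_eq_zero N).2 h, TensorProduct.zero_tmul]
  refine (and_congr_right' h4).trans ?_
  rw [hmem]
  constructor
  · rintro ⟨ha, hb⟩
    rwa [ha, zero_smul, sub_zero] at hb
  · intro h
    have := LinearMap.mem_ker.1 (hM h)
    exact ⟨this, by rwa [this, zero_smul, sub_zero]⟩

/-! ### Duality -/

variable {H : Type u} [Ring H] [HopfAlgebra k H] {B : H →ₗ[k] A →ₗ[k] k}

/-- The elements of the kernel of the counit of `A` that are annihilated by a subspace of `H`. -/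
def annihilator (B : H →ₗ[k] A →ₗ[k] k) (L : Submodule k H) : Submodule k A :=
  LinearMap.ker (counit (R := k) (A := A)) ⊓ (L.map B).dualCoannihilator

lemma mem_annihilator {L : Submodule k H} {a : A} :
    a ∈ annihilator B L ↔ counit (R := k) a = 0 ∧ ∀ l ∈ L, B l a = 0 := by
  rw [annihilator, Submodule.mem_inf, Submodule.mem_dualCoannihilator]
  refine and_congr_right' ⟨fun h l hl => h _ ⟨l, hl, rfl⟩, ?_⟩
  rintro h _ ⟨l, hl, rfl⟩
  exact h l hl

namespace BicovariantCalculus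

variable {Γ : BicovariantCalculus k A} {L : Submodule k H}

/-- If the crossed submodule is the annihilator of a subspace `L` of `ker ε`, then the kernel of
the right Maurer-Cartan form consists of all elements annihilated by `L`. -/
lemma ker_maurerCartan (hB1 : ∀ x, B x 1 = counit (R := k) x)
    (hL : L ≤ LinearMap.ker (counit (R := k) (A := H))) (hΓ : Γ.ideal = annihilator B L) :
    LinearMap.ker Γ.maurerCartan = (L.map B).dualCoannihilator := by
  ext a
  rw [LinearMap.mem_ker, ← sub_mem_ideal, hΓ, mem_annihilator, and_iff_right (counit_sub a),
    Submodule.mem_dualCoannihilator]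
  have h : ∀ l ∈ L, B l (a - algebraMap k A (counit (R := k) a)) = B l a := fun l hl => by
    rw [map_sub, Algebra.algebraMap_eq_smul_one, map_smul, hB1, LinearMap.mem_ker.1 (hL hl),
      smul_zero, sub_zero]
  constructor
  · rintro h2 _ ⟨l, hl, rfl⟩
    rw [← h l hl, h2 l hl]
  · intro h2 l hl
    rw [h l hl, h2 _ ⟨l, hl, rfl⟩]

lemma finrank_quot_dualCoannihilator {V : Type*} [AddCommGroup V] [Module k V]
    (W : Subspace k (Module.Dual k V)) [FiniteDimensional k W] :
    Module.Finite k (V ⧸ W.dualCoannihilator) ∧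
      Module.finrank k (V ⧸ W.dualCoannihilator) = Module.finrank k W := by
  let _ : AddCommGroup W := inferInstance
  have e := LinearEquiv.ofBijective _ (Subspace.quotDualCoannihilatorToDual_bijective W)
  exact ⟨Module.Finite.equiv e.symm, e.finrank_eq.trans Subspace.dual_finrank_eq⟩

/-- The right invariant forms are dual to the annihilated subspace. -/
lemma finrank_rightInvariant (hB : Function.Injective B) (hB1 : ∀ x, B x 1 = counit (R := k) x)
    (hL : L ≤ LinearMap.ker (counit (R := k) (A := H))) [FiniteDimensional k L]
    (hΓ : Γ.ideal = annihilator B L) :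
    Γ.IsFiniteDimensional ∧ Γ.dim = Module.finrank k L := by
  have hr := Γ.rightInvariant_eq
  have e1 : (A ⧸ (L.map B).dualCoannihilator) ≃ₗ[k] Γ.rightInvariant :=
    (Submodule.quotEquivOfEq _ _ (ker_maurerCartan hB1 hL hΓ).symm).trans
      (Γ.maurerCartan.quotKerEquivRange.trans (LinearEquiv.ofEq _ _ hr.symm))
  have : FiniteDimensional k (L.map B) := inferInstance
  obtain ⟨e2, e4⟩ := finrank_quot_dualCoannihilator (L.map B)
  have e3 : L ≃ₗ[k] L.map B := Submodule.equivMapOfInjective B hB L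
  constructor
  · exact Module.Finite.equiv e1
  · rw [dim, ← e1.finrank_eq, e4, ← e3.finrank_eq]

/-- A finite dimensional subspace `L` of `ker ε` is its own bidual annihilator, so it is the tangent
space of every calculus whose crossed submodule is the annihilator of `L`. -/
lemma tangentSpace_eq (hB : Function.Injective B) (hB1 : ∀ x, B x 1 = counit (R := k) x)
    (hL : L ≤ LinearMap.ker (counit (R := k) (A := H))) [FiniteDimensional k L]
    (hΓ : Γ.ideal = annihilator B L) : Γ.tangentSpace B = L := by
  have : FiniteDimensional k (L.map B) := inferInstance
  have hk := ker_maurerCartan hB1 hL hΓ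
  ext x
  rw [tangentSpace, Submodule.mem_inf, Submodule.mem_comap, Submodule.mem_dualAnnihilator]
  constructor
  · rintro ⟨hx, h⟩
    have h2 : B x ∈ (L.map B).dualCoannihilator.dualAnnihilator := by
      rw [Submodule.mem_dualAnnihilator, ← hk]
      intro a ha
      have h3 := h _ (Γ.sub_mem_ideal.2 ha)
      rwa [map_sub, Algebra.algebraMap_eq_smul_one, map_smul, hB1, LinearMap.mem_ker.1 hx,
        smul_zero, sub_zero] at h3
    rw [Subspace.dualCoannihilator_dualAnnihilator_eq] at h2
    obtain ⟨l, hl, hlx⟩ := h2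
    rwa [← hB hlx]
  · intro hx
    refine ⟨hL hx, fun a ha => ?_⟩
    rw [hΓ, mem_annihilator] at ha
    exact ha.2 x hx

/-- Dual bases: if `η i = ω(b i)` where `b` is dual to a basis `φ` of `L`, then `η` is a right
invariant basis of the calculus. -/
lemma isRightInvariantBasis_of_dual {n : ℕ} {φ : ℕ → H} {b : ℕ → A}
    (hb0 : ∀ i < n, counit (R := k) (b i) = 0)
    (hφ : ∀ i < n, ∀ j < n, B (φ j) (b i) = if i = j then 1 else 0)
    (hspan : Submodule.span k (Set.range fun i : Fin n => φ i) = L)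
    (hΓ : Γ.ideal = annihilator B L) :
    Γ.IsRightInvariantBasis n (fun i => Γ.maurerCartan (b i)) ∧
      IsDualBasis B Γ L n (fun i => Γ.maurerCartan (b i)) φ := by
  have hexp : ∀ a : A, counit (R := k) a = 0 →
      Γ.maurerCartan a = ∑ i ∈ Finset.range n, B (φ i) a • Γ.maurerCartan (b i) := by
    intro a ha
    have h : a - ∑ i ∈ Finset.range n, B (φ i) a • b i ∈ Γ.ideal := by
      rw [hΓ, mem_annihilator]
      constructor
      · rw [map_sub, ha, map_sum, zero_sub, neg_eq_zero]
        refine Finset.sum_eq_zero fun i hi => ?_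
        rw [map_smul, hb0 i (Finset.mem_range.1 hi), smul_zero]
      · rw [← hspan]
        intro l hl
        induction hl using Submodule.span_induction with
        | zero => simp
        | add x y _ _ hx hy => rw [map_add, LinearMap.add_apply, hx, hy, add_zero]
        | smul c x _ hx => rw [map_smul, LinearMap.smul_apply, hx, smul_zero]
        | mem x hx =>
          obtain ⟨j, rfl⟩ := hx
          rw [map_sub, map_sum, sub_eq_zero, Finset.sum_eq_single (j : ℕ)]
          · simp [hφ j j.2 j j.2]
          · intro i hi hij
            simp [hφ i (Finset.mem_range.1 hi) j j.2, hij]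
          · simp
    have := (mem_ideal.1 h).2
    rw [map_sub, sub_eq_zero] at this
    rw [this, map_sum]
    simp
  refine ⟨⟨fun i _ => Γ.maurerCartan_mem _, ?_, ?_⟩, ?_, hspan, hexp⟩
  · rw [Fintype.linearIndependent_iff]
    intro c hc j
    obtain ⟨e, he⟩ : ∃ e : Γ.Form →ₗ[k] k, ∀ a : A, counit (R := k) a = 0 →
        e (Γ.maurerCartan a) = B (φ j) a := by
      obtain ⟨e, he⟩ := exists_comp_eq_of_ker_le (k := k) (f := Γ.maurerCartan)
        (g := B (φ j) ∘ₗ (LinearMap.id - (counit (R := k) (A := A)).smulRight 1)) (by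
          intro a ha
          have h2 := Γ.sub_mem_ideal.2 ha
          rw [hΓ, mem_annihilator] at h2
          have h3 := h2.2 (φ j) (hspan ▸ Submodule.subset_span ⟨j, rfl⟩)
          rwa [Algebra.algebraMap_eq_smul_one] at h3)
      refine ⟨e, fun a ha => ?_⟩
      rw [← LinearMap.comp_apply, he]
      simp [ha]
    have h1 : ∑ i : Fin n, (b i) ⊗ₜ[k] (c i).unop ∈ LinearMap.ker Γ.frame := by
      rw [LinearMap.mem_ker, map_sum, ← hc]
      rfl
    have h2 := Γ.coords_frame (∑ i : Fin n, (b i) ⊗ₜ[k] (c i).unop)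
    rw [LinearMap.mem_ker.1 h1, map_zero] at h2
    have h3 := congrArg (TensorProduct.lid k A ∘ e.rTensor A) h2.symm
    simp only [Function.comp_apply, map_sum, LinearMap.rTensor_tmul, TensorProduct.lid_tmul,
      map_zero] at h3
    have h4 : ∑ i : Fin n, e (Γ.maurerCartan (b i)) • (c i).unop = (c j).unop := by
      rw [Finset.sum_eq_single j]
      · rw [he _ (hb0 j j.2), hφ j j.2 j j.2, if_pos rfl, one_smul]
      · intro i _ hij
        rw [he _ (hb0 i i.2), hφ i i.2 j j.2, if_neg (fun h => hij (Fin.ext h)), zero_smul]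
      · simp
    rw [h4] at h3
    exact MulOpposite.unop_injective h3
  · rw [eq_top_iff]
    rintro v -
    obtain ⟨t, rfl⟩ := Γ.frame_surjective v
    induction t with
    | zero => simp
    | add x y hx hy => rw [map_add]; exact add_mem hx hy
    | tmul x y =>
      rw [frame_tmul, ← maurerCartan_sub, hexp _ (counit_sub x)]
      refine Submodule.smul_mem _ _ (Submodule.sum_mem _ fun i hi => ?_)
      rw [← one_smul Aᵐᵒᵖ (Γ.maurerCartan (b i)), ← smul_assoc]
      exact Submodule.smul_mem _ _ (Submodule.subset_span ⟨⟨i, Finset.mem_range.1 hi⟩, rfl⟩)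
  · rw [Fintype.linearIndependent_iff]
    intro c hc j
    have := congrArg (fun l => B l (b j)) hc
    simp only [map_sum, map_smul, LinearMap.sum_apply, LinearMap.smul_apply, map_zero,
      LinearMap.zero_apply] at this
    rw [Finset.sum_eq_single j] at this
    · simpa [hφ j j.2 j j.2] using this
    · intro i _ hij
      rw [hφ j j.2 i i.2, if_neg (fun h => hij (Fin.ext h.symm)), smul_zero]
    · simp

lemma d_primitive {c : A} (hc : comul (R := k) c = c ⊗ₜ 1 + 1 ⊗ₜ c) :
    Γ.d c = Γ.maurerCartan c := by
  rw [← frame_comul, hc]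
  simp

lemma commutator_primitive {c b : A} (hc : comul (R := k) c = c ⊗ₜ 1 + 1 ⊗ₜ c)
    (hb : counit (R := k) b = 0) :
    c • Γ.maurerCartan b - MulOpposite.op c • Γ.maurerCartan b = Γ.maurerCartan (c * b) := by
  have := Γ.smul_frame c hb 1
  rw [hc] at this
  simp only [frame_tmul, MulOpposite.op_one, one_smul, add_mul,
    Algebra.TensorProduct.tmul_mul_tmul, map_add, one_mul, mul_one] at this
  rw [this, add_sub_cancel_right]

lemma isCoirreducible_iff : Γ.IsCoirreducible ↔
    Γ.ideal ≠ LinearMap.ker (counit (R := k) (A := A)) ∧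
      ∀ Γ' : BicovariantCalculus k A, Γ.ideal ≤ Γ'.ideal →
        Γ'.ideal = LinearMap.ker (counit (R := k) (A := A)) ∨ Γ.ideal = Γ'.ideal := by
  rw [IsCoirreducible, ← not_subsingleton_iff_nontrivial, subsingleton_iff]
  refine and_congr_right' ⟨fun h Γ' hle => ?_, fun h Γ' f hf => ?_⟩
  · obtain ⟨f, hf⟩ := exists_isHom hle
    rw [← subsingleton_iff, ← hf.injective_iff]
    exact h Γ' f hf
  · rw [subsingleton_iff, hf.injective_iff]
    exact h Γ' hf.ideal_le

end BicovariantCalculus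
end Existence

/-! ### Gaussian binomial coefficients -/

section QBinom

variable {K : Type u} [Field K]

/-- The Gaussian binomial coefficients in the parameter `v`. -/
def qBinom (v : K) : ℕ → ℕ → K
  | _, 0 => 1
  | 0, _ + 1 => 0
  | n + 1, i + 1 => qBinom v n i + v ^ (i + 1) * qBinom v n (i + 1)

@[simp] lemma qBinom_zero_right (v : K) (n : ℕ) : qBinom v n 0 = 1 := by cases n <;> rfl

lemma qBinom_succ_succ (v : K) (n i : ℕ) :
    qBinom v (n + 1) (i + 1) = qBinom v n i + v ^ (i + 1) * qBinom v n (i + 1) := rfl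

lemma qBinom_eq_zero (v : K) : ∀ {n i : ℕ}, n < i → qBinom v n i = 0
  | 0, _ + 1, _ => rfl
  | n + 1, i + 1, h => by
    rw [qBinom_succ_succ, qBinom_eq_zero v (by omega : n < i),
      qBinom_eq_zero v (by omega : n < i + 1), mul_zero, add_zero]

lemma qBinom_mul_one_sub (v : K) : ∀ i j : ℕ,
    qBinom v (i + j) i * (1 - v ^ j) = qBinom v (i + j) (i + 1) * (1 - v ^ (i + 1)) := by
  suffices h : ∀ n i j : ℕ, i + j = n →
      qBinom v n i * (1 - v ^ j) = qBinom v n (i + 1) * (1 - v ^ (i + 1)) from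
    fun i j => h _ i j rfl
  intro n
  induction n with
  | zero =>
    intro i j h
    obtain ⟨rfl, rfl⟩ : i = 0 ∧ j = 0 := by omega
    simp [qBinom]
  | succ n ih =>
    intro i j h
    cases i with
    | zero =>
      obtain rfl : j = n + 1 := by omega
      have := ih 0 n (by omega)
      simp only [qBinom_zero_right, qBinom_succ_succ, zero_add, pow_one] at this ⊢
      linear_combination v * this
    | succ i =>
      have h1 := ih i j (by omega)
      cases j with
      | zero => simp [qBinom_eq_zero v (by omega : n + 1 < i + 1 + 1)]
      | succ j =>
        have h2 := ih (i + 1) j (by omega)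
        simp only [qBinom_succ_succ]
        linear_combination h1 + v ^ (i + 2) * h2

lemma qBinom_one (v : K) (n : ℕ) : qBinom v n 1 * (1 - v) = 1 - v ^ n := by
  have := qBinom_mul_one_sub v 0 n
  simpa using this.symm

lemma sum_qBinom {M : Type*} [AddCommGroup M] [Module K M] (v : K) (n : ℕ) (f : ℕ → ℕ → M) :
    ∑ p ∈ Finset.HasAntidiagonal.antidiagonal n, (v ^ p.1 * qBinom v n p.1) • f p.1 (p.2 + 1) =
      f 0 (n + 1) + ∑ p ∈ Finset.HasAntidiagonal.antidiagonal n,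
        (v ^ (p.1 + 1) * qBinom v n (p.1 + 1)) • f (p.1 + 1) p.2 := by
  have h1 := Finset.Nat.sum_antidiagonal_succ (n := n)
    (f := fun p => (v ^ p.1 * qBinom v n p.1) • f p.1 p.2)
  have h2 := Finset.Nat.sum_antidiagonal_succ' (n := n)
    (f := fun p => (v ^ p.1 * qBinom v n p.1) • f p.1 p.2)
  rw [h1] at h2
  simp only [qBinom_eq_zero v (Nat.lt_succ_self n), mul_zero, zero_smul, qBinom_zero_right,
    pow_zero, mul_one, one_smul, zero_add] at h2
  rw [h2]

lemma sum_qBinom_succ {M : Type*} [AddCommGroup M] [Module K M] (v : K) (n : ℕ) (f : ℕ → ℕ → M) :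
    ∑ p ∈ Finset.HasAntidiagonal.antidiagonal (n + 1), qBinom v (n + 1) p.1 • f p.1 p.2 =
      ∑ p ∈ Finset.HasAntidiagonal.antidiagonal n, (qBinom v n p.1 • f (p.1 + 1) p.2 +
        (v ^ p.1 * qBinom v n p.1) • f p.1 (p.2 + 1)) := by
  rw [Finset.sum_add_distrib, sum_qBinom, Finset.Nat.sum_antidiagonal_succ]
  simp only [qBinom_zero_right, one_smul, qBinom_succ_succ, add_smul, Finset.sum_add_distrib]
  abel

end QBinom

/-! ### Monomials in the quantum Borel algebra -/

namespace QBorel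

open Coalgebra

variable {K : Type u} [Field K] {q : Kˣ}

lemma g_mul_X : (g K q : QBorel K q) * X K q = ((q⁻¹ : Kˣ) : K) • (X K q * (g K q : QBorel K q)) := by
  rw [X_mul_g, smul_smul, Units.inv_mul, one_smul]

lemma gInv_mul_X : (((g K q)⁻¹ : (QBorel K q)ˣ) : QBorel K q) * X K q =
    (q : K) • (X K q * (((g K q)⁻¹ : (QBorel K q)ˣ) : QBorel K q)) := (X_mul_gInv K q).symm

lemma zpow_mul_X (m : ℤ) : ((g K q ^ m : (QBorel K q)ˣ) : QBorel K q) * X K q =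
    ((q ^ (-m) : Kˣ) : K) • (X K q * ((g K q ^ m : (QBorel K q)ˣ) : QBorel K q)) := by
  induction m with
  | zero => simp
  | succ i ih =>
    rw [zpow_add_one, Units.val_mul, mul_assoc, g_mul_X, mul_smul_comm, ← mul_assoc, ih,
      smul_mul_assoc, smul_smul, mul_assoc, neg_add, zpow_add, Units.val_mul, zpow_neg_one,
      mul_comm]
  | pred i ih =>
    rw [zpow_sub_one, Units.val_mul, mul_assoc, gInv_mul_X, mul_smul_comm, ← mul_assoc, ih,
      smul_mul_assoc, smul_smul, mul_assoc, neg_sub, sub_neg_eq_add, neg_neg, add_comm (1 : ℤ),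
      zpow_add_one, Units.val_mul, mul_comm]

lemma zpow_mul_X_pow (m : ℤ) (n : ℕ) : ((g K q ^ m : (QBorel K q)ˣ) : QBorel K q) * X K q ^ n =
    ((q ^ (-m * n) : Kˣ) : K) • (X K q ^ n * ((g K q ^ m : (QBorel K q)ˣ) : QBorel K q)) := by
  induction n with
  | zero => simp
  | succ n ih =>
    rw [pow_succ, ← mul_assoc, ih, smul_mul_assoc, mul_assoc, zpow_mul_X, mul_smul_comm, smul_smul,
      ← mul_assoc, ← Units.val_mul, ← zpow_add]
    congr 4
    push_cast
    ring

lemma monomial_mul_zpow (p : ℕ × ℤ) (m : ℤ) : monomial K q p *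
    ((g K q ^ m : (QBorel K q)ˣ) : QBorel K q) = monomial K q (p.1, p.2 + m) := by
  rw [monomial, monomial, mul_assoc, zpow_add, Units.val_mul]

lemma zpow_mul_monomial (m : ℤ) (p : ℕ × ℤ) : ((g K q ^ m : (QBorel K q)ˣ) : QBorel K q) *
    monomial K q p = ((q ^ (-m * p.1) : Kˣ) : K) • monomial K q (p.1, m + p.2) := by
  rw [monomial, monomial, ← mul_assoc, zpow_mul_X_pow, smul_mul_assoc, mul_assoc, zpow_add,
    Units.val_mul]

lemma X_mul_monomial (p : ℕ × ℤ) : X K q * monomial K q p = monomial K q (p.1 + 1, p.2) := by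
  rw [monomial, monomial, ← mul_assoc, pow_succ']

lemma monomial_mul_X (p : ℕ × ℤ) :
    monomial K q p * X K q = ((q ^ (-p.2) : Kˣ) : K) • monomial K q (p.1 + 1, p.2) := by
  rw [monomial, monomial, mul_assoc, zpow_mul_X, mul_smul_comm, ← mul_assoc, pow_succ]

lemma monomial_zero : monomial K q (0, 0) = 1 := by simp [monomial]

lemma span_monomial : Submodule.span K (Set.range (monomial K q)) = ⊤ := by
  set S := Submodule.span K (Set.range (monomial K q)) with hS
  have key : ∀ a b : QBorel K q, (∀ p, a * monomial K q p ∈ S) → b ∈ S → a * b ∈ S := by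
    intro a b h hb
    induction hb using Submodule.span_induction with
    | zero => simp
    | add x y _ _ hx hy => rw [mul_add]; exact add_mem hx hy
    | smul c x _ hx => rw [mul_smul_comm]; exact S.smul_mem _ hx
    | mem x hx =>
      obtain ⟨p, rfl⟩ := hx
      exact h p
  have hm : ∀ p, monomial K q p ∈ S := fun p => Submodule.subset_span ⟨p, rfl⟩
  have h : ∀ a ∈ Algebra.adjoin K ({X K q, (g K q : QBorel K q),
      (((g K q)⁻¹ : (QBorel K q)ˣ) : QBorel K q)} : Set (QBorel K q)), ∀ b ∈ S, a * b ∈ S := by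
    intro a ha
    induction ha using Algebra.adjoin_induction with
    | algebraMap r => intro b hb; rw [← Algebra.smul_def]; exact S.smul_mem _ hb
    | add x y _ _ hx hy => intro b hb; rw [add_mul]; exact add_mem (hx b hb) (hy b hb)
    | mul x y _ _ hx hy => intro b hb; rw [mul_assoc]; exact hx _ (hy b hb)
    | mem x hx =>
      intro b hb
      refine key _ _ (fun p => ?_) hb
      rcases hx with rfl | rfl | rfl
      · rw [X_mul_monomial]; exact hm _
      · have := zpow_mul_monomial (K := K) (q := q) 1 p
        rw [zpow_one] at this
        rw [this]
        exact S.smul_mem _ (hm _)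
      · have := zpow_mul_monomial (K := K) (q := q) (-1) p
        rw [zpow_neg_one] at this
        rw [this]
        exact S.smul_mem _ (hm _)
  rw [adjoin_eq_top] at h
  rw [eq_top_iff]
  rintro a -
  have := h a Algebra.mem_top 1 (by rw [← monomial_zero]; exact hm _)
  rwa [mul_one] at this

lemma lhom_ext {M : Type*} [AddCommGroup M] [Module K M] {f f' : QBorel K q →ₗ[K] M}
    (h : ∀ p, f (monomial K q p) = f' (monomial K q p)) : f = f' :=
  LinearMap.ext_on_range span_monomial h

lemma linearCombination_coord (a : QBorel K q) :
    Finsupp.linearCombination K (monomial K q) (coord K q a) = a := by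
  have : Finsupp.linearCombination K (monomial K q) ∘ₗ coord K q = LinearMap.id :=
    lhom_ext fun p => by simp [coord_monomial]
  exact LinearMap.congr_fun this a

lemma coord_linearCombination (c : ℕ × ℤ →₀ K) :
    coord K q (Finsupp.linearCombination K (monomial K q) c) = c := by
  have : coord K q ∘ₗ Finsupp.linearCombination K (monomial K q) = LinearMap.id :=
    Finsupp.lhom_ext fun p r => by simp [coord_monomial]
  exact LinearMap.congr_fun this c

lemma linearIndependent_monomial : LinearIndependent K (monomial K q) :=
  Function.LeftInverse.injective coord_linearCombination

lemma counit_monomial (p : ℕ × ℤ) :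
    counit (R := K) (monomial K q p) = if p.1 = 0 then 1 else 0 := by
  have h : ∀ m : ℤ, counit (R := K) ((g K q ^ m : (QBorel K q)ˣ) : QBorel K q) = 1 := by
    intro m
    have : Units.map (Bialgebra.counitAlgHom K (QBorel K q) : QBorel K q →* K) (g K q) = 1 :=
      Units.ext (counit_g K q)
    have h2 := congrArg (fun u : Kˣ => ((u ^ m : Kˣ) : K)) this
    simp only [← map_zpow, one_zpow] at h2
    exact h2
  rw [monomial, Bialgebra.counit_mul, h, Bialgebra.counit_pow, counit_X, mul_one]
  rcases eq_or_ne p.1 0 with h0 | h0 <;> simp [h0]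

lemma comul_zpow (m : ℤ) : comul (R := K) ((g K q ^ m : (QBorel K q)ˣ) : QBorel K q) =
    ((g K q ^ m : (QBorel K q)ˣ) : QBorel K q) ⊗ₜ ((g K q ^ m : (QBorel K q)ˣ) : QBorel K q) := by
  have h1 : Units.map (Bialgebra.comulAlgHom K (QBorel K q) : QBorel K q →* _) (g K q) =
      gTensor K q := Units.ext (comul_g K q)
  have h2 : Units.map (Bialgebra.comulAlgHom K (QBorel K q) : QBorel K q →* _) (g K q ^ m) =
      gTensor K q ^ m := by rw [map_zpow, h1]
  refine (congrArg Units.val h2).trans ?_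
  clear h1 h2
  induction m with
  | zero => simp [Algebra.TensorProduct.one_def]
  | succ i ih =>
    rw [zpow_add_one, Units.val_mul, ih, zpow_add_one, Units.val_mul]
    exact Algebra.TensorProduct.tmul_mul_tmul _ _ _ _
  | pred i ih =>
    rw [zpow_sub_one, Units.val_mul, ih, zpow_sub_one, Units.val_mul]
    exact Algebra.TensorProduct.tmul_mul_tmul _ _ _ _

/-- The coproduct of a monomial. -/
lemma comul_monomial (n : ℕ) (m : ℤ) : comul (R := K) (monomial K q (n, m)) =
    ∑ p ∈ Finset.HasAntidiagonal.antidiagonal n, qBinom ((q⁻¹ : Kˣ) : K) n p.1 •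
      (monomial K q (p.1, p.2 + m) ⊗ₜ[K] monomial K q (p.2, m)) := by
  induction n with
  | zero => simp [monomial, comul_zpow]
  | succ n ih =>
    rw [← X_mul_monomial (n, m), Bialgebra.comul_mul, ih, comul_X, Finset.mul_sum,
      sum_qBinom_succ _ n (fun i j => monomial K q (i, j + m) ⊗ₜ[K] monomial K q (j, m))]
    refine Finset.sum_congr rfl fun p _ => ?_
    have := zpow_mul_monomial (K := K) (q := q) 1 (p.1, p.2 + m)
    rw [zpow_one] at this
    rw [mul_smul_comm, add_mul, Algebra.TensorProduct.tmul_mul_tmul,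
      Algebra.TensorProduct.tmul_mul_tmul, X_mul_monomial, X_mul_monomial, this, one_mul, smul_add,
      ← TensorProduct.smul_tmul', smul_smul, mul_comm (_ ^ _)]
    congr 3
    · rw [← Units.val_pow_eq_pow_val, ← zpow_natCast, inv_zpow', neg_mul, one_mul]
    · simp only [show (1 : ℤ) + (p.2 + m) = ((p.2 + 1 : ℕ) : ℤ) + m by push_cast; ring]

end QBorel

/-! ### The adjoint coaction of the quantum Borel algebra -/

namespace QBorel

open Coalgebra Polynomial

variable {K : Type u} [Field K] {q : Kˣ}

/-- The element `X ^ n p(g)`. -/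
def polyElem (q : Kˣ) (n : ℕ) : K[X] →ₗ[K] QBorel K q :=
  LinearMap.mulLeft K (X K q ^ n) ∘ₗ (Polynomial.aeval (g K q : QBorel K q)).toLinearMap

lemma polyElem_apply (n : ℕ) (p : K[X]) :
    polyElem q n p = X K q ^ n * Polynomial.aeval (g K q : QBorel K q) p := rfl

lemma polyElem_X_pow (n m : ℕ) : polyElem q n (Polynomial.X ^ m) = monomial K q (n, m) := by
  rw [polyElem_apply, monomial, map_pow, aeval_X, zpow_natCast, Units.val_pow_eq_pow_val]

lemma X_mul_polyElem (n : ℕ) (p : K[X]) : X K q * polyElem q n p = polyElem q (n + 1) p := by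
  rw [polyElem_apply, polyElem_apply, ← mul_assoc, pow_succ']

lemma g_mul_polyElem (n : ℕ) (p : K[X]) : (g K q : QBorel K q) * polyElem q n p =
    ((q⁻¹ : Kˣ) : K) ^ n • polyElem q n (Polynomial.X * p) := by
  have := zpow_mul_X_pow (K := K) (q := q) 1 n
  rw [zpow_one] at this
  rw [polyElem_apply, polyElem_apply, ← mul_assoc, this, smul_mul_assoc, mul_assoc, map_mul,
    aeval_X, ← Units.val_pow_eq_pow_val, ← zpow_natCast, inv_zpow', neg_mul, one_mul]

lemma antipode_X : HopfAlgebra.antipode K (X K q) =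
    -((((g K q)⁻¹ : (QBorel K q)ˣ) : QBorel K q) * X K q) := antiLinear_antipodeHom_X K q

lemma antipode_g : HopfAlgebra.antipode K (g K q : QBorel K q) =
    (((g K q)⁻¹ : (QBorel K q)ˣ) : QBorel K q) := antiLinear_antipodeHom_g K q

lemma antipode_gInv : HopfAlgebra.antipode K (((g K q)⁻¹ : (QBorel K q)ˣ) : QBorel K q) =
    (g K q : QBorel K q) := antiLinear_antipodeHom_gInv K q

lemma adCoaction_X_mul (b : QBorel K q) : adCoaction K _ (X K q * b) =
    (X K q ⊗ₜ 1 + (g K q : QBorel K q) ⊗ₜ X K q) * adCoaction K _ b +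
    ((g K q : QBorel K q) ⊗ₜ (g K q : QBorel K q)) * adCoaction K _ b *
      ((-((((g K q)⁻¹ : (QBorel K q)ˣ) : QBorel K q) * X K q)) ⊗ₜ 1) := by
  rw [adCoaction_mul, comul_X, map_add, conjBy_tmul, conjBy_tmul, antipode_X, comul_X, comul_g,
    HopfAlgebra.antipode_one, ← Algebra.TensorProduct.one_def, mul_one]

/-- The adjoint coaction commutes with right multiplication by coinvariant elements. -/
lemma _root_.BorelCalculi.adCoaction_mul_right {k A : Type u} [Field k] [Ring A] [HopfAlgebra k A]
    (a : A) {b : A} (hb : adCoaction k A b = 1 ⊗ₜ b) :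
    adCoaction k A (a * b) = adCoaction k A a * 1 ⊗ₜ b := by
  rw [adCoaction_mul, hb]
  conv_rhs => rw [← mul_one a, adCoaction_mul, adCoaction_one]
  generalize comul (R := k) a = t
  induction t with
  | zero => simp
  | add x y hx hy => simp only [map_add, add_mul, hx, hy]
  | tmul x y => simp [conjBy_tmul, mul_assoc]

lemma adCoaction_g : adCoaction K _ (g K q : QBorel K q) = 1 ⊗ₜ (g K q : QBorel K q) := by
  rw [← mul_one (g K q : QBorel K q), adCoaction_mul, comul_g, conjBy_tmul, adCoaction_one, comul_g,
    antipode_g]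
  simp

lemma adCoaction_gInv : adCoaction K _ (((g K q)⁻¹ : (QBorel K q)ˣ) : QBorel K q) =
    1 ⊗ₜ (((g K q)⁻¹ : (QBorel K q)ˣ) : QBorel K q) := by
  rw [← mul_one (((g K q)⁻¹ : (QBorel K q)ˣ) : QBorel K q), adCoaction_mul, comul_gInv,
    conjBy_tmul, adCoaction_one, comul_gInv, antipode_gInv]
  simp

lemma adCoaction_zpow (m : ℤ) : adCoaction K _ ((g K q ^ m : (QBorel K q)ˣ) : QBorel K q) =
    1 ⊗ₜ ((g K q ^ m : (QBorel K q)ˣ) : QBorel K q) := by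
  induction m with
  | zero => simp [adCoaction_one]
  | succ i ih =>
    rw [zpow_add_one, Units.val_mul, adCoaction_mul_right _ adCoaction_g, ih]
    simp
  | pred i ih =>
    rw [zpow_sub_one, Units.val_mul, adCoaction_mul_right _ adCoaction_gInv, ih]
    simp

lemma adCoaction_aeval (p : K[X]) : adCoaction K _ (aeval (g K q : QBorel K q) p) =
    1 ⊗ₜ aeval (g K q : QBorel K q) p := by
  induction p using Polynomial.induction_on' with
  | add p r hp hr => simp only [map_add, TensorProduct.tmul_add, hp, hr]
  | monomial n a =>
    have := adCoaction_zpow (K := K) (q := q) n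
    rw [zpow_natCast, Units.val_pow_eq_pow_val] at this
    rw [aeval_monomial, ← Algebra.smul_def, map_smul, this, TensorProduct.tmul_smul]

variable (K) in
/-- The polynomial `(1 - v ^ j T) ⋯ (1 - v ^ (j + i - 1) T)`. -/
def adPoly (v : K) (i j : ℕ) : K[X] := ∏ l ∈ Finset.range i, (1 - C (v ^ (j + l)) * Polynomial.X)

lemma adPoly_succ (v : K) (i j : ℕ) :
    adPoly K v (i + 1) j = adPoly K v i j * (1 - C (v ^ (j + i)) * Polynomial.X) :=
  Finset.prod_range_succ _ _

lemma adPoly_succ' (v : K) (i j : ℕ) :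
    adPoly K v (i + 1) j = adPoly K v i (j + 1) * (1 - C (v ^ j) * Polynomial.X) := by
  rw [adPoly, Finset.prod_range_succ', adPoly]
  congr 1
  refine Finset.prod_congr rfl fun l _ => ?_
  rw [add_right_comm, add_assoc]

lemma adCoaction_step (i j : ℕ) (p : K[X]) :
    (X K q ⊗ₜ[K] 1 + (g K q : QBorel K q) ⊗ₜ X K q) *
      (monomial K q (i, j) ⊗ₜ[K] polyElem q j p) +
    ((g K q : QBorel K q) ⊗ₜ[K] (g K q : QBorel K q)) * (monomial K q (i, j) ⊗ₜ[K] polyElem q j p) *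
      ((-((((g K q)⁻¹ : (QBorel K q)ˣ) : QBorel K q) * X K q)) ⊗ₜ[K] 1) =
    monomial K q (i + 1, j) ⊗ₜ[K] polyElem q j
      (p * (1 - C (((q⁻¹ : Kˣ) : K) ^ (i + j + j)) * Polynomial.X)) +
    ((q⁻¹ : Kˣ) : K) ^ i • (monomial K q (i, (j + 1 : ℕ)) ⊗ₜ[K] polyElem q (j + 1) p) := by
  have h1 := zpow_mul_monomial (K := K) (q := q) 1 (i, j)
  have h2 : (g K q : QBorel K q) * monomial K q (i, j) *
      (((g K q)⁻¹ : (QBorel K q)ˣ) : QBorel K q) =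
      ((q⁻¹ : Kˣ) : K) ^ i • monomial K q (i, j) := by
    have h3 := monomial_mul_zpow (K := K) (q := q) (i, 1 + j) (-1)
    rw [zpow_neg_one] at h3
    rw [zpow_one] at h1
    rw [h1, smul_mul_assoc]
    simp only [h3]
    rw [← Units.val_pow_eq_pow_val, ← zpow_natCast, inv_zpow', neg_mul, one_mul]
    congr 3
    ring
  rw [zpow_one] at h1
  have h5 : ((q ^ (-(j : ℤ)) : Kˣ) : K) = ((q⁻¹ : Kˣ) : K) ^ j := by
    rw [← Units.val_pow_eq_pow_val, ← zpow_natCast, inv_zpow']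
  have h6 : ((q ^ (-1 * (i : ℤ)) : Kˣ) : K) = ((q⁻¹ : Kˣ) : K) ^ i := by
    rw [← Units.val_pow_eq_pow_val, ← zpow_natCast, inv_zpow', neg_mul, one_mul]
  have h4 : (g K q : QBorel K q) * monomial K q (i, j) *
      (-((((g K q)⁻¹ : (QBorel K q)ˣ) : QBorel K q) * X K q)) =
      -(((q⁻¹ : Kˣ) : K) ^ (i + j) • monomial K q (i + 1, j)) := by
    rw [mul_neg, ← mul_assoc, h2, smul_mul_assoc, monomial_mul_X, smul_smul, h5, pow_add]
  rw [add_mul, Algebra.TensorProduct.tmul_mul_tmul, Algebra.TensorProduct.tmul_mul_tmul,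
    Algebra.TensorProduct.tmul_mul_tmul, Algebra.TensorProduct.tmul_mul_tmul, h4, h1, h6,
    X_mul_monomial, X_mul_polyElem, g_mul_polyElem, mul_one, one_mul]
  have h7 : p * (1 - C (((q⁻¹ : Kˣ) : K) ^ (i + j + j)) * Polynomial.X) =
      p - ((q⁻¹ : Kˣ) : K) ^ (i + j + j) • (Polynomial.X * p) := by
    rw [Polynomial.smul_eq_C_mul]
    ring
  rw [h7, map_sub, map_smul, TensorProduct.tmul_sub, TensorProduct.neg_tmul,
    TensorProduct.smul_tmul_smul, TensorProduct.tmul_smul, ← TensorProduct.smul_tmul', ← pow_add]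
  simp only [Nat.cast_add, Nat.cast_one, add_comm (1 : ℤ)]
  abel

/-- The adjoint coaction on `X ^ n`. -/
lemma adCoaction_X_pow (n : ℕ) : adCoaction K _ (X K q ^ n) =
    ∑ p ∈ Finset.HasAntidiagonal.antidiagonal n, qBinom ((q⁻¹ : Kˣ) : K) n p.1 •
      (monomial K q (p.1, p.2) ⊗ₜ[K] polyElem q p.2 (adPoly K ((q⁻¹ : Kˣ) : K) p.1 p.2)) := by
  set v : K := ((q⁻¹ : Kˣ) : K) with hv
  induction n with
  | zero => simp [adCoaction_one, monomial_zero, adPoly, polyElem_apply]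
  | succ n ih =>
    rw [pow_succ', adCoaction_X_mul, ih, Finset.mul_sum, Finset.mul_sum, Finset.sum_mul,
      ← Finset.sum_add_distrib]
    obtain ⟨F, hF⟩ : ∃ F : ℕ → ℕ → QBorel K q ⊗[K] QBorel K q, ∀ i j, F i j =
        monomial K q (i, j) ⊗ₜ[K] polyElem q j (adPoly K v i (j - 1)) := ⟨_, fun _ _ => rfl⟩
    have h1 : ∀ p ∈ Finset.HasAntidiagonal.antidiagonal n,
        (X K q ⊗ₜ[K] 1 + (g K q : QBorel K q) ⊗ₜ X K q) * (qBinom v n p.1 •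
          (monomial K q (p.1, p.2) ⊗ₜ[K] polyElem q p.2 (adPoly K v p.1 p.2))) +
        ((g K q : QBorel K q) ⊗ₜ[K] (g K q : QBorel K q)) * (qBinom v n p.1 •
          (monomial K q (p.1, p.2) ⊗ₜ[K] polyElem q p.2 (adPoly K v p.1 p.2))) *
          ((-((((g K q)⁻¹ : (QBorel K q)ˣ) : QBorel K q) * X K q)) ⊗ₜ[K] 1) =
        qBinom v n p.1 • (monomial K q (p.1 + 1, p.2) ⊗ₜ[K] polyElem q p.2
          (adPoly K v p.1 p.2 * (1 - C (v ^ (n + p.2)) * Polynomial.X))) +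
        (v ^ p.1 * qBinom v n p.1) • F p.1 (p.2 + 1) := by
      intro p hp
      rw [mul_smul_comm, mul_smul_comm, smul_mul_assoc, ← smul_add, adCoaction_step, smul_add,
        smul_smul, mul_comm (v ^ _), Finset.HasAntidiagonal.mem_antidiagonal.1 hp, hF,
        Nat.add_sub_cancel]
    rw [Finset.sum_congr rfl h1, Finset.sum_add_distrib, sum_qBinom,
      Finset.Nat.sum_antidiagonal_succ, add_left_comm, ← Finset.sum_add_distrib]
    congr 1
    · simp [adPoly, hF]
    refine Finset.sum_congr rfl fun p hp => ?_
    obtain ⟨i, j⟩ := p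
    obtain rfl := Finset.HasAntidiagonal.mem_antidiagonal.1 hp
    simp only [hF]
    rw [← TensorProduct.tmul_smul, ← TensorProduct.tmul_smul, ← TensorProduct.tmul_smul,
      ← TensorProduct.tmul_add, ← map_smul, ← map_smul, ← map_smul, ← map_add]
    congr 2
    rw [Polynomial.smul_eq_C_mul, Polynomial.smul_eq_C_mul, Polynomial.smul_eq_C_mul]
    have hb := congrArg (C : K → K[X]) (qBinom_mul_one_sub v i j)
    rw [qBinom_succ_succ]
    cases j with
    | zero =>
      simp only [add_zero, qBinom_eq_zero v (Nat.lt_succ_self i), mul_zero, map_zero, zero_mul,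
        adPoly_succ, zero_add]
    | succ j =>
      rw [adPoly_succ v i (j + 1), Nat.add_sub_cancel, adPoly_succ' v i j]
      simp only [map_mul, map_sub, map_pow, map_one, map_add] at hb ⊢
      linear_combination (C v ^ (i + (j + 1)) * adPoly K v i (j + 1) * Polynomial.X) * hb

/-- The adjoint coaction on `X ^ n p(g)`. -/
lemma adCoaction_polyElem (n : ℕ) (r : K[X]) : adCoaction K _ (polyElem q n r) =
    ∑ p ∈ Finset.HasAntidiagonal.antidiagonal n, qBinom ((q⁻¹ : Kˣ) : K) n p.1 •
      (monomial K q (p.1, p.2) ⊗ₜ[K]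
        polyElem q p.2 (adPoly K ((q⁻¹ : Kˣ) : K) p.1 p.2 * r)) := by
  rw [polyElem_apply, adCoaction_mul_right _ (adCoaction_aeval r), adCoaction_X_pow,
    Finset.sum_mul]
  refine Finset.sum_congr rfl fun p _ => ?_
  rw [smul_mul_assoc, Algebra.TensorProduct.tmul_mul_tmul, mul_one, polyElem_apply, polyElem_apply,
    map_mul, mul_assoc]

end QBorel

/-! ### Monomial quantum tangent spaces -/

/-- The index set of the tangent space attached to `J ⊆ ℕ`: the exponents of the monomials
`X ^ n g ^ (-j)` with `n ≤ j` and `j ∈ J ∪ {0}`. -/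
def indexSet (J : Finset ℕ) : Finset (ℕ × ℤ) :=
  (insert 0 J).biUnion fun j => (Finset.range (j + 1)).image fun n => (n, -(j : ℤ))

lemma mem_indexSet {J : Finset ℕ} {p : ℕ × ℤ} :
    p ∈ indexSet J ↔ ∃ j ∈ insert 0 J, p.1 ≤ j ∧ p.2 = -(j : ℤ) := by
  obtain ⟨n, m⟩ := p
  simp only [indexSet, Finset.mem_biUnion, Finset.mem_image, Finset.mem_range, Prod.mk.injEq,
    Order.lt_add_one_iff]
  constructor
  · rintro ⟨j, hj, i, hi, rfl, rfl⟩
    exact ⟨j, hj, hi, rfl⟩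
  · rintro ⟨j, hj, hi, rfl⟩
    exact ⟨j, hj, n, hi, rfl, rfl⟩

lemma mk_neg_mem_indexSet {J : Finset ℕ} {n j : ℕ} :
    (n, -(j : ℤ)) ∈ indexSet J ↔ j ∈ insert 0 J ∧ n ≤ j := by
  rw [mem_indexSet]
  constructor
  · rintro ⟨j', hj, h1, h2⟩
    obtain rfl : j = j' := by simpa using h2
    exact ⟨hj, h1⟩
  · rintro ⟨h1, h2⟩
    exact ⟨j, h1, h2, rfl⟩

lemma zero_mem_indexSet (J : Finset ℕ) : ((0, 0) : ℕ × ℤ) ∈ indexSet J :=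
  mem_indexSet.2 ⟨0, by simp, le_rfl, by simp⟩

lemma indexSet_subset {J J' : Finset ℕ} (h0 : 0 ∉ J) :
    indexSet J ⊆ indexSet J' ↔ J ⊆ J' := by
  constructor
  · intro h j hj
    have h1 : (0, -(j : ℤ)) ∈ indexSet J := mk_neg_mem_indexSet.2 ⟨by simp [hj], Nat.zero_le _⟩
    have h2 := (mk_neg_mem_indexSet.1 (h h1)).1
    rcases Finset.mem_insert.1 h2 with rfl | h2
    · exact absurd hj h0
    · exact h2
  · intro h p hp
    obtain ⟨j, hj, h1, h2⟩ := mem_indexSet.1 hp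
    exact mem_indexSet.2 ⟨j, Finset.insert_subset_insert 0 h hj, h1, h2⟩

lemma indexSet_inter (J J' : Finset ℕ) :
    indexSet (J ∩ J') = indexSet J ∩ indexSet J' := by
  ext ⟨n, m⟩
  rw [Finset.mem_inter, mem_indexSet, mem_indexSet, mem_indexSet]
  constructor
  · rintro ⟨j, hj, h1, h2⟩
    rw [Finset.insert_inter_distrib, Finset.mem_inter] at hj
    exact ⟨⟨j, hj.1, h1, h2⟩, ⟨j, hj.2, h1, h2⟩⟩
  · rintro ⟨⟨j, hj, h1, h2⟩, ⟨j', hj', h1', h2'⟩⟩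
    simp only at h2 h2'
    obtain rfl : j = j' := by omega
    refine ⟨j, ?_, h1, h2⟩
    rw [Finset.insert_inter_distrib]
    exact Finset.mem_inter.2 ⟨hj, hj'⟩

lemma indexSet_union (J J' : Finset ℕ) :
    indexSet (J ∪ J') = indexSet J ∪ indexSet J' := by
  rw [indexSet, Finset.insert_union_distrib, Finset.union_biUnion]
  rfl

lemma card_indexSet_singleton {j : ℕ} (hj : j ≠ 0) : (indexSet {j}).card = j + 2 := by
  have h : indexSet {j} = insert (0, 0) ((Finset.range (j + 1)).image fun n => (n, -(j : ℤ))) := by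
    simp [indexSet]
  rw [h, Finset.card_insert_of_notMem, Finset.card_image_of_injective, Finset.card_range]
  · intro a b hab
    simpa using hab
  · simp [hj]

/-- If a subspace is stable under an operator and contains a sum of eigenvectors for distinct
eigenvalues, it contains each of them. -/
lemma mem_of_sum_mem {K V ι : Type*} [Field K] [AddCommGroup V] [Module K V]
    {N : Submodule K V} {D : V →ₗ[K] V} (hD : ∀ x ∈ N, D x ∈ N) (lam : ι → K) (s : Finset ι) :
    ∀ x : ι → V, (∀ i ∈ s, D (x i) = lam i • x i) → Set.InjOn lam s → ∑ i ∈ s, x i ∈ N →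
      ∀ i ∈ s, x i ∈ N := by
  classical
  induction s using Finset.induction_on with
  | empty => simp
  | insert a s ha ih =>
    intro x hx hinj hsum
    have h1 : ∑ i ∈ s, (lam i - lam a) • x i ∈ N := by
      have h2 := N.sub_mem (hD _ hsum) (N.smul_mem (lam a) hsum)
      rw [Finset.sum_insert ha, map_add, map_sum, hx a (Finset.mem_insert_self _ _), smul_add,
        add_sub_add_left_eq_sub, Finset.smul_sum, ← Finset.sum_sub_distrib] at h2
      convert h2 using 2 with i hi
      rw [hx i (Finset.mem_insert_of_mem hi), sub_smul]
    have h3 := ih (fun i => (lam i - lam a) • x i) (fun i hi => by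
      rw [map_smul, hx i (Finset.mem_insert_of_mem hi), smul_comm]) (hinj.mono (by simp)) h1
    have h4 : ∀ i ∈ s, x i ∈ N := fun i hi => by
      refine (N.smul_mem_iff (sub_ne_zero.2 fun h => ha ?_)).1 (h3 i hi)
      rw [← hinj (by simp [hi]) (by simp) h]
      exact hi
    intro i hi
    rcases Finset.mem_insert.1 hi with rfl | hi
    · have := N.sub_mem hsum (N.sum_mem h4)
      rwa [Finset.sum_insert ha, add_sub_cancel_right] at this
    · exact h4 i hi

section Adjoint

open Coalgebra

variable {k H : Type u} [Field k] [Ring H] [HopfAlgebra k H]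

/-- The adjoint action `h ▷ x` as a linear map in `x` and in the coproduct of `h`. -/
def adjointLinear : H ⊗[k] H →ₗ[k] H →ₗ[k] H :=
  TensorProduct.lift (LinearMap.mk₂ k (fun a b => LinearMap.mulLeft k a ∘ₗ
      LinearMap.mulRight k (HopfAlgebra.antipode k b))
    (fun a a' b => by ext; simp [add_mul])
    (fun c a b => by ext; simp)
    (fun a b b' => by ext; simp [mul_add])
    (fun c a b => by ext; simp))

lemma adjointLinear_tmul (a b x : H) :
    adjointLinear (k := k) (a ⊗ₜ b) x = a * (x * HopfAlgebra.antipode k b) := rfl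

lemma adjointAction_eq (h x : H) :
    adjointAction (k := k) h x = adjointLinear (comul (R := k) h) x := by
  unfold adjointAction
  generalize comul (R := k) h = t
  induction t with
  | zero => simp
  | add x y hx hy => simp only [map_add, LinearMap.add_apply, hx, hy]
  | tmul a b => simp [adjointLinear_tmul, mul_assoc]

lemma adjointAction_mul (h h' x : H) :
    adjointAction (k := k) (h * h') x = adjointAction (k := k) h (adjointAction (k := k) h' x) := by
  rw [adjointAction_eq, adjointAction_eq, adjointAction_eq, Bialgebra.comul_mul]
  generalize comul (R := k) h = s
  generalize comul (R := k) h' = t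
  induction s with
  | zero => simp
  | add x y hx hy => simp only [map_add, add_mul, LinearMap.add_apply, hx, hy]
  | tmul a b =>
    induction t with
    | zero => simp
    | add x y hx hy => simp only [map_add, mul_add, LinearMap.add_apply, hx, hy]
    | tmul a' b' => simp [adjointLinear_tmul, mul_assoc, HopfAlgebra.antipode_mul_antidistrib]

lemma adjointAction_mem {s : Set H} (hs : Algebra.adjoin k s = ⊤) {L : Submodule k H}
    (hL : ∀ h ∈ s, ∀ x ∈ L, adjointAction (k := k) h x ∈ L) (h : H) :
    ∀ x ∈ L, adjointAction (k := k) h x ∈ L := by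
  have hh : h ∈ Algebra.adjoin k s := hs ▸ Algebra.mem_top
  induction hh using Algebra.adjoin_induction with
  | mem h hh => exact hL h hh
  | algebraMap r =>
    intro x hx
    rw [adjointAction_eq, Algebra.algebraMap_eq_smul_one, map_smul, map_smul, Bialgebra.comul_one,
      Algebra.TensorProduct.one_def, LinearMap.smul_apply, adjointLinear_tmul,
      HopfAlgebra.antipode_one, mul_one, one_mul]
    exact L.smul_mem _ hx
  | add a b _ _ ha hb =>
    intro x hx
    have := L.add_mem (ha x hx) (hb x hx)
    rwa [adjointAction_eq, adjointAction_eq, ← LinearMap.add_apply, ← map_add, ← map_add,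
      ← adjointAction_eq] at this
  | mul a b _ _ ha hb =>
    intro x hx
    rw [adjointAction_mul]
    exact ha _ (hb x hx)

end Adjoint

namespace QBorel

open Coalgebra

variable {K : Type u} [Field K] {q : Kˣ}

variable (K q) in
/-- The span of the monomials with exponents in `indexSet J`. -/
def monomialSpan (J : Finset ℕ) : Submodule K (QBorel K q) :=
  (Finsupp.supported K K (indexSet J : Set (ℕ × ℤ))).comap (coord K q)

variable (K q) in
/-- The tangent space attached to `J ⊆ ℕ`: it is spanned by the `g ^ (-j) - 1` and the
`X ^ n g ^ (-j)` with `1 ≤ n ≤ j` for `j ∈ J`. -/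
def tangent (J : Finset ℕ) : Submodule K (QBorel K q) :=
  LinearMap.ker (counit (R := K) (A := QBorel K q)) ⊓ monomialSpan K q J

lemma monomial_mem_monomialSpan {J : Finset ℕ} {p : ℕ × ℤ} :
    monomial K q p ∈ monomialSpan K q J ↔ p ∈ indexSet J := by
  rw [monomialSpan, Submodule.mem_comap, coord_monomial, Finsupp.mem_supported,
    Finsupp.support_single p (one_ne_zero)]
  simp

lemma monomialSpan_eq (J : Finset ℕ) :
    monomialSpan K q J = Submodule.span K (monomial K q '' indexSet J) := by
  apply le_antisymm
  · intro x hx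
    rw [← linearCombination_coord x]
    exact (Finsupp.mem_span_image_iff_linearCombination K).2 ⟨_, hx, rfl⟩
  · rw [Submodule.span_le]
    rintro _ ⟨p, hp, rfl⟩
    exact monomial_mem_monomialSpan.2 hp

lemma one_mem_monomialSpan (J : Finset ℕ) : (1 : QBorel K q) ∈ monomialSpan K q J := by
  rw [← monomial_zero, monomial_mem_monomialSpan]
  exact zero_mem_indexSet J

lemma map_mem_of_mem_monomialSpan {M : Type*} [AddCommGroup M] [Module K M] {J : Finset ℕ}
    (f : QBorel K q →ₗ[K] M) (N : Submodule K M) (h : ∀ p ∈ indexSet J, f (monomial K q p) ∈ N)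
    {x : QBorel K q} (hx : x ∈ monomialSpan K q J) : f x ∈ N := by
  rw [monomialSpan_eq] at hx
  have : Submodule.span K (monomial K q '' indexSet J) ≤ N.comap f := by
    rw [Submodule.span_le]
    rintro _ ⟨p, hp, rfl⟩
    exact h p hp
  exact this hx

lemma tangent_le (J : Finset ℕ) :
    tangent K q J ≤ LinearMap.ker (counit (R := K) (A := QBorel K q)) := inf_le_left

lemma contractLeft_monomial (f : QBorel K q →ₗ[K] K) (n : ℕ) (m : ℤ) :
    contractLeft f (monomial K q (n, m)) = ∑ p ∈ Finset.HasAntidiagonal.antidiagonal n,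
      (qBinom ((q⁻¹ : Kˣ) : K) n p.1 * f (monomial K q (p.1, p.2 + m))) •
        monomial K q (p.2, m) := by
  rw [contractLeft, LinearMap.comp_apply, LinearMap.comp_apply, comul_monomial, map_sum, map_sum]
  refine Finset.sum_congr rfl fun p _ => ?_
  simp [smul_smul]

lemma adjointAction_X (x : QBorel K q) : adjointAction (k := K) (X K q) x =
    X K q * x - (g K q : QBorel K q) * x * (((g K q)⁻¹ : (QBorel K q)ˣ) : QBorel K q) * X K q := by
  rw [adjointAction_eq, comul_X, map_add, LinearMap.add_apply, adjointLinear_tmul,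
    adjointLinear_tmul, antipode_X, HopfAlgebra.antipode_one, mul_one, mul_neg, mul_neg,
    ← sub_eq_add_neg]
  simp only [mul_assoc]

lemma adjointAction_g (x : QBorel K q) : adjointAction (k := K) (g K q : QBorel K q) x =
    (g K q : QBorel K q) * x * (((g K q)⁻¹ : (QBorel K q)ˣ) : QBorel K q) := by
  rw [adjointAction_eq, comul_g, adjointLinear_tmul, antipode_g, mul_assoc]

lemma adjointAction_gInv (x : QBorel K q) :
    adjointAction (k := K) (((g K q)⁻¹ : (QBorel K q)ˣ) : QBorel K q) x =
    (((g K q)⁻¹ : (QBorel K q)ˣ) : QBorel K q) * x * (g K q : QBorel K q) := by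
  rw [adjointAction_eq, comul_gInv, adjointLinear_tmul, antipode_gInv, mul_assoc]

lemma conj_zpow_monomial (m : ℤ) (p : ℕ × ℤ) : ((g K q ^ m : (QBorel K q)ˣ) : QBorel K q) *
    monomial K q p * ((g K q ^ (-m) : (QBorel K q)ˣ) : QBorel K q) =
      ((q ^ (-m * p.1) : Kˣ) : K) • monomial K q p := by
  rw [zpow_mul_monomial, smul_mul_assoc, monomial_mul_zpow]
  congr 2
  ext <;> simp

lemma adjointAction_g_monomial (p : ℕ × ℤ) : adjointAction (k := K) (g K q : QBorel K q)
    (monomial K q p) = ((q ^ (-(p.1 : ℤ)) : Kˣ) : K) • monomial K q p := by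
  have := conj_zpow_monomial (K := K) (q := q) 1 p
  rwa [zpow_one, zpow_neg_one, ← adjointAction_g, neg_one_mul] at this

lemma adjointAction_gInv_monomial (p : ℕ × ℤ) :
    adjointAction (k := K) (((g K q)⁻¹ : (QBorel K q)ˣ) : QBorel K q)
    (monomial K q p) = ((q ^ (p.1 : ℤ) : Kˣ) : K) • monomial K q p := by
  have := conj_zpow_monomial (K := K) (q := q) (-1) p
  rwa [neg_neg, zpow_one, zpow_neg_one, ← adjointAction_gInv, one_mul] at this

lemma adjointAction_X_monomial (p : ℕ × ℤ) : adjointAction (k := K) (X K q) (monomial K q p) =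
    (1 - ((q ^ (-(p.1 + p.2)) : Kˣ) : K)) • monomial K q (p.1 + 1, p.2) := by
  rw [adjointAction_X, ← adjointAction_g, adjointAction_g_monomial, X_mul_monomial,
    smul_mul_assoc, monomial_mul_X, smul_smul, ← Units.val_mul, ← zpow_add, sub_smul, one_smul]
  congr 5
  ring

/-- Projection along `1` maps `monomialSpan` to `tangent`. -/
lemma sub_counit_mem_tangent {J : Finset ℕ} {x : QBorel K q} (hx : x ∈ monomialSpan K q J) :
    x - counit (R := K) x • 1 ∈ tangent K q J := by
  refine ⟨?_, ?_⟩
  · rw [← Algebra.algebraMap_eq_smul_one]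
    exact BicovariantCalculus.counit_sub x
  · exact sub_mem hx (Submodule.smul_mem _ _ (one_mem_monomialSpan J))

/-- The adjoint action of `X` raises the degree of `X ^ n g ^ (-j)` by one with a coefficient that
vanishes for `n = j`, and the coregular action only lowers the degree; hence the monomials
`X ^ n g ^ (-j)` with `n ≤ j` span a stable subspace. This holds for any pairing. -/
theorem isQuantumTangentSpace_tangent {A : Type u} [Ring A] [HopfAlgebra K A]
    (B : QBorel K q →ₗ[K] A →ₗ[K] K) (J : Finset ℕ) :
    IsQuantumTangentSpace B (tangent K q J) := by
  refine ⟨tangent_le J,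
    fun h => adjointAction_mem (adjoin_eq_top (K := K) (q := q)) ?_ h, ?_⟩
  · rintro h hh x ⟨hx0, hx⟩
    have hx0' : counit (R := K) x = 0 := hx0
    have key : ∀ x ∈ monomialSpan K q J, adjointAction (k := K) h x ∈ monomialSpan K q J := by
      intro x hx
      rw [adjointAction_eq]
      refine map_mem_of_mem_monomialSpan (adjointLinear (comul (R := K) h)) _ (fun p hp => ?_) hx
      rw [← adjointAction_eq]
      have hp' := (monomial_mem_monomialSpan (K := K) (q := q)).2 hp
      rcases hh with rfl | rfl | rfl
      · rw [adjointAction_X_monomial]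
        obtain ⟨j, hj, h1, h2⟩ := mem_indexSet.1 hp
        rcases h1.lt_or_eq with h3 | h3
        · refine Submodule.smul_mem _ _ (monomial_mem_monomialSpan.2 (mem_indexSet.2
            ⟨j, hj, h3, h2⟩))
        · rw [h2, h3, add_neg_cancel, neg_zero, zpow_zero, Units.val_one, sub_self, zero_smul]
          exact zero_mem _
      · rw [adjointAction_g_monomial]
        exact Submodule.smul_mem _ _ hp'
      · rw [adjointAction_gInv_monomial]
        exact Submodule.smul_mem _ _ hp'
    refine ⟨?_, key x hx⟩
    change counit (R := K) _ = 0
    rcases hh with rfl | rfl | rfl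
    · rw [adjointAction_X]
      simp [counit_X]
    · rw [adjointAction_g]
      simp [hx0']
    · rw [adjointAction_gInv]
      simp [hx0']
  · rintro a x ⟨-, hx⟩
    refine sub_counit_mem_tangent ?_
    refine map_mem_of_mem_monomialSpan _ _ (fun p hp => ?_) hx
    rw [← Prod.mk.eta (p := p), contractLeft_monomial]
    refine Submodule.sum_mem _ fun r hr => Submodule.smul_mem _ _ (monomial_mem_monomialSpan.2 ?_)
    obtain ⟨j, hj, h1, h2⟩ := mem_indexSet.1 hp
    have := Finset.HasAntidiagonal.mem_antidiagonal.1 hr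
    exact mem_indexSet.2 ⟨j, hj, by simp only; omega, h2⟩

instance (J : Finset ℕ) : FiniteDimensional K (monomialSpan K q J) := by
  rw [monomialSpan_eq]
  exact FiniteDimensional.span_of_finite K ((indexSet J).finite_toSet.image _)

instance (J : Finset ℕ) : FiniteDimensional K (tangent K q J) :=
  Submodule.finiteDimensional_inf_right _ _

lemma finrank_monomialSpan (J : Finset ℕ) :
    Module.finrank K (monomialSpan K q J) = (indexSet J).card := by
  rw [monomialSpan_eq, Set.image_eq_range, finrank_span_eq_card]
  · simp
  · exact linearIndependent_monomial.comp _ Subtype.val_injective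

lemma finrank_tangent (J : Finset ℕ) :
    Module.finrank K (tangent K q J) + 1 = (indexSet J).card := by
  rw [← finrank_monomialSpan (K := K) (q := q)]
  have h1 : Submodule.span K {(1 : QBorel K q)} ⊔ tangent K q J = monomialSpan K q J := by
    apply le_antisymm
    · refine sup_le ?_ inf_le_right
      rw [Submodule.span_singleton_le_iff_mem]
      exact one_mem_monomialSpan J
    · intro x hx
      have := Submodule.add_mem_sup (Submodule.smul_mem _ (counit (R := K) x)
        (Submodule.mem_span_singleton_self (1 : QBorel K q))) (sub_counit_mem_tangent hx)
      rwa [add_sub_cancel] at this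
  have h2 : Submodule.span K {(1 : QBorel K q)} ⊓ tangent K q J = ⊥ := by
    rw [eq_bot_iff]
    rintro x ⟨h3, h4, -⟩
    obtain ⟨c, rfl⟩ := Submodule.mem_span_singleton.1 h3
    have h5 : counit (R := K) (c • (1 : QBorel K q)) = 0 := h4
    have : c = 0 := by simpa using h5
    simp [this]
  have h3 := Submodule.finrank_sup_add_finrank_inf_eq (Submodule.span K {(1 : QBorel K q)})
    (tangent K q J)
  have hone : (1 : QBorel K q) ≠ 0 := by
    intro h
    have := congrArg (counit (R := K)) h
    simp at this
  rw [h1, h2, finrank_bot, finrank_span_singleton hone] at h3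
  omega

lemma tangent_inf (J J' : Finset ℕ) : tangent K q J ⊓ tangent K q J' = tangent K q (J ∩ J') := by
  rw [tangent, tangent, tangent, ← inf_inf_distrib_left, monomialSpan, monomialSpan, monomialSpan,
    ← Submodule.comap_inf, indexSet_inter, Finset.coe_inter, Finsupp.supported_inter]

lemma tangent_le_iff {J J' : Finset ℕ} (h0 : 0 ∉ J) :
    tangent K q J ≤ tangent K q J' ↔ J ⊆ J' := by
  rw [← indexSet_subset h0]
  constructor
  · intro h p hp
    have h1 := h (sub_counit_mem_tangent (monomial_mem_monomialSpan (K := K) (q := q).2 hp))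
    have h2 := add_mem h1.2 (Submodule.smul_mem _ (counit (R := K) (monomial K q p))
      (one_mem_monomialSpan J'))
    rw [sub_add_cancel] at h2
    exact monomial_mem_monomialSpan.1 h2
  · intro h
    refine inf_le_inf_left _ (Submodule.comap_mono (Finsupp.supported_mono ?_))
    exact_mod_cast h

lemma tangent_injective {J J' : Finset ℕ} (h0 : 0 ∉ J) (h0' : 0 ∉ J')
    (h : tangent K q J = tangent K q J') : J = J' :=
  Finset.Subset.antisymm ((tangent_le_iff h0).1 h.le) ((tangent_le_iff h0').1 h.ge)

end QBorel

/-! ### Classification of the finite dimensional quantum tangent spaces -/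

namespace QBorel

open Coalgebra

variable {K : Type u} [Field K] {q : Kˣ}

/-- A bilinear form on monomials of the shape of the self-pairing of `U_q(b₊)`. -/
structure IsMonomialPairing (B : QBorel K q →ₗ[K] QBorel K q →ₗ[K] K) (c : ℕ → K) : Prop where
  zero : c 0 = 1
  ne_zero : ∀ n, c n ≠ 0
  apply : ∀ p r : ℕ × ℤ, B (monomial K q p) (monomial K q r) =
    if p.1 = r.1 then c p.1 * ((q ^ (-(p.2 * r.2)) : Kˣ) : K) else 0

lemma zpow_injective_of_not_root (hq : ∀ m : ℤ, q ^ m = 1 → m = 0) {m m' : ℤ}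
    (h : ((q ^ m : Kˣ) : K) = ((q ^ m' : Kˣ) : K)) : m = m' := by
  have h1 : q ^ (m - m') = 1 := by rw [zpow_sub, Units.ext h, mul_inv_cancel]
  have := hq _ h1
  omega

lemma qBinom_one_ne_zero (hq : ∀ m : ℤ, q ^ m = 1 → m = 0) (n : ℕ) :
    qBinom ((q⁻¹ : Kˣ) : K) (n + 1) 1 ≠ 0 := by
  intro h
  have h1 := qBinom_one ((q⁻¹ : Kˣ) : K) (n + 1)
  rw [h, zero_mul, eq_comm, sub_eq_zero, ← Units.val_pow_eq_pow_val, ← zpow_natCast,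
    inv_zpow'] at h1
  have := hq _ (Units.ext h1.symm)
  push_cast at this
  omega

variable {B : QBorel K q →ₗ[K] QBorel K q →ₗ[K] K} {c : ℕ → K}

lemma contractLeft_g (hB : IsMonomialPairing B c) (p : ℕ × ℤ) :
    contractLeft (B.flip (monomial K q (0, 1))) (monomial K q p) =
      ((q ^ (-(p.1 + p.2)) : Kˣ) : K) • monomial K q p := by
  obtain ⟨n, m⟩ := p
  rw [contractLeft_monomial, Finset.sum_eq_single (0, n)]
  · simp [hB.apply, hB.zero]
  · intro r hr hne
    have h1 : r.1 ≠ 0 := fun h => hne (by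
      have := Finset.HasAntidiagonal.mem_antidiagonal.1 hr
      ext <;> simp <;> omega)
    simp [hB.apply, h1]
  · simp

lemma contractLeft_X (hB : IsMonomialPairing B c) (n : ℕ) (m : ℤ) :
    contractLeft (B.flip (monomial K q (1, 0))) (monomial K q (n + 1, m)) =
      (qBinom ((q⁻¹ : Kˣ) : K) (n + 1) 1 * c 1) • monomial K q (n, m) := by
  rw [contractLeft_monomial, Finset.sum_eq_single (1, n)]
  · simp [hB.apply]
  · intro r hr hne
    have h1 : r.1 ≠ 1 := fun h => hne (by
      have := Finset.HasAntidiagonal.mem_antidiagonal.1 hr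
      ext <;> simp <;> omega)
    simp [hB.apply, h1]
  · intro h
    exact absurd (Finset.HasAntidiagonal.mem_antidiagonal.2 (add_comm 1 n)) h

/-- A subspace that is stable under two families of diagonal operators is spanned by monomials. -/
lemma monomial_mem_of_coord_ne_zero (hq : ∀ m : ℤ, q ^ m = 1 → m = 0) {N : Submodule K (QBorel K q)}
    {D D' : QBorel K q →ₗ[K] QBorel K q} (hD : ∀ x ∈ N, D x ∈ N) (hD' : ∀ x ∈ N, D' x ∈ N)
    (h1 : ∀ p, D (monomial K q p) = ((q ^ (-(p.1 : ℤ)) : Kˣ) : K) • monomial K q p)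
    (h2 : ∀ p, D' (monomial K q p) = ((q ^ (-(p.1 + p.2)) : Kˣ) : K) • monomial K q p)
    {x : QBorel K q} (hx : x ∈ N) {p : ℕ × ℤ} (hp : coord K q x p ≠ 0) : monomial K q p ∈ N := by
  classical
  set s := (coord K q x).support with hs
  have hx1 : ∑ n ∈ s.image Prod.fst, ∑ p ∈ s with p.1 = n, coord K q x p • monomial K q p ∈ N := by
    rw [Finset.sum_fiberwise_of_maps_to (fun p hp => Finset.mem_image_of_mem _ hp)]
    have := linearCombination_coord x
    rw [Finsupp.linearCombination_apply, Finsupp.sum] at this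
    rwa [this]
  have hps : p ∈ s := Finsupp.mem_support_iff.2 hp
  have hx2 := mem_of_sum_mem hD (fun n : ℕ => ((q ^ (-(n : ℤ)) : Kˣ) : K)) _ _ (by
    intro n _
    rw [map_sum, Finset.smul_sum]
    refine Finset.sum_congr rfl fun r hr => ?_
    rw [map_smul, h1, (Finset.mem_filter.1 hr).2, smul_comm]) (by
    intro n _ n' _ h
    have := zpow_injective_of_not_root hq h
    omega) hx1 p.1 (Finset.mem_image_of_mem _ hps)
  have hx3 := mem_of_sum_mem hD' (fun r : ℕ × ℤ => ((q ^ (-(r.1 + r.2)) : Kˣ) : K)) _ _ (by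
    intro r _
    rw [map_smul, h2, smul_comm]) (by
    intro r hr r' hr' h
    have := zpow_injective_of_not_root hq h
    have e1 : r.1 = p.1 := (Finset.mem_filter.1 hr).2
    have e2 : r'.1 = p.1 := (Finset.mem_filter.1 hr').2
    ext
    · rw [e1, e2]
    · omega) hx2 p (Finset.mem_filter.2 ⟨hps, rfl⟩)
  exact (N.smul_mem_iff hp).1 hx3

/-- Finite dimensional quantum tangent spaces are the `tangent K q J`. The conjugation by `g` and the
coregular action of `g` act on monomials by eigenvalues that separate them, so the space is spanned
by monomials up to multiples of `1`. The set of exponents is closed under lowering `n`, and under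
raising `n` as long as `n + m ≠ 0`; being finite, it consists of the `(n, -j)` with `n ≤ j` for `j`
in a finite set. -/
theorem exists_eq_tangent (hq : ∀ m : ℤ, q ^ m = 1 → m = 0) (hB : IsMonomialPairing B c)
    {L : Submodule K (QBorel K q)} (hL : IsQuantumTangentSpace B L) (hfd : FiniteDimensional K L) :
    ∃ J : Finset ℕ, 0 ∉ J ∧ L = tangent K q J := by
  classical
  obtain ⟨hε, had, hco⟩ := hL
  -- `N = L ⊕ K 1`
  set N : Submodule K (QBorel K q) :=
    L.comap (LinearMap.id - (counit (R := K) (A := QBorel K q)).smulRight 1) with hN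
  have hmem : ∀ x, x ∈ N ↔ x - counit (R := K) x • 1 ∈ L := fun x => Iff.rfl
  have hLN : L ≤ N := fun x hx => by
    rw [hmem, LinearMap.mem_ker.1 (hε hx), zero_smul, sub_zero]
    exact hx
  have h1N : (1 : QBorel K q) ∈ N := by simp [hmem]
  have hstab : ∀ D : QBorel K q →ₗ[K] QBorel K q, (∀ x ∈ L, D x ∈ N) → D 1 ∈ N →
      ∀ x ∈ N, D x ∈ N := by
    intro D hD h1 x hx
    have := N.add_mem (hD _ ((hmem x).1 hx)) (N.smul_mem (counit (R := K) x) h1)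
    rwa [← map_smul, ← map_add, sub_add_cancel] at this
  have hNfd : FiniteDimensional K N := by
    have : N ≤ L ⊔ Submodule.span K {1} := fun x hx => by
      have := Submodule.add_mem_sup ((hmem x).1 hx)
        (Submodule.smul_mem _ (counit (R := K) x) (Submodule.mem_span_singleton_self 1))
      rwa [sub_add_cancel] at this
    exact Submodule.finiteDimensional_of_le this
  have hg := hstab (adjointLinear (comul (R := K) (g K q : QBorel K q)))
    (fun x hx => hLN (by rw [← adjointAction_eq]; exact had _ x hx))
    (by rw [← adjointAction_eq, adjointAction_g]; simpa using h1N)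
  have hX := hstab (adjointLinear (comul (R := K) (X K q)))
    (fun x hx => hLN (by rw [← adjointAction_eq]; exact had _ x hx))
    (by rw [← adjointAction_eq, adjointAction_X]; simp)
  have hc : ∀ a, ∀ x ∈ N, contractLeft (B.flip a) x ∈ N := fun a =>
    hstab _ (fun x hx => hco a x hx) (by
      rw [← monomial_zero, contractLeft_monomial]
      refine N.sum_mem fun r hr => N.smul_mem _ ?_
      have : r.2 = 0 := by
        have := Finset.HasAntidiagonal.mem_antidiagonal.1 hr
        omega
      rw [this, monomial_zero]
      exact h1N)
  have hmono : ∀ x ∈ N, ∀ p, coord K q x p ≠ 0 → monomial K q p ∈ N := fun x hx p hp =>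
    monomial_mem_of_coord_ne_zero hq hg (hc _)
      (fun p => by rw [← adjointAction_eq, adjointAction_g_monomial])
      (fun p => contractLeft_g hB p) hx hp
  have hdown1 : ∀ n m, monomial K q (n + 1, m) ∈ N → monomial K q (n, m) ∈ N := by
    intro n m h
    have := hc (monomial K q (1, 0)) _ h
    rw [contractLeft_X hB] at this
    exact (N.smul_mem_iff (mul_ne_zero (qBinom_one_ne_zero hq n) (hB.ne_zero 1))).1 this
  have hdown : ∀ n m, monomial K q (n, m) ∈ N → monomial K q (0, m) ∈ N := by
    intro n m h
    induction n with
    | zero => exact h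
    | succ n ih => exact ih (hdown1 n m h)
  have hup : ∀ (n : ℕ) (m : ℤ), (n : ℤ) + m ≠ 0 → monomial K q (n, m) ∈ N →
      monomial K q (n + 1, m) ∈ N := by
    intro n m hnm h
    have := hX _ h
    rw [← adjointAction_eq, adjointAction_X_monomial] at this
    refine (N.smul_mem_iff (sub_ne_zero.2 fun h => hnm ?_)).1 this
    have h3 := hq _ (Units.ext h.symm)
    simp only at h3
    omega
  set S : Set (ℕ × ℤ) := {p | monomial K q p ∈ N} with hS
  have hSfin : S.Finite := by
    have hli : LinearIndependent K (fun p : S => (⟨monomial K q p, p.2⟩ : N)) := by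
      refine LinearIndependent.of_comp N.subtype ?_
      exact linearIndependent_monomial.comp _ Subtype.val_injective
    have : Finite S := hli.finite_of_isNoetherian
    exact Set.toFinite S
  have hneg : ∀ (n : ℕ) (m : ℤ), (n, m) ∈ S → (n : ℤ) + m ≤ 0 := by
    intro n m h
    -- a positive `n + m` would allow raising `n` indefinitely
    by_contra! hpos
    refine Set.infinite_of_injective_forall_mem (f := fun i : ℕ => (n + i, m)) (s := S)
      (fun a b hab => by simpa using hab) (fun i => ?_) hSfin
    induction i with
    | zero => exact h
    | succ i ih => exact hup (n + i) m (by push_cast; omega) ih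
  set J : Finset ℕ := (hSfin.toFinset.image fun p => (-p.2).toNat).erase 0 with hJ
  have hJmem : ∀ j : ℕ, j ∈ insert 0 J ↔ monomial K q (0, -(j : ℤ)) ∈ N := by
    intro j
    rw [hJ, Finset.mem_insert, Finset.mem_erase, Finset.mem_image]
    constructor
    · rintro (rfl | ⟨-, p, hp, rfl⟩)
      · rw [Nat.cast_zero, neg_zero, monomial_zero]
        exact h1N
      · have hp' := hSfin.mem_toFinset.1 hp
        have h1 := hneg p.1 p.2 hp'
        rw [Int.toNat_of_nonneg (by omega), neg_neg]
        exact hdown p.1 p.2 hp'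
    · intro h
      rcases Nat.eq_zero_or_pos j with h0 | h0
      · exact Or.inl h0
      · exact Or.inr ⟨h0.ne', (0, -(j : ℤ)), hSfin.mem_toFinset.2 h, by simp⟩
  have hSJ : ∀ p, p ∈ indexSet J ↔ monomial K q p ∈ N := by
    rintro ⟨n, m⟩
    rw [mem_indexSet]
    constructor
    · rintro ⟨j, hj, h1, h2⟩
      simp only at h1 h2
      have h0 := (hJmem j).1 hj
      rw [h2]
      induction n with
      | zero => exact h0
      | succ n ih => exact hup n _ (by omega) (ih (by omega))
    · intro h
      have h1 := hneg n m h
      refine ⟨(-m).toNat, (hJmem _).2 ?_, by simp only; omega, by simp only; omega⟩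
      rw [Int.toNat_of_nonneg (by omega), neg_neg]
      exact hdown n m h
  refine ⟨J, Finset.notMem_erase _ _, le_antisymm ?_ ?_⟩
  · intro x hx
    refine ⟨hε hx, ?_⟩
    rw [SetLike.mem_coe, monomialSpan, Submodule.mem_comap, Finsupp.mem_supported]
    intro p hp
    exact (hSJ p).2 (hmono x (hLN hx) p (Finsupp.mem_support_iff.1 hp))
  · rintro x ⟨hx0, hx⟩
    have h1 : x ∈ N := map_mem_of_mem_monomialSpan LinearMap.id N (fun p hp => (hSJ p).1 hp) hx
    rwa [hmem, LinearMap.mem_ker.1 hx0, zero_smul, sub_zero] at h1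

end QBorel

/-! ### Annihilators of monomial quantum tangent spaces -/

section

open Coalgebra WithConv

variable {k A : Type u} [Field k] [Ring A] [HopfAlgebra k A]

/-- The component `(f ⊗ id) Ad` of the adjoint coaction along a functional `f`. -/
def adComponent (f : A →ₗ[k] k) : A →ₗ[k] A :=
  (TensorProduct.lid k A).toLinearMap ∘ₗ f.rTensor A ∘ₗ adCoaction k A

lemma counit_adComponent (f : A →ₗ[k] k) (a : A) :
    counit (R := k) (adComponent f a) = f 1 * counit (R := k) a := by
  set e : A ⊗[k] A →ₐ[k] A := (Algebra.TensorProduct.rid k k A).toAlgHom.comp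
    (Algebra.TensorProduct.map (AlgHom.id k A) (Bialgebra.counitAlgHom k A)) with he
  have h1 : ∀ t : A ⊗[k] A, counit (R := k) (TensorProduct.lid k A (f.rTensor A t)) = f (e t) := by
    intro t
    induction t with
    | zero => simp
    | add x y hx hy => simp only [map_add, hx, hy]
    | tmul x y => simp [e, mul_comm]
  have h2 := LinearMap.algHom_comp_convMul_distrib e (toConv (comul (R := k) (A := A)))
    (toConv ((Algebra.TensorProduct.includeLeft :
      A →ₐ[k] A ⊗[k] A).toLinearMap ∘ₗ HopfAlgebra.antipode k))
  have h3 : e.toLinearMap ∘ₗ comul = LinearMap.id := by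
    ext a
    have : ∀ t : A ⊗[k] A, e t = TensorProduct.rid k A (counit.lTensor A t) := by
      intro t
      induction t with
      | zero => simp
      | add x y hx hy => simp only [map_add, hx, hy]
      | tmul x y => simp [e]
    simp [this]
  have h4 : e.toLinearMap ∘ₗ ((Algebra.TensorProduct.includeLeft :
      A →ₐ[k] A ⊗[k] A).toLinearMap ∘ₗ HopfAlgebra.antipode k) = HopfAlgebra.antipode k := by
    ext a
    simp [e]
  have h5 : e (adCoaction k A a) = algebraMap k A (counit (R := k) a) := by
    have h6 := LinearMap.congr_fun h2 a
    simp only [h3, h4, LinearMap.id_mul_antipode] at h6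
    exact h6
  have h7 := h1 (adCoaction k A a)
  rw [h5, Algebra.algebraMap_eq_smul_one, map_smul, smul_eq_mul, mul_comm] at h7
  exact h7

lemma adComponent_mul_right (f : A →ₗ[k] k) (a : A) {b : A} (hb : adCoaction k A b = 1 ⊗ₜ b) :
    adComponent f (a * b) = adComponent f a * b := by
  simp only [adComponent, LinearMap.comp_apply, adCoaction_mul_right a hb]
  generalize adCoaction k A a = t
  induction t with
  | zero => simp
  | add x y hx hy => simp only [map_add, add_mul, hx, hy]
  | tmul x y => simp

lemma BicovariantCalculus.adComponent_mem_ideal (Γ : BicovariantCalculus k A) (f : A →ₗ[k] k)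
    {m : A} (hm : m ∈ Γ.ideal) : adComponent f m ∈ Γ.ideal := by
  rw [mem_ideal] at hm ⊢
  exact ⟨by rw [counit_adComponent, hm.1, mul_zero], Γ.maurerCartan_adCoaction f hm.2⟩

end

section Polynomial

open Polynomial

/-- An ideal containing a product of distinct linear factors is the vanishing ideal of its zeros. -/
lemma mem_ideal_of_eval_eq_zero {K : Type*} [Field K] {I : Ideal K[X]} {s : Finset K}
    (hs : ∏ a ∈ s, (X - C a) ∈ I) {r : K[X]}
    (hr : ∀ a ∈ s, (∀ f ∈ I, f.eval a = 0) → r.eval a = 0) : r ∈ I := by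
  set f := Submodule.IsPrincipal.generator I with hf
  have hgen : ∀ x, x ∈ I ↔ f ∣ x := fun x => Submodule.IsPrincipal.mem_iff_generator_dvd I
  rcases eq_or_ne r 0 with rfl | hr0
  · exact zero_mem _
  have hP0 : ∏ a ∈ s, (X - C a) ≠ 0 := Finset.prod_ne_zero_iff.2 fun a _ => X_sub_C_ne_zero a
  have hdvd := (hgen _).1 hs
  have hf0 : f ≠ 0 := fun h => hP0 (zero_dvd_iff.1 (h ▸ hdvd))
  have hsplit : f.Splits := Polynomial.Splits.of_dvd
    (Polynomial.Splits.prod fun a _ => Polynomial.Splits.X_sub_C a) hP0 hdvd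
  have hroots : f.roots ≤ s.val := by
    have := Polynomial.roots.le_of_dvd hP0 hdvd
    rwa [Polynomial.roots_prod_X_sub_C] at this
  have hle : f.roots ≤ r.roots := by
    rw [Multiset.le_iff_subset (Multiset.nodup_of_le hroots s.nodup)]
    intro a ha
    have ha' : a ∈ s := Multiset.subset_of_le hroots ha
    rw [mem_roots hr0]
    refine hr a ha' fun h hh => ?_
    obtain ⟨w, rfl⟩ := (hgen h).1 hh
    rw [eval_mul, (mem_roots hf0).1 ha, zero_mul]
  rw [hgen]
  have h1 := (Multiset.prod_X_sub_C_dvd_iff_le_roots hr0 f.roots).2 hle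
  have h2 := hsplit.eq_prod_roots
  rw [h2, mul_comm]
  obtain ⟨w, hw⟩ := h1
  refine ⟨C f.leadingCoeff⁻¹ * w, ?_⟩
  rw [mul_assoc, ← mul_assoc (C _) (C _), ← C_mul, mul_inv_cancel₀ (leadingCoeff_ne_zero.2 hf0),
    C_1, one_mul]
  exact hw

end Polynomial

namespace QBorel

open Coalgebra Polynomial

variable {K : Type u} [Field K] {q : Kˣ}

variable (q) in
/-- The coordinate functional of a monomial. -/
def coordFn (p : ℕ × ℤ) : QBorel K q →ₗ[K] K := Finsupp.lapply p ∘ₗ coord K q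

lemma coordFn_monomial (p r : ℕ × ℤ) :
    coordFn q p (monomial K q r) = if r = p then 1 else 0 := by
  classical
  simp [coordFn, coord_monomial, Finsupp.single_apply]

lemma adComponent_polyElem (f : QBorel K q →ₗ[K] K) (n : ℕ) (r : K[X]) :
    adComponent f (polyElem q n r) = ∑ p ∈ Finset.HasAntidiagonal.antidiagonal n,
      (qBinom ((q⁻¹ : Kˣ) : K) n p.1 * f (monomial K q (p.1, p.2))) •
        polyElem q p.2 (adPoly K ((q⁻¹ : Kˣ) : K) p.1 p.2 * r) := by
  rw [adComponent, LinearMap.comp_apply, LinearMap.comp_apply, adCoaction_polyElem, map_sum,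
    map_sum]
  refine Finset.sum_congr rfl fun p _ => ?_
  simp [smul_smul]

lemma adComponent_zero (n n' : ℕ) (r : K[X]) :
    adComponent (coordFn q (0, (n : ℤ))) (polyElem q n' r) =
      if n' = n then polyElem q n r else 0 := by
  rw [adComponent_polyElem, Finset.sum_eq_single (0, n')]
  · rcases eq_or_ne n' n with rfl | h
    · simp [coordFn_monomial, adPoly]
    · simp [coordFn_monomial, h]
  · intro p hp hne
    have h1 : p.1 ≠ 0 := fun h => hne (by
      have := Finset.HasAntidiagonal.mem_antidiagonal.1 hp
      ext <;> simp <;> omega)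
    simp [coordFn_monomial, h1]
  · simp

lemma adComponent_one (n : ℕ) (r : K[X]) :
    adComponent (coordFn q (1, (n : ℤ))) (polyElem q (n + 1) r) =
      qBinom ((q⁻¹ : Kˣ) : K) (n + 1) 1 •
        polyElem q n ((1 - C (((q⁻¹ : Kˣ) : K) ^ n) * Polynomial.X) * r) := by
  rw [adComponent_polyElem, Finset.sum_eq_single (1, n)]
  · simp [coordFn_monomial, adPoly]
  · intro p hp hne
    have h1 : p.1 ≠ 1 := fun h => hne (by
      have := Finset.HasAntidiagonal.mem_antidiagonal.1 hp
      ext <;> simp <;> omega)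
    simp [coordFn_monomial, h1]
  · intro h
    exact absurd (Finset.HasAntidiagonal.mem_antidiagonal.2 (add_comm 1 n)) h

lemma adComponent_monomial (n : ℕ) (p : ℕ × ℤ) :
    adComponent (coordFn q (0, (n : ℤ))) (monomial K q p) =
      if p.1 = n then monomial K q p else 0 := by
  have h : monomial K q p = polyElem q p.1 1 * ((g K q ^ p.2 : (QBorel K q)ˣ) : QBorel K q) := by
    rw [polyElem_apply, map_one, mul_one, monomial]
  rw [h, adComponent_mul_right _ _ (adCoaction_zpow p.2), adComponent_zero]
  split_ifs with h1
  · rw [h1]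
  · rw [zero_mul]

/-- Sums of elements `X ^ n p(g)` over different `n`. -/
def polySum (q : Kˣ) : (ℕ →₀ K[X]) →ₗ[K] QBorel K q := Finsupp.lsum K fun n => polyElem q n

lemma polySum_apply (p : ℕ →₀ K[X]) :
    polySum q p = ∑ n ∈ p.support, polyElem q n (p n) := rfl

/-- Right multiplication by a power of `g` clears the negative powers of `g`. -/
lemma exists_mul_eq_polySum (a : QBorel K q) :
    ∃ (s : ℕ) (p : ℕ →₀ K[X]), a * (g K q : QBorel K q) ^ s = polySum q p := by
  have hshift : ∀ (t : ℕ) (p : ℕ →₀ K[X]), ∃ p', polySum q p * (g K q : QBorel K q) ^ t =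
      polySum q p' := by
    intro t p
    induction p using Finsupp.induction_linear with
    | zero => exact ⟨0, by simp⟩
    | add x y hx hy =>
      obtain ⟨x', hx⟩ := hx
      obtain ⟨y', hy⟩ := hy
      exact ⟨x' + y', by rw [map_add, map_add, add_mul, hx, hy]⟩
    | single n r =>
      refine ⟨Finsupp.single n (r * Polynomial.X ^ t), ?_⟩
      simp [polySum, polyElem_apply, mul_assoc, -Finsupp.single_mul]
  have ha : a ∈ Submodule.span K (Set.range (monomial K q)) := by
    rw [span_monomial]
    exact Submodule.mem_top
  induction ha using Submodule.span_induction with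
  | zero => exact ⟨0, 0, by simp⟩
  | add x y _ _ hx hy =>
    obtain ⟨s, x', hx⟩ := hx
    obtain ⟨t, y', hy⟩ := hy
    obtain ⟨x'', hx'⟩ := hshift t x'
    obtain ⟨y'', hy'⟩ := hshift s y'
    exact ⟨s + t, x'' + y'', by
      rw [add_mul, map_add, ← hx', ← hy', ← hx, ← hy, mul_assoc, mul_assoc, ← pow_add, ← pow_add,
        add_comm t s]⟩
  | smul c x _ hx =>
    obtain ⟨s, x', hx⟩ := hx
    exact ⟨s, c • x', by rw [map_smul, ← hx, smul_mul_assoc]⟩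
  | mem x hx =>
    obtain ⟨⟨n, m⟩, rfl⟩ := hx
    refine ⟨m.natAbs, Finsupp.single n (Polynomial.X ^ (m + m.natAbs).toNat), ?_⟩
    have h := monomial_mul_zpow (K := K) (q := q) (n, m) m.natAbs
    rw [zpow_natCast, Units.val_pow_eq_pow_val] at h
    rw [h, polySum, Finsupp.lsum_single, polyElem_X_pow, Int.toNat_of_nonneg (by omega)]

variable {B : QBorel K q →ₗ[K] QBorel K q →ₗ[K] K} {c : ℕ → K}

lemma IsMonomialPairing.apply_polyElem (hB : IsMonomialPairing B c) (n j n' : ℕ) (r : K[X]) :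
    B (monomial K q (n, -(j : ℤ))) (polyElem q n' r) =
      if n = n' then c n * r.eval ((q : K) ^ j) else 0 := by
  induction r using Polynomial.induction_on' with
  | add x y hx hy =>
    rw [map_add, map_add, hx, hy, eval_add]
    split_ifs
    · ring
    · simp
  | monomial m a =>
    rw [← C_mul_X_pow_eq_monomial, ← smul_eq_C_mul, map_smul, polyElem_X_pow, map_smul, hB.apply]
    simp only [neg_mul, neg_neg]
    split_ifs
    · rw [eval_smul, eval_pow, eval_X, smul_eq_mul, smul_eq_mul, ← pow_mul,
        ← Units.val_pow_eq_pow_val, ← zpow_natCast]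
      push_cast
      ring
    · simp

lemma IsMonomialPairing.one_left (hB : IsMonomialPairing B c) (a : QBorel K q) :
    B 1 a = counit (R := K) a := by
  have : B 1 = counit (R := K) := lhom_ext fun p => by
    rw [← monomial_zero, hB.apply, counit_monomial]
    simp [hB.zero, eq_comm]
  rw [this]

lemma IsMonomialPairing.one_right (hB : IsMonomialPairing B c) (a : QBorel K q) :
    B a 1 = counit (R := K) a := by
  have : B.flip 1 = counit (R := K) := lhom_ext fun p => by
    rw [← monomial_zero, LinearMap.flip_apply, hB.apply, counit_monomial]
    split_ifs with h
    · simp [h, hB.zero]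
    · rfl
  rw [← LinearMap.flip_apply, this]

lemma mem_annihilator_tangent {A : Type u} [Ring A] [HopfAlgebra K A]
    {B : QBorel K q →ₗ[K] A →ₗ[K] K} (hB : ∀ a, B 1 a = counit (R := K) a) {J : Finset ℕ} {a : A} :
    a ∈ annihilator B (tangent K q J) ↔ ∀ p ∈ indexSet J, B (monomial K q p) a = 0 := by
  rw [mem_annihilator]
  constructor
  · rintro ⟨h0, h⟩ p hp
    have := h _ (sub_counit_mem_tangent (monomial_mem_monomialSpan.2 hp))
    rwa [map_sub, map_smul, LinearMap.sub_apply, LinearMap.smul_apply, hB, h0, smul_zero,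
      sub_zero] at this
  · intro h
    refine ⟨?_, ?_⟩
    · rw [← hB, ← monomial_zero]
      exact h _ (zero_mem_indexSet J)
    · rintro l ⟨-, hl⟩
      have := map_mem_of_mem_monomialSpan (B.flip a) ⊥ (fun p hp => by simpa using h p hp) hl
      simpa using this

lemma annihilator_tangent_anti {A : Type u} [Ring A] [HopfAlgebra K A]
    {B : QBorel K q →ₗ[K] A →ₗ[K] K} (hB : ∀ a, B 1 a = counit (R := K) a) {J J' : Finset ℕ}
    (h : J' ⊆ J) : annihilator B (tangent K q J) ≤ annihilator B (tangent K q J') := by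
  intro a ha
  rw [mem_annihilator_tangent hB] at ha ⊢
  intro p hp
  obtain ⟨j, hj, h1⟩ := mem_indexSet.1 hp
  exact ha p (mem_indexSet.2 ⟨j, Finset.insert_subset_insert 0 h hj, h1⟩)

lemma annihilator_tangent_union {A : Type u} [Ring A] [HopfAlgebra K A]
    {B : QBorel K q →ₗ[K] A →ₗ[K] K} (hB : ∀ a, B 1 a = counit (R := K) a) (J J' : Finset ℕ) :
    annihilator B (tangent K q (J ∪ J')) =
      annihilator B (tangent K q J) ⊓ annihilator B (tangent K q J') := by
  ext a
  rw [Submodule.mem_inf, mem_annihilator_tangent hB, mem_annihilator_tangent hB,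
    mem_annihilator_tangent hB, indexSet_union]
  simp only [Finset.mem_union, or_imp, forall_and]

end QBorel

/-! ### Classification of the crossed submodules of finite codimension -/

namespace QBorel

open Coalgebra Polynomial

variable {K : Type u} [Field K] {q : Kˣ}

lemma polyElem_mul_zpow (n : ℕ) (r : K[X]) (z : ℤ) :
    polyElem q n r * ((g K q ^ z : (QBorel K q)ˣ) : QBorel K q) =
      ((q ^ (z * n) : Kˣ) : K) • (((g K q ^ z : (QBorel K q)ˣ) : QBorel K q) * polyElem q n r) := by
  induction r using Polynomial.induction_on' with
  | add x y hx hy => rw [map_add, add_mul, mul_add, smul_add, hx, hy]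
  | monomial m a =>
    rw [← C_mul_X_pow_eq_monomial, ← smul_eq_C_mul, map_smul, polyElem_X_pow, smul_mul_assoc,
      monomial_mul_zpow, mul_smul_comm, zpow_mul_monomial, smul_comm _ a, neg_mul,
      zpow_neg, smul_smul, smul_smul, mul_assoc, Units.mul_inv, mul_one, add_comm z]

/-- The coefficient of `g ^ n` in the first leg of the adjoint coaction is the projection to degree `n`
in `X`. -/
lemma adComponent_polySum (p : ℕ →₀ K[X]) (n : ℕ) :
    adComponent (coordFn q (0, (n : ℤ))) (polySum q p) = polyElem q n (p n) := by
  rw [polySum_apply, map_sum]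
  simp only [adComponent_zero]
  rw [Finset.sum_eq_single n]
  · simp
  · intro b _ hb
    rw [if_neg hb]
  · intro h
    rw [if_pos rfl, Finsupp.notMem_support_iff.1 h, map_zero]

section

variable {M : Submodule K (QBorel K q)} (hmul : ∀ c, ∀ m ∈ M, c * m ∈ M)

lemma polyElem_mul_zpow_mem (hmul : ∀ c, ∀ m ∈ M, c * m ∈ M) {n : ℕ} {r : K[X]}
    (h : polyElem q n r ∈ M) (z : ℤ) :
    polyElem q n r * ((g K q ^ z : (QBorel K q)ˣ) : QBorel K q) ∈ M := by
  rw [polyElem_mul_zpow]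
  exact M.smul_mem _ (hmul _ _ h)

/-- Left ideals which are stable under the homogeneous components of the adjoint coaction are
spanned by elements `X ^ n p(g)`, up to powers of `g`. -/
lemma mem_iff_polyElem_mem (hmul : ∀ c, ∀ m ∈ M, c * m ∈ M)
    (had : ∀ n : ℕ, ∀ m ∈ M, adComponent (coordFn q (0, (n : ℤ))) m ∈ M) {a : QBorel K q} {s : ℕ}
    {p : ℕ →₀ K[X]} (h : a * (g K q : QBorel K q) ^ s = polySum q p) :
    a ∈ M ↔ ∀ n, polyElem q n (p n) ∈ M := by
  have hs : (g K q : QBorel K q) ^ s = ((g K q ^ (s : ℤ) : (QBorel K q)ˣ) : QBorel K q) := by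
    rw [zpow_natCast, Units.val_pow_eq_pow_val]
  rw [hs] at h
  have ha : a = polySum q p * ((g K q ^ (-s : ℤ) : (QBorel K q)ˣ) : QBorel K q) := by
    rw [← h, mul_assoc, ← Units.val_mul, ← zpow_add, add_neg_cancel, zpow_zero, Units.val_one,
      mul_one]
  constructor
  · intro hm n
    have h1 : polyElem q n (p n) * ((g K q ^ (-s : ℤ) : (QBorel K q)ˣ) : QBorel K q) ∈ M := by
      rw [← adComponent_polySum, ← adComponent_mul_right _ _ (adCoaction_zpow _), ← ha]
      exact had n a hm
    rw [polyElem_mul_zpow, M.smul_mem_iff (Units.ne_zero _)] at h1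
    have h2 := hmul ((g K q ^ (s : ℤ) : (QBorel K q)ˣ) : QBorel K q) _ h1
    rwa [← mul_assoc, ← Units.val_mul, ← zpow_add, add_neg_cancel, zpow_zero, Units.val_one,
      one_mul] at h2
  · intro hn
    rw [ha, polySum_apply, Finset.sum_mul]
    exact M.sum_mem fun n _ => polyElem_mul_zpow_mem hmul (hn n) _

/-- The polynomials `p` for which `X ^ n p(g)` lies in a given left ideal. -/
def polyIdeal (M : Submodule K (QBorel K q)) (hmul : ∀ c, ∀ m ∈ M, c * m ∈ M) (n : ℕ) :
    Ideal K[X] where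
  carrier := {r | polyElem q n r ∈ M}
  add_mem' {x y} hx hy := by
    change polyElem q n (x + y) ∈ M
    rw [map_add]
    exact M.add_mem hx hy
  zero_mem' := by
    change polyElem q n 0 ∈ M
    rw [map_zero]
    exact M.zero_mem
  smul_mem' s r hr := by
    change polyElem q n (s * r) ∈ M
    have hr' : polyElem q n r ∈ M := hr
    have hX : ∀ m : ℕ, polyElem q n (Polynomial.X ^ m * r) ∈ M := by
      intro m
      induction m with
      | zero => simpa using hr'
      | succ m ih =>
        have h1 := hmul (g K q : QBorel K q) _ ih
        rw [g_mul_polyElem, M.smul_mem_iff (pow_ne_zero _ (Units.ne_zero _)), ← mul_assoc,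
          ← pow_succ'] at h1
        exact h1
    induction s using Polynomial.induction_on' with
    | add x y hx hy =>
      rw [add_mul, map_add]
      exact M.add_mem hx hy
    | monomial m a =>
      rw [← C_mul_X_pow_eq_monomial, ← smul_eq_C_mul, smul_mul_assoc, map_smul]
      exact M.smul_mem _ (hX m)

lemma mem_polyIdeal {hmul : ∀ c, ∀ m ∈ M, c * m ∈ M} {n : ℕ} {r : K[X]} :
    r ∈ polyIdeal M hmul n ↔ polyElem q n r ∈ M := Iff.rfl

lemma polyIdeal_le_add (n i : ℕ) : polyIdeal M hmul n ≤ polyIdeal M hmul (n + i) := by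
  induction i with
  | zero => exact le_rfl
  | succ i ih =>
    refine ih.trans fun r hr => ?_
    rw [mem_polyIdeal] at hr ⊢
    rw [← add_assoc, ← X_mul_polyElem]
    exact hmul _ _ hr

/-- The part of the adjoint coaction that lowers the degree in `X`. -/
lemma adPoly_mul_mem_polyIdeal (hq : ∀ m : ℤ, q ^ m = 1 → m = 0)
    (had : ∀ f : QBorel K q →ₗ[K] K, ∀ m ∈ M, adComponent f m ∈ M) (i : ℕ) :
    ∀ (n : ℕ) {r : K[X]}, r ∈ polyIdeal M hmul (n + i) →
      adPoly K ((q⁻¹ : Kˣ) : K) i n * r ∈ polyIdeal M hmul n := by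
  induction i with
  | zero =>
    intro n r hr
    simpa [adPoly] using hr
  | succ i ih =>
    intro n r hr
    rw [show n + (i + 1) = n + 1 + i by omega] at hr
    have h1 := had (coordFn q (1, (n : ℤ))) _ (mem_polyIdeal.1 (ih (n + 1) hr))
    rw [adComponent_one, M.smul_mem_iff (qBinom_one_ne_zero hq n)] at h1
    rw [mem_polyIdeal, adPoly_succ', mul_right_comm, mul_comm]
    exact h1

lemma eval_adPoly_eq_zero_iff (hq : ∀ m : ℤ, q ^ m = 1 → m = 0) (i n j : ℕ) :
    (adPoly K ((q⁻¹ : Kˣ) : K) i n).eval ((q : K) ^ j) = 0 ↔ n ≤ j ∧ j < n + i := by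
  rw [adPoly, eval_prod, Finset.prod_eq_zero_iff]
  have key : ∀ l, eval ((q : K) ^ j) (1 - C (((q⁻¹ : Kˣ) : K) ^ (n + l)) * Polynomial.X) = 0 ↔
      n + l = j := by
    intro l
    rw [eval_sub, eval_one, eval_mul, eval_C, eval_X, sub_eq_zero, ← Units.val_pow_eq_pow_val,
      ← Units.val_pow_eq_pow_val, inv_pow, eq_comm, Units.inv_mul_eq_one]
    rw [← zpow_natCast, ← zpow_natCast]
    constructor
    · intro h
      exact_mod_cast zpow_injective_of_not_root hq h
    · rintro rfl
      rfl
  constructor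
  · rintro ⟨l, hl, h⟩
    rw [Finset.mem_range] at hl
    have := (key l).1 h
    omega
  · rintro ⟨h1, h2⟩
    exact ⟨j - n, Finset.mem_range.2 (by omega), (key _).2 (by omega)⟩

/-- If the left ideal contains a power of `X`, then the polynomials `p` with `X ^ n p(g)` in it are
those which vanish at the powers `q ^ j` that are common zeros for `n = 0` and satisfy `n ≤ j`. -/
lemma mem_polyIdeal_iff (hq : ∀ m : ℤ, q ^ m = 1 → m = 0)
    (had : ∀ f : QBorel K q →ₗ[K] K, ∀ m ∈ M, adComponent f m ∈ M) {N : ℕ} (hN : X K q ^ N ∈ M) (n : ℕ) (r : K[X]) :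
    r ∈ polyIdeal M hmul n ↔ ∀ j, n ≤ j → j < N →
      (∀ f ∈ polyIdeal M hmul 0, f.eval ((q : K) ^ j) = 0) → r.eval ((q : K) ^ j) = 0 := by
  have h1 : (1 : K[X]) ∈ polyIdeal M hmul N := by
    rw [mem_polyIdeal, polyElem_apply, map_one, mul_one]
    exact hN
  constructor
  · intro hr j hj hjN hz
    rw [← zero_add n] at hr
    have h2 := hz _ (adPoly_mul_mem_polyIdeal hmul hq had n 0 hr)
    rw [eval_mul, mul_eq_zero, eval_adPoly_eq_zero_iff hq] at h2
    rcases h2 with h2 | h2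
    · omega
    · exact h2
  · intro hr
    rcases le_or_gt N n with hNn | hNn
    · have := polyIdeal_le_add hmul N (n - N) h1
      rw [show N + (n - N) = n by omega] at this
      rw [Ideal.eq_top_of_isUnit_mem _ this isUnit_one]
      exact Submodule.mem_top
    have hP := adPoly_mul_mem_polyIdeal hmul hq had (N - n) n
      (r := 1) (by rwa [show n + (N - n) = N by omega])
    rw [mul_one] at hP
    have hinj : Set.InjOn (fun l : ℕ => (q : K) ^ (n + l)) (Finset.range (N - n)) := by
      intro a _ b _ hab
      simp only [← Units.val_pow_eq_pow_val] at hab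
      rw [← zpow_natCast, ← zpow_natCast] at hab
      have := zpow_injective_of_not_root hq hab
      omega
    classical
    refine mem_ideal_of_eval_eq_zero
      (s := (Finset.range (N - n)).image fun l => (q : K) ^ (n + l)) ?_ ?_
    · rw [Finset.prod_image hinj]
      have h3 : ∏ l ∈ Finset.range (N - n), (Polynomial.X - C ((q : K) ^ (n + l))) =
          (∏ l ∈ Finset.range (N - n), C (-(q : K) ^ (n + l))) *
            adPoly K ((q⁻¹ : Kˣ) : K) (N - n) n := by
        rw [adPoly, ← Finset.prod_mul_distrib]
        refine Finset.prod_congr rfl fun l _ => ?_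
        have h4 : C (-(q : K) ^ (n + l)) * C (((q⁻¹ : Kˣ) : K) ^ (n + l)) = (-1 : K[X]) := by
          rw [← C_mul, neg_mul, ← mul_pow, Units.mul_inv, one_pow, C_neg, C_1]
        rw [mul_sub, ← mul_assoc, h4, mul_one, C_neg]
        ring
      rw [h3]
      exact Ideal.mul_mem_left _ _ hP
    · intro a ha hf
      obtain ⟨l, hl, rfl⟩ := Finset.mem_image.1 ha
      rw [Finset.mem_range] at hl
      refine hr _ (by omega) (by omega) fun f hf0 => hf f ?_
      have := polyIdeal_le_add hmul 0 n hf0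
      rwa [zero_add] at this

end

variable {B : QBorel K q →ₗ[K] QBorel K q →ₗ[K] K} {c : ℕ → K}

lemma IsMonomialPairing.apply_zpow_mul (hB : IsMonomialPairing B c) (n : ℕ) (m z : ℤ)
    (a : QBorel K q) :
    B (monomial K q (n, m)) (((g K q ^ z : (QBorel K q)ˣ) : QBorel K q) * a) =
      ((q ^ (-((m + n) * z)) : Kˣ) : K) * B (monomial K q (n, m)) a := by
  have : B (monomial K q (n, m)) ∘ₗ LinearMap.mulLeft K
      ((g K q ^ z : (QBorel K q)ˣ) : QBorel K q) =
        ((q ^ (-((m + n) * z)) : Kˣ) : K) • B (monomial K q (n, m)) := by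
    refine lhom_ext fun p => ?_
    rw [LinearMap.comp_apply, LinearMap.mulLeft_apply, zpow_mul_monomial, map_smul,
      LinearMap.smul_apply, hB.apply, hB.apply, smul_eq_mul, smul_eq_mul]
    simp only
    split_ifs with h
    · rw [mul_left_comm, mul_left_comm _ (c n), ← Units.val_mul, ← Units.val_mul, ← zpow_add,
        ← zpow_add, h]
      congr 3
      ring
    · simp
  exact LinearMap.congr_fun this a

lemma IsMonomialPairing.apply_X_mul (hB : IsMonomialPairing B c) (n : ℕ) (m : ℤ)
    (a : QBorel K q) :
    B (monomial K q (n + 1, m)) (X K q * a) = c (n + 1) * (c n)⁻¹ * B (monomial K q (n, m)) a := by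
  have : B (monomial K q (n + 1, m)) ∘ₗ LinearMap.mulLeft K (X K q) =
        (c (n + 1) * (c n)⁻¹) • B (monomial K q (n, m)) := by
    refine lhom_ext fun p => ?_
    rw [LinearMap.comp_apply, LinearMap.mulLeft_apply, X_mul_monomial,
      LinearMap.smul_apply, hB.apply, hB.apply, smul_eq_mul]
    simp only [add_left_inj]
    split_ifs with h
    · rw [← mul_assoc, inv_mul_cancel_right₀ (hB.ne_zero n)]
    · simp
  exact LinearMap.congr_fun this a

lemma IsMonomialPairing.apply_X_mul_zero (hB : IsMonomialPairing B c) (m : ℤ)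
    (a : QBorel K q) : B (monomial K q (0, m)) (X K q * a) = 0 := by
  have : B (monomial K q (0, m)) ∘ₗ LinearMap.mulLeft K (X K q) = 0 := by
    refine lhom_ext fun p => ?_
    rw [LinearMap.comp_apply, LinearMap.mulLeft_apply, X_mul_monomial, hB.apply]
    simp
  exact LinearMap.congr_fun this a

lemma mul_mem_of_generators {M : Submodule K (QBorel K q)} (hX : ∀ m ∈ M, X K q * m ∈ M)
    (hg : ∀ z : ℤ, ∀ m ∈ M, ((g K q ^ z : (QBorel K q)ˣ) : QBorel K q) * m ∈ M)
    (a : QBorel K q) : ∀ m ∈ M, a * m ∈ M := by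
  have ha : a ∈ Algebra.adjoin K ({X K q, (g K q : QBorel K q),
      (((g K q)⁻¹ : (QBorel K q)ˣ) : QBorel K q)} : Set (QBorel K q)) := by
    rw [adjoin_eq_top]
    exact Algebra.mem_top
  induction ha using Algebra.adjoin_induction with
  | mem x hx =>
    rcases hx with rfl | rfl | rfl
    · exact hX
    · simpa using hg 1
    · simpa using hg (-1)
  | algebraMap r =>
    intro m hm
    rw [← Algebra.smul_def]
    exact M.smul_mem _ hm
  | add x y _ _ hx hy =>
    intro m hm
    rw [add_mul]
    exact M.add_mem (hx m hm) (hy m hm)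
  | mul x y _ _ hx hy =>
    intro m hm
    rw [mul_assoc]
    exact hx _ (hy m hm)

lemma IsMonomialPairing.mul_mem_annihilator (hB : IsMonomialPairing B c) (J : Finset ℕ)
    (a : QBorel K q) : ∀ m ∈ annihilator B (tangent K q J), a * m ∈ annihilator B (tangent K q J) := by
  refine mul_mem_of_generators (fun m hm => ?_) (fun z m hm => ?_) a
  · rw [mem_annihilator_tangent hB.one_left] at hm ⊢
    rintro ⟨n, z⟩ hp
    obtain ⟨j, hj, h1, rfl⟩ := mem_indexSet.1 hp
    cases n with
    | zero => exact hB.apply_X_mul_zero _ _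
    | succ n =>
      rw [hB.apply_X_mul, hm _ (mk_neg_mem_indexSet.2 ⟨hj, by simp only at h1; omega⟩), mul_zero]
  · rw [mem_annihilator_tangent hB.one_left] at hm ⊢
    rintro ⟨n, z⟩ hp
    rw [hB.apply_zpow_mul, hm _ hp, mul_zero]

lemma IsMonomialPairing.adComponent_mem_annihilator (hB : IsMonomialPairing B c) (J : Finset ℕ)
    (n : ℕ) : ∀ m ∈ annihilator B (tangent K q J),
      adComponent (coordFn q (0, (n : ℤ))) m ∈ annihilator B (tangent K q J) := by
  intro m hm
  rw [mem_annihilator_tangent hB.one_left] at hm ⊢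
  intro p hp
  have : B (monomial K q p) ∘ₗ adComponent (coordFn q (0, (n : ℤ))) =
      if p.1 = n then B (monomial K q p) else 0 := by
    refine lhom_ext fun r => ?_
    rw [LinearMap.comp_apply, adComponent_monomial]
    split_ifs with h1 h2 h2
    · rfl
    · rw [hB.apply, if_neg (by omega)]
      rfl
    · rw [hB.apply, if_neg (by omega), map_zero]
    · simp
  have h2 := LinearMap.congr_fun this m
  rw [LinearMap.comp_apply] at h2
  rw [h2]
  split_ifs
  · exact hm p hp
  · rfl

lemma IsMonomialPairing.polyElem_mem_annihilator (hB : IsMonomialPairing B c) {J : Finset ℕ}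
    {n : ℕ} {r : K[X]} : polyElem q n r ∈ annihilator B (tangent K q J) ↔
      ∀ j ∈ insert 0 J, n ≤ j → r.eval ((q : K) ^ j) = 0 := by
  rw [mem_annihilator_tangent hB.one_left]
  constructor
  · intro h j hj hn
    have := h _ (mk_neg_mem_indexSet.2 ⟨hj, hn⟩)
    rw [hB.apply_polyElem, if_pos rfl, mul_eq_zero] at this
    exact this.resolve_left (hB.ne_zero n)
  · rintro h ⟨i, m⟩ hp
    obtain ⟨j, hj, h1, h2⟩ := mem_indexSet.1 hp
    simp only at h1 h2
    rw [h2, hB.apply_polyElem]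
    split_ifs with h3
    · rw [h j hj (by omega), mul_zero]
    · rfl

/-- Crossed submodules of finite codimension are the annihilators of the quantum tangent spaces
spanned by monomials. Finite codimension is expressed by a linear map `f` to a finite dimensional
space whose kernel in `ker ε` is contained in `M`. -/
theorem exists_eq_annihilator (hq : ∀ m : ℤ, q ^ m = 1 → m = 0) (hB : IsMonomialPairing B c)
    {M : Submodule K (QBorel K q)} (hM : M ≤ LinearMap.ker (counit (R := K) (A := QBorel K q)))
    (hmul : ∀ c, ∀ m ∈ M, c * m ∈ M) (had : ∀ f : QBorel K q →ₗ[K] K, ∀ m ∈ M, adComponent f m ∈ M)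
    {V : Type*} [AddCommGroup V] [Module K V] [FiniteDimensional K V] (f : QBorel K q →ₗ[K] V)
    (hf : LinearMap.ker (counit (R := K) (A := QBorel K q)) ⊓ LinearMap.ker f ≤ M) :
    ∃ J : Finset ℕ, 0 ∉ J ∧ M = annihilator B (tangent K q J) := by
  classical
  -- a linear relation between the `f (X ^ (i + 1))` yields an element of `M`, whose homogeneous
  -- components lie in `M`
  have hN : ∃ N, X K q ^ N ∈ M := by
    have hdep : ¬ LinearIndependent K fun i : ℕ => f (X K q ^ (i + 1)) := by
      intro h
      have := h.finite_of_isNoetherian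
      exact not_finite ℕ
    rw [linearIndependent_iff] at hdep
    push Not at hdep
    obtain ⟨l, hl, hl0⟩ := hdep
    obtain ⟨i, hi⟩ := Finsupp.ne_iff.1 hl0
    have hx : ∀ i : ℕ, X K q ^ i = monomial K q (i, 0) := fun i => by simp [monomial]
    have h1 : l.sum (fun i a => a • X K q ^ (i + 1)) ∈ M := by
      refine hf ⟨?_, ?_⟩
      · change counit (R := K) _ = 0
        rw [Finsupp.sum, map_sum]
        refine Finset.sum_eq_zero fun i _ => ?_
        rw [map_smul, hx, counit_monomial]
        simp
      · change f _ = 0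
        rw [← hl, Finsupp.linearCombination_apply, Finsupp.sum, map_sum]
        simp [Finsupp.sum]
    refine ⟨i + 1, ?_⟩
    have h2 := had (coordFn q (0, ((i + 1 : ℕ) : ℤ))) _ h1
    rw [Finsupp.sum, map_sum, Finset.sum_eq_single i] at h2
    · rw [map_smul, hx, adComponent_monomial, if_pos rfl, M.smul_mem_iff (by simpa using hi),
        ← hx] at h2
      exact h2
    · intro b _ hb
      rw [map_smul, hx, adComponent_monomial, if_neg (by simpa using hb), smul_zero]
    · intro h
      exact absurd (Finsupp.mem_support_iff.2 (by simpa using hi)) h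
  obtain ⟨N, hN⟩ := hN
  -- the exponents of the zeros `q ^ j` of the polynomials `f` with `f(g) ∈ M`
  set Z : ℕ → Prop := fun j => ∀ f ∈ polyIdeal M hmul 0, f.eval ((q : K) ^ j) = 0 with hZ
  have hZ0 : Z 0 := by
    intro f hf0
    have h1 : counit (R := K) (polyElem q 0 f) = 0 := hM (mem_polyIdeal.1 hf0)
    rw [← hB.one_left, ← monomial_zero] at h1
    have h2 := hB.apply_polyElem 0 0 0 f
    rw [Nat.cast_zero, neg_zero, h1, if_pos rfl, hB.zero, one_mul] at h2
    exact h2.symm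
  have hZN : ∀ j, Z j → j < N := by
    intro j hj
    have h1 : (1 : K[X]) ∈ polyIdeal M hmul (0 + N) := by
      rw [mem_polyIdeal, polyElem_apply, map_one, mul_one, zero_add]
      exact hN
    have := hj _ (adPoly_mul_mem_polyIdeal hmul hq had N 0 h1)
    rw [mul_one, eval_adPoly_eq_zero_iff hq] at this
    omega
  set J := ((Finset.range N).filter Z).erase 0 with hJ
  have hJZ : ∀ j, j ∈ insert 0 J ↔ Z j := by
    intro j
    rw [hJ, Finset.mem_insert, Finset.mem_erase, Finset.mem_filter, Finset.mem_range]
    constructor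
    · rintro (rfl | h)
      · exact hZ0
      · exact h.2.2
    · intro h
      rcases eq_or_ne j 0 with h0 | h0
      · exact Or.inl h0
      · exact Or.inr ⟨h0, hZN j h, h⟩
  refine ⟨J, Finset.notMem_erase _ _, ?_⟩
  ext a
  obtain ⟨s, p, h⟩ := exists_mul_eq_polySum a
  rw [mem_iff_polyElem_mem hmul (fun n => had _) h,
    mem_iff_polyElem_mem (hB.mul_mem_annihilator J) (hB.adComponent_mem_annihilator J) h]
  refine forall_congr' fun n => ?_
  rw [hB.polyElem_mem_annihilator, ← mem_polyIdeal (hmul := hmul),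
    mem_polyIdeal_iff hmul hq had hN]
  constructor
  · intro h1 j hj hn
    exact h1 j hn (hZN j ((hJZ j).1 hj)) ((hJZ j).1 hj)
  · intro h1 j hn _ hj
    exact h1 j ((hJZ j).2 hj) hn

/-- The annihilator of a monomial quantum tangent space is the crossed submodule of a calculus: the
term of degree `j < n` in `Ad(X ^ n p(g))` carries a polynomial factor that vanishes at `q ^ l` for
`j ≤ l < n`. -/
theorem exists_calculus_of_tangent (hq : ∀ m : ℤ, q ^ m = 1 → m = 0) (hB : IsMonomialPairing B c)
    (J : Finset ℕ) :
    ∃ Γ : BicovariantCalculus K (QBorel K q), Γ.ideal = annihilator B (tangent K q J) := by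
  set M := annihilator B (tangent K q J) with hM
  refine exists_calculus M inf_le_left (hB.mul_mem_annihilator J) fun a ha => ?_
  have htmul : ∀ x, ∀ m ∈ M, x ⊗ₜ[K] m ∈ LinearMap.range (M.subtype.lTensor (QBorel K q)) :=
    fun x m hm => ⟨x ⊗ₜ ⟨m, hm⟩, by simp⟩
  obtain ⟨s, p, h⟩ := exists_mul_eq_polySum a
  have hp := (mem_iff_polyElem_mem (hB.mul_mem_annihilator J)
    (hB.adComponent_mem_annihilator J) h).1 ha
  have ha' : a = polySum q p * ((g K q ^ (-s : ℤ) : (QBorel K q)ˣ) : QBorel K q) := by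
    rw [← h, ← Units.val_pow_eq_pow_val, ← zpow_natCast, mul_assoc, ← Units.val_mul, ← zpow_add,
      add_neg_cancel, zpow_zero, Units.val_one, mul_one]
  rw [ha', polySum_apply, Finset.sum_mul, map_sum]
  refine Submodule.sum_mem _ fun n _ => ?_
  rw [adCoaction_mul_right _ (adCoaction_zpow _), adCoaction_polyElem, Finset.sum_mul]
  refine Submodule.sum_mem _ fun r hr => ?_
  rw [smul_mul_assoc, Algebra.TensorProduct.tmul_mul_tmul, mul_one]
  refine Submodule.smul_mem _ _ (htmul _ _ ?_)
  refine polyElem_mul_zpow_mem (hB.mul_mem_annihilator J) ?_ _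
  rw [hB.polyElem_mem_annihilator]
  intro j hj hrj
  have hr' := Finset.HasAntidiagonal.mem_antidiagonal.1 hr
  rw [eval_mul, mul_eq_zero]
  rcases le_or_gt n j with hnj | hnj
  · exact Or.inr (hB.polyElem_mem_annihilator.1 (hp n) j hj hnj)
  · exact Or.inl ((eval_adPoly_eq_zero_iff hq _ _ _).2 ⟨hrj, by omega⟩)

end QBorel

/-! ### Calculi and quantum tangent spaces over `k(q)` -/

open Coalgebra

/-- Distinct geometric progressions are linearly independent. -/
lemma eq_zero_of_sum_mul_pow_eq_zero {K ι : Type*} [Field K] {s : Finset ι} {a lam : ι → K}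
    (hlam : Set.InjOn lam s) (h : ∀ j : ℕ, ∑ i ∈ s, a i * lam i ^ j = 0) : ∀ i ∈ s, a i = 0 := by
  classical
  have hP : ∀ P : Polynomial K, ∑ i ∈ s, a i * P.eval (lam i) = 0 := by
    intro P
    simp only [Polynomial.eval_eq_sum_range, Finset.mul_sum]
    rw [Finset.sum_comm]
    refine Finset.sum_eq_zero fun j _ => ?_
    have : ∑ i ∈ s, a i * (P.coeff j * lam i ^ j) = P.coeff j * ∑ i ∈ s, a i * lam i ^ j := by
      rw [Finset.mul_sum]
      exact Finset.sum_congr rfl fun i _ => by ring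
    rw [this, h, mul_zero]
  intro i hi
  have h1 := hP (∏ l ∈ s.erase i, (Polynomial.X - Polynomial.C (lam l)))
  rw [Finset.sum_eq_single_of_mem i hi, Polynomial.eval_prod, mul_eq_zero,
    Finset.prod_eq_zero_iff] at h1
  · refine h1.resolve_right ?_
    rintro ⟨l, hl, h2⟩
    simp only [Polynomial.eval_sub, Polynomial.eval_X, Polynomial.eval_C, sub_eq_zero] at h2
    exact (Finset.mem_erase.1 hl).1 (hlam (Finset.mem_erase.1 hl).2 hi h2.symm)
  · intro l hl hli
    rw [Polynomial.eval_prod, Finset.prod_eq_zero (Finset.mem_erase.2 ⟨hli, hl⟩), mul_zero]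
    simp

namespace QBorel

variable {K : Type u} [Field K] {q : Kˣ}

lemma apply_eq_sum {A : Type*} [AddCommGroup A] [Module K A] (B : QBorel K q →ₗ[K] A →ₗ[K] K)
    (x : QBorel K q) (a : A) :
    B x a = ∑ p ∈ (coord K q x).support, coord K q x p * B (monomial K q p) a := by
  conv_lhs => rw [← linearCombination_coord x, Finsupp.linearCombination_apply, Finsupp.sum, map_sum,
    LinearMap.sum_apply]
  refine Finset.sum_congr rfl fun p _ => ?_
  rw [map_smul, LinearMap.smul_apply, smul_eq_mul]

/-- A form that is diagonal in the degree of `X` and geometric in the exponent of `g` is nondegenerate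
on the left, because distinct geometric progressions are linearly independent. -/
lemma injective_of_apply_eq {A : Type*} [AddCommGroup A] [Module K A]
    {B : QBorel K q →ₗ[K] A →ₗ[K] K} (e : ℕ → ℕ → A) {c : ℕ → K} (hc : ∀ n, c n ≠ 0) {lam : ℤ → K}
    (hlam : Function.Injective lam)
    (h : ∀ p n s, B (monomial K q p) (e n s) = if p.1 = n then c n * lam p.2 ^ s else 0) :
    Function.Injective B := by
  rw [injective_iff_map_eq_zero]
  intro x hx
  have h1 : coord K q x = 0 := by
    ext p
    by_contra hp
    refine hp ?_
    have h2 := eq_zero_of_sum_mul_pow_eq_zero (s := (coord K q x).support.filter (·.1 = p.1))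
      (a := fun r => coord K q x r * c p.1) (lam := fun r => lam r.2) (by
        intro r hr r' hr' hrr
        have h3 := (Finset.mem_filter.1 hr).2
        have h4 := (Finset.mem_filter.1 hr').2
        exact Prod.ext (h3.trans h4.symm) (hlam hrr)) (fun j => by
        have h3 := apply_eq_sum B x (e p.1 j)
        rw [hx, LinearMap.zero_apply] at h3
        rw [h3, Finset.sum_filter]
        refine Finset.sum_congr rfl fun r _ => ?_
        rw [h]
        split_ifs
        · ring
        · simp) p (Finset.mem_filter.2 ⟨Finsupp.mem_support_iff.2 hp, rfl⟩)
    exact (mul_eq_zero.1 h2).resolve_right (hc _)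
  rw [← linearCombination_coord x, h1, map_zero]

lemma IsMonomialPairing.injective (hq : ∀ m : ℤ, q ^ m = 1 → m = 0)
    {B : QBorel K q →ₗ[K] QBorel K q →ₗ[K] K} {c : ℕ → K} (hB : IsMonomialPairing B c) :
    Function.Injective B := by
  refine injective_of_apply_eq (fun n s => monomial K q (n, s)) hB.ne_zero
    (lam := fun m => ((q ^ (-m) : Kˣ) : K)) (fun m m' h => ?_) fun p n s => ?_
  · have := zpow_injective_of_not_root hq h
    omega
  · rw [hB.apply]
    simp only
    split_ifs with h
    · rw [h, ← Units.val_pow_eq_pow_val, ← zpow_natCast, ← zpow_mul, neg_mul]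
    · rfl

/-- Annihilators determine the monomial quantum tangent spaces. -/
lemma annihilator_tangent_injective {A : Type u} [Ring A] [HopfAlgebra K A]
    {B : QBorel K q →ₗ[K] A →ₗ[K] K} (hB : Function.Injective B)
    (hB1 : ∀ x, B x 1 = counit (R := K) x) {Γ : BicovariantCalculus K A} {J J' : Finset ℕ}
    (h0 : 0 ∉ J) (h0' : 0 ∉ J') (hJ : Γ.ideal = annihilator B (tangent K q J))
    (hJ' : Γ.ideal = annihilator B (tangent K q J')) : J = J' :=
  tangent_injective h0 h0' ((BicovariantCalculus.tangentSpace_eq hB hB1 (tangent_le J) hJ).symm.trans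
    (BicovariantCalculus.tangentSpace_eq hB hB1 (tangent_le J') hJ'))

end QBorel

section Uq

variable (k : Type u) [Field k]

/-- The indeterminate `q` as a unit of `k(q)`. -/
abbrev qUnit : (RatFunc k)ˣ := Units.mk0 (RatFunc.X : RatFunc k) RatFunc.X_ne_zero

variable {k}

lemma qUnit_zpow_eq_one (m : ℤ) (h : qUnit k ^ m = 1) : m = 0 := by
  have hnat : ∀ n : ℕ, qUnit k ^ n = 1 → n = 0 := by
    intro n hn
    have h1 := congrArg Units.val hn
    rw [Units.val_pow_eq_pow_val, Units.val_mk0, Units.val_one, ← RatFunc.algebraMap_X, ← map_pow,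
      ← map_one (algebraMap (Polynomial k) (RatFunc k))] at h1
    have h2 := congrArg Polynomial.natDegree (RatFunc.algebraMap_injective k h1)
    simpa using h2
  have h1 := hnat m.natAbs (by
    rcases Int.natAbs_eq m with h2 | h2
    · rw [h2, zpow_natCast] at h
      exact h
    · rw [h2, zpow_neg, zpow_natCast, inv_eq_one] at h
      exact h)
  omega

variable (k) in
/-- The values `⟨X ^ n, X ^ n⟩` of the self-pairing. -/
def qPairingCoeff (n : ℕ) : RatFunc k :=
  qFactorial (RatFunc.X : RatFunc k) n * (RatFunc.X : RatFunc k) ^ (-((n * (n - 1) / 2 : ℕ) : ℤ))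

lemma isMonomialPairing_qPairing : QBorel.IsMonomialPairing (qPairing k) (qPairingCoeff k) where
  zero := by simp [qPairingCoeff, qFactorial]
  ne_zero n := by
    refine mul_ne_zero (Finset.prod_ne_zero_iff.2 fun i _ h => ?_)
      (zpow_ne_zero _ RatFunc.X_ne_zero)
    have h1 := geom_sum_mul (RatFunc.X : RatFunc k) (i + 1)
    rw [h, zero_mul, eq_comm, sub_eq_zero] at h1
    have := qUnit_zpow_eq_one (k := k) ((i + 1 : ℕ) : ℤ) (by
      ext
      rw [zpow_natCast, Units.val_pow_eq_pow_val, Units.val_mk0, h1, Units.val_one])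
    omega
  apply p r := by
    rw [qPairing_monomial, qPairingCoeff, Units.val_zpow_eq_zpow_val, Units.val_mk0]

lemma qPairing_injective : Function.Injective (qPairing k) :=
  isMonomialPairing_qPairing.injective qUnit_zpow_eq_one

/-- The quantum tangent space in `U_q(b₊)` that belongs to a finite set of positive integers. -/
abbrev tangentQ (k : Type u) [Field k] (J : Finset ℕ) : Submodule (RatFunc k) (Uq k) :=
  QBorel.tangent (RatFunc k) (qUnit k) J

/-- Every quotient of a finite dimensional calculus, in particular the calculus itself, has a crossed
submodule of the form `annihilator (tangentQ k J)`. -/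
lemma exists_ideal_eq {Γ : BicovariantCalculus (RatFunc k) (Uq k)} (hfd : Γ.IsFiniteDimensional)
    {Γ' : BicovariantCalculus (RatFunc k) (Uq k)} (hle : Γ.ideal ≤ Γ'.ideal) :
    ∃ J : Finset ℕ, 0 ∉ J ∧ Γ'.ideal = annihilator (qPairing k) (tangentQ k J) := by
  have : FiniteDimensional (RatFunc k) Γ.rightInvariant := hfd
  refine QBorel.exists_eq_annihilator qUnit_zpow_eq_one isMonomialPairing_qPairing
    inf_le_left (fun c m hm => Γ'.mul_mem_ideal c hm) (fun f m hm => Γ'.adComponent_mem_ideal f hm)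
    (Γ.maurerCartan.codRestrict Γ.rightInvariant Γ.maurerCartan_mem) ?_
  rw [LinearMap.ker_codRestrict]
  exact hle

lemma exists_calculus_tangentQ (J : Finset ℕ) :
    ∃ Γ : BicovariantCalculus (RatFunc k) (Uq k),
      Γ.ideal = annihilator (qPairing k) (tangentQ k J) :=
  QBorel.exists_calculus_of_tangent qUnit_zpow_eq_one isMonomialPairing_qPairing J

section

variable {Γ : BicovariantCalculus (RatFunc k) (Uq k)} {J : Finset ℕ}
  (hJ : Γ.ideal = annihilator (qPairing k) (tangentQ k J))

lemma isFiniteDimensional_of_ideal_eq (hJ : Γ.ideal = annihilator (qPairing k) (tangentQ k J)) :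
    Γ.IsFiniteDimensional ∧ Γ.dim = Module.finrank (RatFunc k) (tangentQ k J) :=
  BicovariantCalculus.finrank_rightInvariant qPairing_injective
    isMonomialPairing_qPairing.one_right (QBorel.tangent_le J) hJ

lemma tangentSpace_eq_of_ideal_eq (hJ : Γ.ideal = annihilator (qPairing k) (tangentQ k J)) :
    Γ.tangentSpace (qPairing k) = tangentQ k J :=
  BicovariantCalculus.tangentSpace_eq qPairing_injective
    isMonomialPairing_qPairing.one_right (QBorel.tangent_le J) hJ

lemma annihilator_le_iff {J J' : Finset ℕ} (h0 : 0 ∉ J) (h0' : 0 ∉ J') :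
    annihilator (qPairing k) (tangentQ k J') ≤ annihilator (qPairing k) (tangentQ k J) ↔ J ⊆ J' := by
  refine ⟨fun h => ?_, QBorel.annihilator_tangent_anti isMonomialPairing_qPairing.one_left⟩
  obtain ⟨Γ, hΓ⟩ := exists_calculus_tangentQ (k := k) J'
  have h1 : Γ.ideal = annihilator (qPairing k) (tangentQ k (J ∪ J')) := by
    rw [QBorel.annihilator_tangent_union isMonomialPairing_qPairing.one_left, hΓ,
      inf_eq_right.2 h]
  have h2 : J' = J ∪ J' := QBorel.annihilator_tangent_injective qPairing_injective
    isMonomialPairing_qPairing.one_right h0' (by simp [h0, h0']) hΓ h1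
  rw [h2]
  exact Finset.subset_union_left

lemma annihilator_tangentQ_empty :
    annihilator (qPairing k) (tangentQ k ∅) =
      LinearMap.ker (counit (R := RatFunc k) (A := Uq k)) := by
  ext a
  rw [QBorel.mem_annihilator_tangent isMonomialPairing_qPairing.one_left]
  have h : indexSet ∅ = {(0, 0)} := by
    ext ⟨n, m⟩
    simp [mem_indexSet]
  simp [h, QBorel.monomial_zero, isMonomialPairing_qPairing.one_left]

/-- The coirreducible calculi are those of the one-element sets. -/
lemma isCoirreducible_iff_card (h0 : 0 ∉ J)
    (hJ : Γ.ideal = annihilator (qPairing k) (tangentQ k J)) :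
    Γ.IsCoirreducible ↔ ∃ j, J = {j} := by
  rw [BicovariantCalculus.isCoirreducible_iff, hJ, ← annihilator_tangentQ_empty]
  constructor
  · rintro ⟨hne, h⟩
    have hJ0 : J.Nonempty := by
      rw [Finset.nonempty_iff_ne_empty]
      rintro rfl
      exact hne rfl
    obtain ⟨j, hj⟩ := hJ0
    have hj0 : 0 ∉ ({j} : Finset ℕ) := by
      rw [Finset.mem_singleton]
      rintro rfl
      exact h0 hj
    refine ⟨j, ?_⟩
    obtain ⟨Γ', hΓ'⟩ := exists_calculus_tangentQ (k := k) {j}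
    rcases h Γ' (by
      rw [hΓ', annihilator_le_iff hj0 h0]
      exact Finset.singleton_subset_iff.2 hj) with h1 | h1
    · rw [hΓ'] at h1
      have h2 := (annihilator_le_iff hj0 (Finset.notMem_empty 0)).1 h1.ge
      simp at h2
    · rw [hΓ'] at h1
      refine Finset.Subset.antisymm ?_ (Finset.singleton_subset_iff.2 hj)
      exact (annihilator_le_iff h0 hj0).1 h1.ge
  · rintro ⟨j, rfl⟩
    refine ⟨fun h => ?_, fun Γ' hle => ?_⟩
    · have := (annihilator_le_iff h0 (Finset.notMem_empty 0)).1 h.ge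
      simp at this
    · rw [← hJ] at hle
      obtain ⟨J', h0', hJ'⟩ := exists_ideal_eq (isFiniteDimensional_of_ideal_eq hJ).1 hle
      rw [hJ, hJ', annihilator_le_iff h0' h0] at hle
      rcases Finset.subset_singleton_iff.1 hle with h1 | h1
      · exact Or.inl (by rw [hJ', h1])
      · exact Or.inr (by rw [hJ', h1])

end

/-- The irreducible quantum tangent spaces are those of the one-element sets. -/
lemma isIrreducibleTangentSpace_iff {J : Finset ℕ} (h0 : 0 ∉ J) :
    IsIrreducibleTangentSpace (qPairing k) (tangentQ k J) ↔ ∃ j, J = {j} := by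
  have hbot : tangentQ k ∅ = ⊥ := by
    have h1 : Module.finrank (RatFunc k) (tangentQ k ∅) + 1 = _ :=
      QBorel.finrank_tangent (K := RatFunc k) (q := qUnit k) ∅
    have h : indexSet ∅ = {(0, 0)} := by
      ext ⟨n, m⟩
      simp [mem_indexSet]
    rw [h, Finset.card_singleton] at h1
    exact Submodule.finrank_eq_zero.1 (by omega)
  constructor
  · rintro ⟨-, hne, h⟩
    have hJ0 : J.Nonempty := by
      rw [Finset.nonempty_iff_ne_empty]
      rintro rfl
      exact hne hbot
    obtain ⟨j, hj⟩ := hJ0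
    have hj0 : 0 ∉ ({j} : Finset ℕ) := by
      rw [Finset.mem_singleton]
      rintro rfl
      exact h0 hj
    refine ⟨j, ?_⟩
    rcases h (tangentQ k {j}) ((QBorel.tangent_le_iff hj0).2 (Finset.singleton_subset_iff.2 hj))
      (QBorel.isQuantumTangentSpace_tangent _ _) with h1 | h1
    · rw [← hbot] at h1
      have h2 := QBorel.tangent_injective hj0 (Finset.notMem_empty 0) h1
      simp at h2
    · exact (QBorel.tangent_injective hj0 h0 h1).symm
  · rintro ⟨j, rfl⟩
    refine ⟨QBorel.isQuantumTangentSpace_tangent _ _, fun h => ?_, fun L' hle hL' => ?_⟩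
    · rw [← hbot] at h
      have h2 := QBorel.tangent_injective h0 (Finset.notMem_empty 0) h
      simp at h2
    · have hfd : FiniteDimensional (RatFunc k) L' := Submodule.finiteDimensional_of_le hle
      obtain ⟨J', h0', rfl⟩ := QBorel.exists_eq_tangent qUnit_zpow_eq_one
        isMonomialPairing_qPairing hL' hfd
      rw [QBorel.tangent_le_iff h0'] at hle
      rcases Finset.subset_singleton_iff.1 hle with h1 | h1
      · exact Or.inl (by rw [h1]; exact hbot)
      · exact Or.inr (by rw [h1])

end Uq

/-! ### The enveloping algebra and its pairing -/

open Coalgebra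

lemma contractLeft_primitive_mul {k A : Type u} [Field k] [Ring A] [HopfAlgebra k A] {c : A}
    (hc : comul (R := k) c = c ⊗ₜ 1 + 1 ⊗ₜ c) (f : A →ₗ[k] k) (a : A) :
    contractLeft f (c * a) = contractLeft (f ∘ₗ LinearMap.mulLeft k c) a + c * contractLeft f a := by
  simp only [contractLeft, LinearMap.comp_apply, Bialgebra.comul_mul, hc]
  generalize comul (R := k) a = t
  induction t with
  | zero => simp
  | add x y hx hy =>
    simp only [mul_add, map_add] at hx hy ⊢
    rw [hx, hy]
    abel
  | tmul x y => simp [add_mul]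

namespace UBorel

open Polynomial

variable {k : Type u} [Field k]

/-- The elements `X ^ n p(H)`. -/
def polyElem (n : ℕ) : k[X] →ₗ[k] UBorel k :=
  LinearMap.mulLeft k (X k ^ n) ∘ₗ (Polynomial.aeval (H k)).toLinearMap

lemma polyElem_apply (n : ℕ) (r : k[X]) :
    polyElem n r = X k ^ n * Polynomial.aeval (H k) r := rfl

lemma polyElem_X_pow (n m : ℕ) : polyElem n (Polynomial.X ^ m) = X k ^ n * H k ^ m := by
  rw [polyElem_apply, map_pow, aeval_X]

lemma polyElem_zero_one : polyElem 0 (1 : k[X]) = 1 := by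
  rw [polyElem_apply, map_one, pow_zero, one_mul]

lemma X_mul_polyElem (n : ℕ) (r : k[X]) : X k * polyElem n r = polyElem (n + 1) r := by
  rw [polyElem_apply, polyElem_apply, ← mul_assoc, pow_succ']

lemma H_mul_X_pow (n : ℕ) : H k * X k ^ n = X k ^ n * (H k + algebraMap k _ (n : k)) := by
  induction n with
  | zero => simp
  | succ n ih =>
    rw [pow_succ, ← mul_assoc, ih, mul_assoc, mul_assoc, add_mul, H_mul_X, Algebra.commutes]
    simp only [mul_add, mul_one, Nat.cast_succ, map_add, map_one]
    abel

lemma H_mul_polyElem (n : ℕ) (r : k[X]) :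
    H k * polyElem n r = polyElem n ((Polynomial.X + C (n : k)) * r) := by
  rw [polyElem_apply, polyElem_apply, ← mul_assoc, H_mul_X_pow, map_mul, map_add, aeval_X, aeval_C,
    mul_assoc]

lemma mem_of_generators {M : Submodule k (UBorel k)} (hX : ∀ m ∈ M, X k * m ∈ M)
    (hH : ∀ m ∈ M, H k * m ∈ M) (a : UBorel k) : ∀ m ∈ M, a * m ∈ M := by
  have ha : a ∈ Algebra.adjoin k ({X k, H k} : Set (UBorel k)) := by
    rw [adjoin_eq_top]
    exact Algebra.mem_top
  induction ha using Algebra.adjoin_induction with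
  | mem x hx =>
    rcases hx with rfl | rfl
    · exact hX
    · exact hH
  | algebraMap r =>
    intro m hm
    rw [← Algebra.smul_def]
    exact M.smul_mem _ hm
  | add x y _ _ hx hy =>
    intro m hm
    rw [add_mul]
    exact M.add_mem (hx m hm) (hy m hm)
  | mul x y _ _ hx hy =>
    intro m hm
    rw [mul_assoc]
    exact hx _ (hy m hm)

lemma span_polyElem :
    Submodule.span k (Set.range fun p : ℕ × k[X] => polyElem p.1 p.2) = ⊤ := by
  rw [eq_top_iff]
  intro a _
  have h1 : (1 : UBorel k) ∈ Submodule.span k (Set.range fun p : ℕ × k[X] => polyElem p.1 p.2) :=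
    Submodule.subset_span ⟨(0, 1), polyElem_zero_one⟩
  rw [← mul_one a]
  refine mem_of_generators (fun m hm => ?_) (fun m hm => ?_) a 1 h1
  · induction hm using Submodule.span_induction with
    | zero => simp
    | add x y _ _ hx hy =>
      rw [mul_add]
      exact Submodule.add_mem _ hx hy
    | smul c x _ hx =>
      rw [mul_smul_comm]
      exact Submodule.smul_mem _ _ hx
    | mem x hx =>
      obtain ⟨p, rfl⟩ := hx
      exact Submodule.subset_span ⟨(p.1 + 1, p.2), (X_mul_polyElem _ _).symm⟩
  · induction hm using Submodule.span_induction with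
    | zero => simp
    | add x y _ _ hx hy =>
      rw [mul_add]
      exact Submodule.add_mem _ hx hy
    | smul c x _ hx =>
      rw [mul_smul_comm]
      exact Submodule.smul_mem _ _ hx
    | mem x hx =>
      obtain ⟨p, rfl⟩ := hx
      exact Submodule.subset_span ⟨(p.1, _), (H_mul_polyElem _ _).symm⟩

lemma lhom_ext {M : Type*} [AddCommGroup M] [Module k M] {f f' : UBorel k →ₗ[k] M}
    (h : ∀ n r, f (polyElem n r) = f' (polyElem n r)) : f = f' :=
  LinearMap.ext_on_range span_polyElem fun p => h p.1 p.2

lemma counit_polyElem (n : ℕ) (r : k[X]) :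
    counit (R := k) (polyElem n r) = if n = 0 then r.eval 0 else 0 := by
  rw [polyElem_apply, Bialgebra.counit_mul, Bialgebra.counit_pow, counit_X]
  have : counit (R := k) (aeval (H k) r) = r.eval 0 := by
    have h := Polynomial.aeval_algHom_apply (Bialgebra.counitAlgHom k (UBorel k)) (H k) r
    rw [Bialgebra.counitAlgHom_apply, Bialgebra.counitAlgHom_apply, counit_H] at h
    rw [← h, Polynomial.coe_aeval_eq_eval]
  rw [this]
  rcases eq_or_ne n 0 with rfl | h
  · simp
  · simp [h]

/-- The coproduct is cocommutative, so that the adjoint coaction is trivial. -/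
lemma adCoaction_eq (a : UBorel k) : adCoaction k (UBorel k) a = 1 ⊗ₜ a := by
  have hp : ∀ c : UBorel k, comul (R := k) c = c ⊗ₜ 1 + 1 ⊗ₜ c →
      HopfAlgebra.antipode k c = -c → adCoaction k (UBorel k) c = 1 ⊗ₜ c := by
    intro c h1 h2
    rw [adCoaction, conv_apply, h1]
    simp only [map_add, TensorProduct.map_tmul, LinearMap.mul'_apply]
    simp [h1, h2]
    rw [← Algebra.TensorProduct.one_def, mul_one, TensorProduct.neg_tmul]
    abel
  have ha : a ∈ Algebra.adjoin k ({X k, H k} : Set (UBorel k)) := by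
    rw [adjoin_eq_top]
    exact Algebra.mem_top
  induction ha using Algebra.adjoin_induction with
  | mem x hx =>
    rcases hx with rfl | rfl
    · exact hp _ (comul_X k) (antiLinear_antipodeHom_X k)
    · exact hp _ (comul_H k) (antiLinear_antipodeHom_H k)
  | algebraMap r =>
    rw [Algebra.algebraMap_eq_smul_one, map_smul, adCoaction_one, TensorProduct.tmul_smul]
  | add x y _ _ hx hy => rw [map_add, hx, hy, TensorProduct.tmul_add]
  | mul x y _ _ hx hy =>
    rw [adCoaction_mul_right x hy, hx, Algebra.TensorProduct.tmul_mul_tmul, mul_one]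

end UBorel

section Pairing

open Polynomial

variable {k : Type u} [Field k]

lemma pairing_polyElem (p : ℕ × ℤ) (n : ℕ) (r : k[X]) :
    pairing k (QBorel.monomial k 1 p) (UBorel.polyElem n r) =
      if p.1 = n then (n.factorial : k) * r.eval (p.2 : k) else 0 := by
  induction r using Polynomial.induction_on' with
  | add x y hx hy =>
    rw [map_add, map_add, hx, hy, eval_add]
    split_ifs
    · ring
    · simp
  | monomial m a =>
    rw [← C_mul_X_pow_eq_monomial, ← smul_eq_C_mul, map_smul, UBorel.polyElem_X_pow, map_smul,
      pairing_monomial]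
    split_ifs with h
    · rw [h, eval_smul, eval_pow, eval_X, smul_eq_mul, smul_eq_mul]
      ring
    · simp

lemma pairing_one_left (a : UBorel k) : pairing k 1 a = counit (R := k) a := by
  have : pairing k 1 = counit (R := k) := UBorel.lhom_ext fun n r => by
    rw [← QBorel.monomial_zero, pairing_polyElem, UBorel.counit_polyElem]
    rcases eq_or_ne n 0 with rfl | h
    · simp
    · rw [if_neg h, if_neg (Ne.symm h)]
  rw [this]

lemma pairing_one_right (x : CB k) : pairing k x 1 = counit (R := k) x := by
  have : (pairing k).flip 1 = counit (R := k) := QBorel.lhom_ext fun p => by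
    rw [← UBorel.polyElem_zero_one, LinearMap.flip_apply, pairing_polyElem, QBorel.counit_monomial]
    simp
  rw [← LinearMap.flip_apply, this]

lemma pairing_injective [CharZero k] : Function.Injective (pairing k) :=
  QBorel.injective_of_apply_eq (fun n s => UBorel.X k ^ n * UBorel.H k ^ s)
    (c := fun n => (n.factorial : k)) (fun n => Nat.cast_ne_zero.2 n.factorial_ne_zero)
    (lam := fun m => (m : k)) Int.cast_injective fun p n s => by
      rw [pairing_monomial]
      split_ifs with h
      · rw [h]
      · rfl

lemma pairing_H_mul (n : ℕ) (m : ℤ) (a : UBorel k) :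
    pairing k (QBorel.monomial k 1 (n, m)) (UBorel.H k * a) =
      (m + n : k) * pairing k (QBorel.monomial k 1 (n, m)) a := by
  have : pairing k (QBorel.monomial k 1 (n, m)) ∘ₗ LinearMap.mulLeft k (UBorel.H k) =
      (m + n : k) • pairing k (QBorel.monomial k 1 (n, m)) := by
    refine UBorel.lhom_ext fun n' r => ?_
    rw [LinearMap.comp_apply, LinearMap.mulLeft_apply, UBorel.H_mul_polyElem,
      LinearMap.smul_apply, pairing_polyElem, pairing_polyElem, smul_eq_mul]
    simp only
    split_ifs with h
    · rw [h]
      simp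
      ring
    · simp
  exact LinearMap.congr_fun this a

lemma pairing_X_mul (n : ℕ) (m : ℤ) (a : UBorel k) :
    pairing k (QBorel.monomial k 1 (n + 1, m)) (UBorel.X k * a) =
      (n + 1 : k) * pairing k (QBorel.monomial k 1 (n, m)) a := by
  have : pairing k (QBorel.monomial k 1 (n + 1, m)) ∘ₗ LinearMap.mulLeft k (UBorel.X k) =
      (n + 1 : k) • pairing k (QBorel.monomial k 1 (n, m)) := by
    refine UBorel.lhom_ext fun n' r => ?_
    rw [LinearMap.comp_apply, LinearMap.mulLeft_apply, UBorel.X_mul_polyElem,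
      LinearMap.smul_apply, pairing_polyElem, pairing_polyElem, smul_eq_mul]
    simp only [add_left_inj]
    split_ifs with h
    · rw [h, Nat.factorial_succ, Nat.cast_mul, Nat.cast_succ, mul_assoc]
    · simp
  exact LinearMap.congr_fun this a

lemma pairing_X_mul_zero (m : ℤ) (a : UBorel k) :
    pairing k (QBorel.monomial k 1 (0, m)) (UBorel.X k * a) = 0 := by
  have : pairing k (QBorel.monomial k 1 (0, m)) ∘ₗ LinearMap.mulLeft k (UBorel.X k) = 0 := by
    refine UBorel.lhom_ext fun n' r => ?_
    rw [LinearMap.comp_apply, LinearMap.mulLeft_apply, UBorel.X_mul_polyElem, pairing_polyElem]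
    simp
  exact LinearMap.congr_fun this a

/-- The quantum tangent space in `C(B₊)` that belongs to a finite set of positive integers. -/
abbrev tangentC (k : Type u) [Field k] (J : Finset ℕ) : Submodule k (CB k) := QBorel.tangent k 1 J

/-- Cocommutativity makes every left ideal in `ker ε` a crossed submodule. -/
lemma exists_calculus_tangentC (J : Finset ℕ) :
    ∃ Γ : BicovariantCalculus k (UBorel k), Γ.ideal = annihilator (pairing k) (tangentC k J) := by
  refine exists_calculus _ inf_le_left (fun a => UBorel.mem_of_generators ?_ ?_ a) ?_
  · intro m hm
    rw [QBorel.mem_annihilator_tangent pairing_one_left] at hm ⊢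
    rintro ⟨n, z⟩ hp
    obtain ⟨j, hj, h1, rfl⟩ := mem_indexSet.1 hp
    cases n with
    | zero => exact pairing_X_mul_zero _ _
    | succ n =>
      rw [pairing_X_mul, hm _ (mk_neg_mem_indexSet.2 ⟨hj, by simp only at h1; omega⟩), mul_zero]
  · intro m hm
    rw [QBorel.mem_annihilator_tangent pairing_one_left] at hm ⊢
    rintro ⟨n, z⟩ hp
    rw [pairing_H_mul, hm _ hp, mul_zero]
  · intro m hm
    rw [UBorel.adCoaction_eq]
    exact ⟨1 ⊗ₜ ⟨m, hm⟩, by simp⟩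

/-! ### Braided derivations -/

lemma contractLeft_pairing_H_pow_mul_X_pow (i : ℕ) (s : ℤ) (a b : ℕ) :
    contractLeft (pairing k (QBorel.monomial k 1 (i, s))) (UBorel.H k ^ a * UBorel.X k ^ b) =
      (b.descFactorial i : k) •
        ((UBorel.H k + algebraMap k _ (s + i : k)) ^ a * UBorel.X k ^ (b - i)) := by
  have hH : ∀ y, contractLeft (pairing k (QBorel.monomial k 1 (i, s))) (UBorel.H k * y) =
      (UBorel.H k + algebraMap k _ (s + i : k)) *
        contractLeft (pairing k (QBorel.monomial k 1 (i, s))) y := by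
    intro y
    rw [contractLeft_primitive_mul (UBorel.comul_H k)]
    have h1 : pairing k (QBorel.monomial k 1 (i, s)) ∘ₗ LinearMap.mulLeft k (UBorel.H k) =
        (s + i : k) • pairing k (QBorel.monomial k 1 (i, s)) :=
      LinearMap.ext fun a => pairing_H_mul i s a
    rw [h1, add_mul, ← Algebra.smul_def, add_comm]
    congr 1
    simp [contractLeft, LinearMap.rTensor_smul]
  induction a with
  | succ a ih => rw [pow_succ', mul_assoc, hH, ih, mul_smul_comm, ← mul_assoc, ← pow_succ']
  | zero =>
    rw [pow_zero, pow_zero, one_mul, one_mul]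
    clear hH
    induction b generalizing i with
    | zero =>
      have : contractLeft (pairing k (QBorel.monomial k 1 (i, s))) 1 =
          pairing k (QBorel.monomial k 1 (i, s)) 1 • (1 : UBorel k) := by
        simp [contractLeft, Algebra.TensorProduct.one_def]
      rw [pow_zero, this, ← UBorel.polyElem_zero_one, pairing_polyElem]
      cases i <;> simp [UBorel.polyElem_zero_one]
    | succ b ih =>
      rw [pow_succ', contractLeft_primitive_mul (UBorel.comul_X k), ih i]
      cases i with
      | zero =>
        have h1 : pairing k (QBorel.monomial k 1 (0, s)) ∘ₗ LinearMap.mulLeft k (UBorel.X k) = 0 :=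
          LinearMap.ext fun a => pairing_X_mul_zero s a
        rw [h1]
        simp [contractLeft, pow_succ']
      | succ i =>
        have h1 : pairing k (QBorel.monomial k 1 (i + 1, s)) ∘ₗ LinearMap.mulLeft k (UBorel.X k) =
            (i + 1 : k) • pairing k (QBorel.monomial k 1 (i, s)) :=
          LinearMap.ext fun a => pairing_X_mul i s a
        have h2 : contractLeft ((i + 1 : k) • pairing k (QBorel.monomial k 1 (i, s)))
            (UBorel.X k ^ b) = (i + 1 : k) •
              contractLeft (pairing k (QBorel.monomial k 1 (i, s))) (UBorel.X k ^ b) := by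
          simp [contractLeft, LinearMap.rTensor_smul]
        rw [h1, h2, ih i, Nat.succ_sub_succ, smul_smul, mul_smul_comm, ← pow_succ']
        rcases le_or_gt (i + 1) b with hb | hb
        · rw [show b - (i + 1) + 1 = b - i by omega, ← add_smul, Nat.succ_descFactorial_succ,
            Nat.descFactorial_succ]
          congr 1
          obtain ⟨c, rfl⟩ := Nat.exists_eq_add_of_le hb
          rw [show i + 1 + c - i = c + 1 by omega]
          push_cast
          ring
        · rw [Nat.descFactorial_of_lt hb, Nat.cast_zero, zero_smul, add_zero]
          rcases Nat.lt_or_ge b i with hbi | hbi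
          · rw [Nat.descFactorial_of_lt hbi, Nat.descFactorial_of_lt (by omega)]
            simp
          · obtain rfl : b = i := by omega
            rw [Nat.succ_descFactorial_succ]
            push_cast
            rfl

lemma normalOrder_X_pow_mul_aeval (b : ℕ) (r : k[X]) :
    normalOrder (MvPolynomial.X 0 ^ b * aeval (MvPolynomial.X 1) r) =
      aeval (UBorel.H k) r * UBorel.X k ^ b := by
  induction r using Polynomial.induction_on' with
  | add x y hx hy => rw [map_add, mul_add, map_add, hx, hy, map_add, add_mul]
  | monomial m a =>
    rw [← C_mul_X_pow_eq_monomial, ← smul_eq_C_mul, map_smul, map_smul, mul_smul_comm, map_smul,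
      map_pow, map_pow, aeval_X, aeval_X, smul_mul_assoc]
    congr 1
    have h : (MvPolynomial.X 0 ^ b * MvPolynomial.X 1 ^ m : MvPolynomial (Fin 2) k) =
        MvPolynomial.basisMonomials (Fin 2) k (Finsupp.single 0 b + Finsupp.single 1 m) := by
      rw [MvPolynomial.coe_basisMonomials, MvPolynomial.X_pow_eq_monomial,
        MvPolynomial.X_pow_eq_monomial, MvPolynomial.monomial_mul, one_mul]
    rw [h, normalOrder, Module.Basis.constr_basis]
    simp

lemma iterate_pderiv_X_pow_mul_aeval (i b : ℕ) (r : k[X]) :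
    (MvPolynomial.pderiv 0)^[i]
      (MvPolynomial.X 0 ^ b * aeval (MvPolynomial.X 1) r : MvPolynomial (Fin 2) k) =
      (b.descFactorial i : k) • (MvPolynomial.X 0 ^ (b - i) * aeval (MvPolynomial.X 1) r) := by
  induction i with
  | zero => simp
  | succ i ih =>
    have h0 : MvPolynomial.pderiv (0 : Fin 2) (aeval (MvPolynomial.X 1 : MvPolynomial (Fin 2) k) r)
        = 0 := by
      rw [Derivation.map_aeval]
      simp [MvPolynomial.pderiv_X]
    rw [Function.iterate_succ_apply', ih, Derivation.map_smul, Derivation.leibniz, h0, smul_zero, zero_add,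
      Derivation.leibniz_pow, MvPolynomial.pderiv_X_self, Nat.descFactorial_succ]
    rw [Nat.sub_sub]
    simp [smul_eq_mul, MvPolynomial.smul_eq_C_mul, mul_comm, mul_left_comm, mul_assoc]

lemma span_X_pow_mul_aeval : Submodule.span k
    (Set.range fun p : ℕ × ℕ => (MvPolynomial.X 0 ^ p.1 * aeval (MvPolynomial.X 1)
      (Polynomial.X ^ p.2 : k[X]) : MvPolynomial (Fin 2) k)) = ⊤ := by
  rw [eq_top_iff, ← (MvPolynomial.basisMonomials (Fin 2) k).span_eq, Submodule.span_le]
  rintro _ ⟨s, rfl⟩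
  refine Submodule.subset_span ⟨(s 0, s 1), ?_⟩
  simp only [MvPolynomial.coe_basisMonomials]
  rw [map_pow, aeval_X, MvPolynomial.X_pow_eq_monomial,
        MvPolynomial.X_pow_eq_monomial, MvPolynomial.monomial_mul, one_mul]
  refine congrArg (fun t => MvPolynomial.monomial t (1 : k)) ?_
  ext i
  fin_cases i <;> simp

/-- The braided derivation along `X ^ i g ^ s` is `(∂/∂X) ^ i` followed by a shift
of `H`. -/
lemma contractLeft_pairing_normalOrder (i : ℕ) (s : ℤ) (f : MvPolynomial (Fin 2) k) :
    contractLeft (pairing k (QBorel.monomial k 1 (i, s))) (normalOrder f) =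
      normalOrder (shiftH (s + i : k) ((MvPolynomial.pderiv 0)^[i] f)) := by
  have hpow : (MvPolynomial.pderiv (0 : Fin 2) : Derivation k (MvPolynomial (Fin 2) k) _)^[i] f =
      (((MvPolynomial.pderiv (0 : Fin 2) : Derivation k (MvPolynomial (Fin 2) k) _) :
        Module.End k (MvPolynomial (Fin 2) k)) ^ i) f := by
    rw [Module.End.pow_apply]
    rfl
  have : contractLeft (pairing k (QBorel.monomial k 1 (i, s))) ∘ₗ normalOrder =
      normalOrder ∘ₗ (shiftH (s + i : k)).toLinearMap ∘ₗ
      (((MvPolynomial.pderiv (0 : Fin 2) : Derivation k (MvPolynomial (Fin 2) k) _) :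
        Module.End k (MvPolynomial (Fin 2) k)) ^ i) := by
    refine LinearMap.ext_on_range span_X_pow_mul_aeval fun p => ?_
    rw [LinearMap.comp_apply, LinearMap.comp_apply, LinearMap.comp_apply, Module.End.pow_apply,
      normalOrder_X_pow_mul_aeval, map_pow, aeval_X, contractLeft_pairing_H_pow_mul_X_pow]
    have h1 := iterate_pderiv_X_pow_mul_aeval i p.1 (Polynomial.X ^ p.2 : k[X])
    have h2 : shiftH (s + i : k) (MvPolynomial.X 0 ^ (p.1 - i) * aeval (MvPolynomial.X 1)
        (Polynomial.X ^ p.2 : k[X])) = MvPolynomial.X 0 ^ (p.1 - i) * aeval (MvPolynomial.X 1)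
          ((Polynomial.X + C (s + i : k)) ^ p.2 : k[X]) := by
      simp only [map_mul, map_pow, aeval_X, map_add, aeval_C, shiftH, MvPolynomial.aeval_X]
      simp [MvPolynomial.algebraMap_eq]
    refine Eq.trans ?_ (congrArg (fun z => normalOrder (shiftH (s + i : k) z)) h1.symm)
    simp only [map_smul]
    rw [h2, normalOrder_X_pow_mul_aeval]
    simp
  rw [hpow]
  exact LinearMap.congr_fun this f

end Pairing

/-! ### The limit of a quantum tangent space -/

open Coalgebra

section LimitC

variable {k : Type u} [Field k]

lemma ofCoeffs_eq (c : ℕ × ℤ →₀ RatFunc k) :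
    ofCoeffs c = Finsupp.linearCombination (RatFunc k) (QBorel.monomial (RatFunc k) (qUnit k)) c := rfl

lemma coord_ofCoeffs (c : ℕ × ℤ →₀ RatFunc k) :
    QBorel.coord (RatFunc k) (qUnit k) (ofCoeffs c) = c :=
  QBorel.coord_linearCombination c

lemma ofCoeffs_coord (x : Uq k) : ofCoeffs (QBorel.coord (RatFunc k) (qUnit k) x) = x :=
  QBorel.linearCombination_coord x

lemma QBorel.mem_tangent {K : Type u} [Field K] {q : Kˣ} {J : Finset ℕ} {x : QBorel K q} :
    x ∈ tangent K q J ↔ (coord K q x).support ⊆ indexSet J ∧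
      ∑ p ∈ (coord K q x).support with p.1 = 0, coord K q x p = 0 := by
  have h : counit (R := K) x = ∑ p ∈ (coord K q x).support with p.1 = 0, coord K q x p := by
    conv_lhs => rw [← linearCombination_coord x, Finsupp.linearCombination_apply, Finsupp.sum,
      map_sum]
    rw [Finset.sum_filter]
    refine Finset.sum_congr rfl fun p _ => ?_
    rw [map_smul, counit_monomial]
    split_ifs <;> simp
  rw [← h, and_comm]
  change counit (R := K) x = 0 ∧ coord K q x ∈ Finsupp.supported K K _ ↔ _
  rw [Finsupp.mem_supported]
  simp

/-- Evaluation at `1` is additive on rational functions without a pole there. -/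
lemma eval_one_sum {ι : Type*} (s : Finset ι) (f : ι → RatFunc k)
    (hf : ∀ i ∈ s, (f i).denom.eval 1 ≠ 0) :
    (∑ i ∈ s, f i).denom.eval 1 ≠ 0 ∧ RatFunc.eval (RingHom.id k) 1 (∑ i ∈ s, f i) =
      ∑ i ∈ s, RatFunc.eval (RingHom.id k) 1 (f i) := by
  classical
  induction s using Finset.induction_on with
  | empty => simp
  | insert i s hi ih =>
    obtain ⟨h1, h2⟩ := ih fun j hj => hf j (Finset.mem_insert_of_mem hj)
    have h3 := hf i (Finset.mem_insert_self i s)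
    rw [Finset.sum_insert hi, Finset.sum_insert hi, ← h2]
    refine ⟨fun h => ?_, RatFunc.eval_add _ _ h3 h1⟩
    obtain ⟨w, hw⟩ := RatFunc.denom_add_dvd (f i) (∑ j ∈ s, f j)
    have h4 := congrArg (Polynomial.eval 1) hw
    rw [Polynomial.eval_mul, Polynomial.eval_mul, h, zero_mul] at h4
    exact mul_ne_zero h3 h1 h4

/-- The limit `q → 1` of a monomial quantum tangent space. Membership is expressed by the support of
the coordinates and the vanishing of one sum of coordinates, conditions with coefficients in `k`. -/
theorem limitC_tangentQ (J : Finset ℕ) : limitC (tangentQ k J) = (tangentC k J : Set (CB k)) := by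
  have key : ∀ c : ℕ × ℤ →₀ RatFunc k, (∀ p, (c p).denom.eval 1 ≠ 0) →
      (c.sum fun p f => RatFunc.eval (RingHom.id k) 1 f • QBorel.monomial k 1 p) =
        Finsupp.linearCombination k (QBorel.monomial k 1)
          (c.mapRange (RatFunc.eval (RingHom.id k) 1) (RatFunc.eval_zero _ _)) := by
    intro c _
    rw [Finsupp.linearCombination_apply, Finsupp.sum_mapRange_index (by simp)]
  have hmem : ∀ c : ℕ × ℤ →₀ RatFunc k, ofCoeffs c ∈ tangentQ k J ↔ c.support ⊆ indexSet J ∧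
      ∑ p ∈ c.support with p.1 = 0, c p = 0 := by
    intro c
    rw [QBorel.mem_tangent, coord_ofCoeffs]
  ext y
  constructor
  · rintro ⟨c, hc, hreg, rfl⟩
    rw [hmem] at hc
    rw [key c hreg, SetLike.mem_coe, QBorel.mem_tangent, QBorel.coord_linearCombination]
    refine ⟨Finsupp.support_mapRange.trans hc.1, ?_⟩
    have h1 := (eval_one_sum (c.support.filter fun p => p.1 = 0) c fun p _ => hreg p).2
    rw [hc.2, RatFunc.eval_zero] at h1
    rw [h1]
    refine Finset.sum_subset (Finset.filter_subset_filter _ Finsupp.support_mapRange) ?_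
    intro p hp hp'
    rw [Finset.mem_filter] at hp hp'
    by_contra h
    exact hp' ⟨Finsupp.mem_support_iff.2 h, hp.2⟩
  · intro hy
    rw [SetLike.mem_coe, QBorel.mem_tangent] at hy
    set c : ℕ × ℤ →₀ RatFunc k :=
      (QBorel.coord k 1 y).mapRange (RatFunc.C : k →+* RatFunc k) (map_zero _) with hc
    have hsupp : c.support = (QBorel.coord k 1 y).support :=
      Finsupp.support_mapRange_of_injective _ _ (RatFunc.C : k →+* RatFunc k).injective
    refine ⟨c, ?_, ?_, ?_⟩
    · rw [hmem, hsupp]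
      refine ⟨hy.1, ?_⟩
      simp only [hc, Finsupp.mapRange_apply]
      rw [← map_sum, hy.2, map_zero]
    · intro p
      rw [hc, Finsupp.mapRange_apply, RatFunc.denom_C]
      simp
    · rw [hc, Finsupp.sum_mapRange_index (by simp)]
      simp only [RatFunc.eval_C, RingHom.id_apply]
      exact QBorel.linearCombination_coord y

end LimitC

/-! ### Exponential series and the substitution `q = e ^ (-t)` -/

open Coalgebra

section Series

/-- The Laurent series `e ^ (a t)`. -/
def expLaurent {A : Type*} [CommRing A] [Algebra ℚ A] (a : A) : LaurentSeries A :=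
  HahnSeries.ofPowerSeries ℤ A (PowerSeries.rescale a (PowerSeries.exp A))

lemma expLaurent_add {A : Type*} [CommRing A] [Algebra ℚ A] (a b : A) :
    expLaurent (a + b) = expLaurent a * expLaurent b := by
  rw [expLaurent, ← PowerSeries.exp_mul_exp_eq_exp_add, map_mul]
  rfl

lemma expLaurent_zero {A : Type*} [CommRing A] [Algebra ℚ A] : expLaurent (0 : A) = 1 := by
  rw [expLaurent, PowerSeries.rescale_zero]
  simp

lemma expLaurent_nsmul {A : Type*} [CommRing A] [Algebra ℚ A] (a : A) (n : ℕ) :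
    expLaurent (n * a) = expLaurent a ^ n := by
  induction n with
  | zero => simp [expLaurent_zero]
  | succ n ih => rw [Nat.cast_succ, add_mul, one_mul, expLaurent_add, ih, pow_succ]

lemma coeff_expLaurent {A : Type*} [CommRing A] [Algebra ℚ A] (a : A) (i : ℤ) :
    (expLaurent a).coeff i =
      if i < 0 then 0 else a ^ i.natAbs * algebraMap ℚ A (1 / i.natAbs.factorial) := by
  rw [expLaurent, PowerSeries.coeff_coe, PowerSeries.coeff_rescale, PowerSeries.coeff_exp]

/-- Linear maps applied coefficientwise commute with multiplication by scalar series. -/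
lemma map_mul_of_linear {k R S : Type*} [Field k] [Ring R] [Algebra k R] [Ring S] [Algebra k S]
    (f : R →ₗ[k] S) (h : LaurentSeries k) (z : HahnSeries ℤ R) :
    (h.map (algebraMap k R) * z).map f = h.map (algebraMap k S) * z.map f := by
  ext i
  rw [HahnSeries.map_coeff, HahnSeries.coeff_mul_left' h.isPWO_support (fun j hj hj' => hj (by
      rw [HahnSeries.map_coeff, hj', map_zero])),
    HahnSeries.coeff_mul_left' h.isPWO_support (fun j hj hj' => hj (by
      rw [HahnSeries.map_coeff, hj', map_zero])), map_sum]
  have hterm : ∀ a b : ℤ, f ((h.map (algebraMap k R)).coeff a * z.coeff b) =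
      (h.map (algebraMap k S)).coeff a * (z.map f).coeff b := by
    intro a b
    simp only [HahnSeries.map_coeff]
    rw [← Algebra.smul_def, map_smul, Algebra.smul_def]
  simp only [hterm]
  refine (Finset.sum_subset (fun ij hij => ?_) fun ij hij hij' => ?_).symm
  · rw [Finset.mem_antidiagonal] at hij ⊢
    exact ⟨hij.1, fun h0 => hij.2.1 (by rw [HahnSeries.map_coeff, h0, map_zero]), hij.2.2⟩
  · rw [Finset.mem_antidiagonal] at hij hij'
    by_contra h0
    exact hij' ⟨hij.1, fun h1 => h0 (by rw [h1, mul_zero]), hij.2.2⟩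

end Series

section Eval

variable {k : Type u} [Field k]

lemma algebraMap_laurentSeries (a : k) :
    algebraMap k (LaurentSeries k) a = HahnSeries.C a := by
  rw [HahnSeries.algebraMap_apply', PowerSeries.algebraMap_apply, HahnSeries.ofPowerSeries_C]
  rfl

variable [CharZero k]

lemma expNegT_eq : expNegT k = expLaurent (-1 : k) := by
  rw [expNegT, expLaurent]
  congr 1
  ext n
  rw [PowerSeries.coeff_mk, PowerSeries.coeff_rescale, PowerSeries.coeff_exp]
  simp

lemma eval₂_expNegT_ne_zero {p : Polynomial k} (hp : p ≠ 0) :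
    p.eval₂ (algebraMap k (LaurentSeries k)) (expNegT k) ≠ 0 := by
  intro h
  refine hp ?_
  have h1 : ∀ i : ℕ, ∑ j ∈ p.support, p.coeff j * (-(j : k)) ^ i = 0 := by
    intro i
    have h2 := congrArg (fun z => HahnSeries.coeff z (i : ℤ)) h
    rw [Polynomial.eval₂_eq_sum, Polynomial.sum] at h2
    have h3 : ∀ j, (algebraMap k (LaurentSeries k) (p.coeff j) * expNegT k ^ j).coeff (i : ℤ) =
        (p.coeff j * (-(j : k)) ^ i) * (algebraMap ℚ k (1 / i.factorial)) := by
      intro j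
      rw [expNegT_eq, ← expLaurent_nsmul, algebraMap_laurentSeries, HahnSeries.C_mul_eq_smul,
        HahnSeries.coeff_smul, coeff_expLaurent]
      simp [mul_assoc]
    simp only [HahnSeries.coeff_sum, h3, HahnSeries.coeff_zero] at h2
    rw [← Finset.sum_mul, mul_eq_zero] at h2
    exact h2.resolve_right (by simp [Nat.factorial_ne_zero])
  ext j
  by_contra hj
  exact hj (eq_zero_of_sum_mul_pow_eq_zero (a := p.coeff) (lam := fun j : ℕ => (-(j : k)))
    (fun a _ b _ hab => by simpa using hab) h1 j (Polynomial.mem_support_iff.2 hj))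

variable (k) in
/-- The substitution `q = e ^ (-t)` as a ring homomorphism. -/
def evalExp : RatFunc k →+* LaurentSeries k where
  toFun := RatFunc.eval (algebraMap k (LaurentSeries k)) (expNegT k)
  map_one' := RatFunc.eval_one _ _
  map_zero' := RatFunc.eval_zero _ _
  map_mul' x y := RatFunc.eval_mul _ _ (eval₂_expNegT_ne_zero x.denom_ne_zero)
    (eval₂_expNegT_ne_zero y.denom_ne_zero)
  map_add' x y := RatFunc.eval_add _ _ (eval₂_expNegT_ne_zero x.denom_ne_zero)
    (eval₂_expNegT_ne_zero y.denom_ne_zero)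

lemma evalExp_apply (f : RatFunc k) :
    evalExp k f = RatFunc.eval (algebraMap k (LaurentSeries k)) (expNegT k) f := rfl

lemma evalExp_C (a : k) : evalExp k (RatFunc.C a) = HahnSeries.C a := by
  rw [evalExp_apply, RatFunc.eval_C, algebraMap_laurentSeries]

lemma evalExp_X_zpow (m : ℤ) : evalExp k (RatFunc.X ^ m) = expLaurent (-m : k) := by
  have hpow : ∀ n : ℕ, evalExp k (RatFunc.X ^ n) = expLaurent (-n : k) := by
    intro n
    rw [map_pow, evalExp_apply, RatFunc.eval_X, expNegT_eq, ← expLaurent_nsmul, mul_neg, mul_one]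
  rcases Int.eq_nat_or_neg m with ⟨n, rfl | rfl⟩
  · rw [zpow_natCast, hpow, Int.cast_natCast]
  · rw [zpow_neg, zpow_natCast, map_inv₀, hpow]
    refine inv_eq_of_mul_eq_one_right ?_
    rw [← expLaurent_add, Int.cast_neg, Int.cast_natCast, add_neg_cancel, expLaurent_zero]

end Eval

/-! ### The limit of a crossed submodule -/

open Coalgebra

section Expand

open Polynomial

variable {k : Type u} [Field k]

lemma expand_zero : expand (0 : ℕ × ℤ →₀ RatFunc k) = 0 := Finsupp.sum_zero_index

variable [CharZero k]

lemma expand_add (c c' : ℕ × ℤ →₀ RatFunc k) : expand (c + c') = expand c + expand c' := by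
  refine Finsupp.sum_add_index' (fun p => ?_) fun p f f' => ?_
  · rw [RatFunc.eval_zero]
    have : (0 : LaurentSeries k).map (algebraMap k (UBorel k)) = 0 := by
      ext i
      simp
    rw [this, zero_mul, zero_mul]
  · have : RatFunc.eval (algebraMap k (LaurentSeries k)) (expNegT k) (f + f') =
        RatFunc.eval (algebraMap k (LaurentSeries k)) (expNegT k) f +
          RatFunc.eval (algebraMap k (LaurentSeries k)) (expNegT k) f' :=
      map_add (evalExp k) f f'
    rw [this]
    have h2 : ∀ x y : LaurentSeries k, (x + y).map (algebraMap k (UBorel k)) =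
        x.map (algebraMap k (UBorel k)) + y.map (algebraMap k (UBorel k)) := by
      intro x y
      ext i
      simp
    rw [h2, add_mul, add_mul]

lemma expand_sum {ι : Type*} (s : Finset ι) (c : ι → ℕ × ℤ →₀ RatFunc k) :
    expand (∑ i ∈ s, c i) = ∑ i ∈ s, expand (c i) :=
  map_sum (⟨⟨expand, expand_zero⟩, expand_add⟩ : (ℕ × ℤ →₀ RatFunc k) →+ HahnSeries ℤ (UBorel k))
    c s

lemma expand_single (n : ℕ) (m : ℤ) (f : RatFunc k) :
    expand (Finsupp.single (n, m) f) =
      ((evalExp k f).map (algebraMap k k[X]) * expLaurent ((m : k[X]) * Polynomial.X)).map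
        (UBorel.polyElem n) := by
  have h0 : (0 : LaurentSeries k).map (algebraMap k (UBorel k)) = 0 := by
    ext i
    simp
  rw [expand, Finsupp.sum_single_index (by rw [RatFunc.eval_zero, h0, zero_mul, zero_mul]),
    map_mul_of_linear, mul_assoc]
  congr 1
  ext i
  rw [HahnSeries.C_mul_eq_smul, HahnSeries.coeff_smul, HahnSeries.map_coeff, coeff_expLaurent, expTH,
    PowerSeries.coeff_coe, smul_eq_mul]
  split_ifs with h
  · simp
  · rw [PowerSeries.coeff_mk, UBorel.polyElem_apply]
    congr 1
    rw [map_mul, map_pow, map_mul, aeval_X, map_intCast,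
      show (algebraMap ℚ k[X] (1 / (i.natAbs.factorial : ℚ))) =
        C ((i.natAbs.factorial : k)⁻¹) by simp, aeval_C, ← Algebra.commutes, ← Algebra.smul_def,
      ← map_intCast (algebraMap k (UBorel k)), ← Algebra.smul_def, _root_.smul_pow, smul_smul, mul_comm]

/-- Pairing the expansion of an element coefficientwise with `X ^ n g ^ (-j)` is, up to a factor, the
expansion of its pairing with `X ^ n g ^ (-j)` in the self-pairing over `k(q)`. -/
lemma map_pairing_expand (n j : ℕ) (c : ℕ × ℤ →₀ RatFunc k) :
    (expand c).map (pairing k (QBorel.monomial k 1 (n, -(j : ℤ)))) =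
      evalExp k ((n.factorial : RatFunc k) * (qPairingCoeff k n)⁻¹ *
        qPairing k (QBorel.monomial _ _ (n, -(j : ℤ))) (ofCoeffs c)) := by
  have hadd : ∀ x y : HahnSeries ℤ (UBorel k),
      (x + y).map (pairing k (QBorel.monomial k 1 (n, -(j : ℤ)))) =
        x.map (pairing k (QBorel.monomial k 1 (n, -(j : ℤ)))) +
          y.map (pairing k (QBorel.monomial k 1 (n, -(j : ℤ)))) := by
    intro x y
    ext i
    simp
  induction c using Finsupp.induction_linear with
  | zero =>
    rw [expand_zero, ofCoeffs_eq, map_zero, map_zero, mul_zero, map_zero]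
    ext i
    simp
  | add x y hx hy =>
    rw [expand_add, hadd, hx, hy, ofCoeffs_eq, ofCoeffs_eq, ofCoeffs_eq, map_add, map_add, mul_add,
      map_add]
  | single p f =>
    obtain ⟨n', m⟩ := p
    rw [expand_single, ofCoeffs_eq, Finsupp.linearCombination_single, map_smul,
      isMonomialPairing_qPairing.apply]
    have h1 : ∀ z : LaurentSeries k[X], (z.map (UBorel.polyElem n')).map
        (pairing k (QBorel.monomial k 1 (n, -(j : ℤ)))) =
          z.map (pairing k (QBorel.monomial k 1 (n, -(j : ℤ))) ∘ₗ UBorel.polyElem n') := by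
      intro z
      ext i
      rfl
    have h2 : (evalExp k f).map (algebraMap k k) = evalExp k f := by
      ext i
      rfl
    rw [h1, map_mul_of_linear, h2]
    simp only
    split_ifs with h
    · subst h
      have h3 : (expLaurent ((m : k[X]) * Polynomial.X)).map
          (pairing k (QBorel.monomial k 1 (n, -(j : ℤ))) ∘ₗ UBorel.polyElem n) =
          HahnSeries.C (n.factorial : k) * expLaurent (-((j * m : ℤ)) : k) := by
        ext i
        rw [HahnSeries.map_coeff, HahnSeries.C_mul_eq_smul, HahnSeries.coeff_smul,
          LinearMap.comp_apply, pairing_polyElem, if_pos rfl, smul_eq_mul, coeff_expLaurent,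
          coeff_expLaurent]
        split_ifs
        · simp
        · rw [eval_mul, eval_pow, eval_mul, eval_X, eval_intCast,
            IsScalarTower.algebraMap_apply ℚ k k[X], algebraMap_eq, eval_C]
          push_cast
          ring
      rw [h3, ← evalExp_X_zpow, ← evalExp_C, ← map_mul, ← map_mul]
      congr 1
      rw [Units.val_zpow_eq_zpow_val, Units.val_mk0, smul_eq_mul, map_natCast, neg_mul, neg_neg]
      field_simp [isMonomialPairing_qPairing.ne_zero n]
    · rw [smul_zero, mul_zero, map_zero]
      have h3 : (expLaurent ((m : k[X]) * Polynomial.X)).map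
          (pairing k (QBorel.monomial k 1 (n, -(j : ℤ))) ∘ₗ UBorel.polyElem n') = 0 := by
        ext i
        rw [HahnSeries.map_coeff, LinearMap.comp_apply, pairing_polyElem, if_neg h]
        rfl
      rw [h3, mul_zero]

end Expand

section Lift

open Polynomial

variable {k : Type u} [Field k] [CharZero k]

lemma map_algebraMap_expLaurent (a : k) :
    (expLaurent a).map (algebraMap k k[X]) = expLaurent (C a) := by
  ext1
  funext i
  rw [HahnSeries.map_coeff, coeff_expLaurent, coeff_expLaurent]
  split_ifs
  · simp
  · simp

variable (k) in
/-- The substitution `q = e ^ (-t)` with values in the Laurent series over `k[H]`. -/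
def evalExpPoly : RatFunc k →+* LaurentSeries k[X] where
  toFun f := (evalExp k f).map (algebraMap k k[X])
  map_one' := by
    rw [map_one, ← expLaurent_zero, map_algebraMap_expLaurent, C_0, expLaurent_zero]
  map_zero' := by
    rw [map_zero]
    ext i
    simp
  map_add' x y := by
    rw [map_add]
    ext1
    funext i
    simp
  map_mul' x y := by
    have h2 : (evalExp k x).map (algebraMap k k) = evalExp k x := by
      ext i
      rfl
    have h := map_mul_of_linear (Algebra.linearMap k k[X]) (evalExp k x) (evalExp k y)
    rw [h2] at h
    rw [map_mul]
    exact h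

lemma evalExpPoly_apply (f : RatFunc k) :
    evalExpPoly k f = (evalExp k f).map (algebraMap k k[X]) := rfl

variable (k) in
/-- The substitution `q = e ^ (-t)`, `g = e ^ (t H)` on polynomials in `g`. -/
def substExp : (RatFunc k)[X] →+* LaurentSeries k[X] :=
  Polynomial.eval₂RingHom (evalExpPoly k) (expLaurent Polynomial.X)

lemma expand_coord_polyElem (n : ℕ) (Q : (RatFunc k)[X]) :
    expand (QBorel.coord _ _ (QBorel.polyElem (qUnit k) n Q)) =
      (substExp k Q).map (UBorel.polyElem n) := by
  induction Q using Polynomial.induction_on' with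
  | add x y hx hy =>
    rw [map_add, map_add, expand_add, hx, hy, map_add]
    ext i
    simp
  | monomial m a =>
    rw [← C_mul_X_pow_eq_monomial, ← smul_eq_C_mul, map_smul, map_smul, QBorel.polyElem_X_pow,
      QBorel.coord_monomial, Finsupp.smul_single, smul_eq_mul, mul_one, expand_single,
      smul_eq_C_mul, substExp, coe_eval₂RingHom, eval₂_mul, eval₂_C, eval₂_X_pow,
      ← expLaurent_nsmul, Int.cast_natCast]
    rfl

/-- The polynomial `Q` over `k(q)` is regular at `t = 0` after the substitution `q = e ^ (-t)`,
`g = e ^ (t H)`, with value `r`. -/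
def HasLimit (Q : (RatFunc k)[X]) (r : k[X]) : Prop :=
  ∃ z : PowerSeries k[X], substExp k Q = HahnSeries.ofPowerSeries ℤ k[X] z ∧
    PowerSeries.constantCoeff z = r

lemma HasLimit.add {Q Q' : (RatFunc k)[X]} {r r' : k[X]} (h : HasLimit Q r) (h' : HasLimit Q' r') :
    HasLimit (Q + Q') (r + r') := by
  obtain ⟨z, hz, rfl⟩ := h
  obtain ⟨z', hz', rfl⟩ := h'
  exact ⟨z + z', by rw [map_add, map_add, hz, hz'], map_add _ _ _⟩

lemma HasLimit.mul {Q Q' : (RatFunc k)[X]} {r r' : k[X]} (h : HasLimit Q r) (h' : HasLimit Q' r') :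
    HasLimit (Q * Q') (r * r') := by
  obtain ⟨z, hz, rfl⟩ := h
  obtain ⟨z', hz', rfl⟩ := h'
  exact ⟨z * z', by rw [map_mul, map_mul, hz, hz'], map_mul _ _ _⟩

lemma hasLimit_C (a : k) : HasLimit (C (RatFunc.C a)) (C a) := by
  refine ⟨PowerSeries.C (C a), ?_, by simp⟩
  rw [substExp, coe_eval₂RingHom, eval₂_C, HahnSeries.ofPowerSeries_C, evalExpPoly_apply, evalExp_C,
    HahnSeries.map_C]
  rfl

/-- `e ^ (a t) - e ^ (b t)` is `t` times a series with constant coefficient `a - b`. -/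
lemma exists_rescale_exp_sub {A : Type*} [CommRing A] [Algebra ℚ A] (a b : A) :
    ∃ z : PowerSeries A, PowerSeries.rescale a (PowerSeries.exp A) -
      PowerSeries.rescale b (PowerSeries.exp A) = PowerSeries.X * z ∧
        PowerSeries.constantCoeff z = a - b := by
  have h : PowerSeries.X ∣ PowerSeries.rescale a (PowerSeries.exp A) -
      PowerSeries.rescale b (PowerSeries.exp A) := by
    rw [PowerSeries.X_dvd_iff, map_sub, ← PowerSeries.coeff_zero_eq_constantCoeff_apply,
      ← PowerSeries.coeff_zero_eq_constantCoeff_apply, PowerSeries.coeff_rescale,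
      PowerSeries.coeff_rescale]
    simp
  obtain ⟨z, hz⟩ := h
  refine ⟨z, hz, ?_⟩
  have h1 := congrArg (PowerSeries.coeff 1) hz
  rw [map_sub, PowerSeries.coeff_rescale, PowerSeries.coeff_rescale, PowerSeries.coeff_exp,
    ← zero_add 1, PowerSeries.coeff_succ_X_mul] at h1
  simpa using h1.symm

/-- The element `(g - q ^ j) / (1 - q)` has the limit `H + j`. -/
lemma hasLimit_linear (j : ℕ) :
    HasLimit (C (1 - RatFunc.X : RatFunc k)⁻¹ * (Polynomial.X - C (RatFunc.X ^ j)))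
      (Polynomial.X + C (j : k)) := by
  obtain ⟨z, hz, hz0⟩ := exists_rescale_exp_sub (Polynomial.X : k[X]) (C (-(j : k)))
  obtain ⟨w, hw, hw0⟩ := exists_rescale_exp_sub (0 : k[X]) (C (-1))
  have hw1 : PowerSeries.constantCoeff w = 1 := by
    rw [hw0]
    simp
  -- `1 - e ^ (-t) = t w` with `w` invertible
  obtain ⟨v, hv⟩ : ∃ v, w * v = 1 := by
    have : IsUnit w := PowerSeries.isUnit_iff_constantCoeff.2 (by rw [hw1]; exact isUnit_one)
    exact this.exists_right_inv
  have hv0 : PowerSeries.constantCoeff v = 1 := by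
    have := congrArg PowerSeries.constantCoeff hv
    rwa [map_mul, hw1, one_mul, map_one] at this
  refine ⟨v * z, ?_, by rw [map_mul, hv0, one_mul, hz0]; simp⟩
  have hX : ∀ n : ℕ, evalExpPoly k (RatFunc.X ^ n) = expLaurent (C (-(n : k))) := by
    intro n
    rw [evalExpPoly_apply, ← zpow_natCast, evalExp_X_zpow, map_algebraMap_expLaurent,
      Int.cast_natCast]
  have h1 : substExp k (Polynomial.X - C (RatFunc.X ^ j)) =
      HahnSeries.ofPowerSeries ℤ k[X] PowerSeries.X * HahnSeries.ofPowerSeries ℤ k[X] z := by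
    rw [← map_mul, ← hz, map_sub, substExp, coe_eval₂RingHom, eval₂_X, eval₂_C, hX, map_sub]
    rfl
  have h2 : substExp k (C (1 - RatFunc.X : RatFunc k)) =
      HahnSeries.ofPowerSeries ℤ k[X] PowerSeries.X * HahnSeries.ofPowerSeries ℤ k[X] w := by
    have h3 := hX 1
    rw [pow_one, Nat.cast_one] at h3
    rw [← map_mul, ← hw, substExp, coe_eval₂RingHom, eval₂_C, map_sub, map_one, h3, map_sub,
      ← expLaurent_zero]
    rfl
  have hq1 : (1 - RatFunc.X : RatFunc k) ≠ 0 := by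
    intro h
    have := qUnit_zpow_eq_one (k := k) 1 (by
      ext
      rw [zpow_one, Units.val_mk0, Units.val_one]
      exact (sub_eq_zero.1 h).symm)
    omega
  have h4 : C (1 - RatFunc.X : RatFunc k) *
      (C (1 - RatFunc.X : RatFunc k)⁻¹ * (Polynomial.X - C (RatFunc.X ^ j))) =
        Polynomial.X - C (RatFunc.X ^ j) := by
    rw [← mul_assoc, ← C_mul, mul_inv_cancel₀ hq1, C_1, one_mul]
  have h5 := congrArg (substExp k) h4
  rw [map_mul, h2, h1, mul_assoc] at h5
  have hX0 : HahnSeries.ofPowerSeries ℤ k[X] PowerSeries.X ≠ 0 := by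
    rw [HahnSeries.ofPowerSeries_X]
    exact HahnSeries.single_ne_zero one_ne_zero
  have h6 := mul_left_cancel₀ hX0 h5
  rw [map_mul (HahnSeries.ofPowerSeries ℤ k[X]), ← h6, ← mul_assoc, ← map_mul, mul_comm v, hv, map_one, one_mul]

/-- Every polynomial in `H` is a limit, since `H` is the limit of `(g - 1) / (1 - q)`. -/
lemma exists_hasLimit (r : k[X]) : ∃ Q : (RatFunc k)[X], HasLimit Q r := by
  have hX : ∃ Q : (RatFunc k)[X], HasLimit Q Polynomial.X := by
    have := hasLimit_linear (k := k) 0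
    rw [Nat.cast_zero, C_0, add_zero] at this
    exact ⟨_, this⟩
  obtain ⟨Q, hQ⟩ := hX
  have hpow : ∀ m : ℕ, HasLimit (Q ^ m) (Polynomial.X ^ m) := by
    intro m
    induction m with
    | zero => simpa using hasLimit_C (1 : k)
    | succ m ih => exact ih.mul hQ
  induction r using Polynomial.induction_on' with
  | add x y hx hy =>
    obtain ⟨Q, hx⟩ := hx
    obtain ⟨Q', hy⟩ := hy
    exact ⟨_, hx.add hy⟩
  | monomial m a =>
    rw [← C_mul_X_pow_eq_monomial]
    exact ⟨_, (hasLimit_C a).mul (hpow m)⟩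

/-- Zeros `-j` of a polynomial in `H` lift to zeros `q ^ j` of a polynomial in `g`. -/
lemma exists_hasLimit_of_eval_eq_zero (s : Finset ℕ) : ∀ r : k[X],
    (∀ j ∈ s, r.eval (-(j : k)) = 0) → ∃ Q : (RatFunc k)[X], HasLimit Q r ∧
      ∀ j ∈ s, Q.eval (RatFunc.X ^ j) = 0 := by
  classical
  induction s using Finset.induction_on with
  | empty =>
    intro r _
    obtain ⟨Q, hQ⟩ := exists_hasLimit r
    exact ⟨Q, hQ, by simp⟩
  | insert j s hj ih =>
    intro r hr
    obtain ⟨r', rfl⟩ := dvd_iff_isRoot.2 (hr j (Finset.mem_insert_self j s))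
    obtain ⟨Q, hQ, hQ0⟩ := ih r' fun i hi => by
      have h1 := hr i (Finset.mem_insert_of_mem hi)
      rw [eval_mul, mul_eq_zero] at h1
      refine h1.resolve_left fun h2 => hj ?_
      rw [eval_sub, eval_X, eval_C, sub_eq_zero, neg_inj, Nat.cast_inj] at h2
      rwa [← h2]
    refine ⟨C (1 - RatFunc.X : RatFunc k)⁻¹ * (Polynomial.X - C (RatFunc.X ^ j)) * Q, ?_, ?_⟩
    · have := (hasLimit_linear (k := k) j).mul hQ
      rwa [show (Polynomial.X + C (j : k)) = Polynomial.X - C (-(j : k)) by simp] at this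
    · intro i hi
      rw [eval_mul, eval_mul, eval_sub, eval_X, eval_C]
      rcases Finset.mem_insert.1 hi with rfl | hi
      · simp
      · rw [hQ0 i hi, mul_zero]

end Lift

section LimitU

open Polynomial

variable {k : Type u} [Field k]

lemma UBorel.exists_eq_sum (y : UBorel k) :
    ∃ r : ℕ →₀ k[X], y = ∑ n ∈ r.support, UBorel.polyElem n (r n) := by
  have hy : y ∈ Submodule.span k (Set.range fun p : ℕ × k[X] => UBorel.polyElem p.1 p.2) := by
    rw [UBorel.span_polyElem]
    exact Submodule.mem_top
  suffices ∃ r : ℕ →₀ k[X], y = Finsupp.lsum k (fun n => UBorel.polyElem n) r from this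
  induction hy using Submodule.span_induction with
  | zero => exact ⟨0, by simp⟩
  | add x y _ _ hx hy =>
    obtain ⟨r, rfl⟩ := hx
    obtain ⟨r', rfl⟩ := hy
    exact ⟨r + r', (map_add _ _ _).symm⟩
  | smul c x _ hx =>
    obtain ⟨r, rfl⟩ := hx
    exact ⟨c • r, (map_smul _ _ _).symm⟩
  | mem x hx =>
    obtain ⟨⟨n, r⟩, rfl⟩ := hx
    exact ⟨Finsupp.single n r, by rw [Finsupp.lsum_single]⟩

lemma leadingCoeff_eq_coeff_zero {R : Type*} [Ring R] {z : HahnSeries ℤ R}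
    (h : ∀ i < 0, z.coeff i = 0) (h0 : z.coeff 0 ≠ 0) : z.leadingCoeff = z.coeff 0 := by
  have hz : z ≠ 0 := by
    rintro rfl
    exact h0 rfl
  have h1 : z.order ≤ 0 := HahnSeries.order_le_of_coeff_ne_zero h0
  have h2 : ¬ z.order < 0 := fun h3 =>
    HahnSeries.leadingCoeff_ne_zero.2 hz (by rw [HahnSeries.leadingCoeff_eq, h _ h3])
  rw [HahnSeries.leadingCoeff_eq, le_antisymm h1 (not_lt.1 h2)]

variable [CharZero k]

/-- The limit `q → 1` of the crossed submodule of a calculus. Leading coefficients of elements of the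
annihilator are annihilated since the pairing can be applied coefficientwise; conversely, an element
`∑ X ^ n r(H)` of the limit annihilator lifts by lifting the zeros of each `r`. -/
theorem limitU_annihilator (J : Finset ℕ) :
    limitU (annihilator (qPairing k) (tangentQ k J)) =
      (annihilator (pairing k) (tangentC k J) : Set (UBorel k)) := by
  ext y
  constructor
  · rintro ⟨c, hc, rfl⟩
    rw [QBorel.mem_annihilator_tangent isMonomialPairing_qPairing.one_left] at hc
    rw [SetLike.mem_coe, QBorel.mem_annihilator_tangent pairing_one_left]
    rintro ⟨n, m⟩ hp
    obtain ⟨j, hj, -, rfl⟩ := mem_indexSet.1 hp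
    have h1 := map_pairing_expand n j c
    rw [hc _ hp, mul_zero, map_zero] at h1
    have h2 := congrArg (fun z => HahnSeries.coeff z (expand c).order) h1
    rw [HahnSeries.leadingCoeff_eq]
    exact h2
  · intro hy
    rw [SetLike.mem_coe, QBorel.mem_annihilator_tangent pairing_one_left] at hy
    obtain ⟨r, hr⟩ := UBorel.exists_eq_sum y
    have hr0 : ∀ n, ∀ j ∈ (insert 0 J).filter (n ≤ ·), (r n).eval (-(j : k)) = 0 := by
      intro n j hj
      obtain ⟨hj, hn⟩ := Finset.mem_filter.1 hj
      have h1 := hy _ (mk_neg_mem_indexSet.2 ⟨hj, hn⟩)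
      rw [hr, map_sum, Finset.sum_eq_single n] at h1
      · rw [pairing_polyElem, if_pos rfl, mul_eq_zero] at h1
        simpa using h1.resolve_left (Nat.cast_ne_zero.2 n.factorial_ne_zero)
      · intro n' _ hn'
        rw [pairing_polyElem, if_neg (Ne.symm hn')]
      · intro hn'
        rw [Finsupp.notMem_support_iff.1 hn', map_zero, map_zero]
    choose Q hQ hQ0 using fun n => exists_hasLimit_of_eval_eq_zero _ (r n) (hr0 n)
    set x : Uq k := ∑ n ∈ r.support, QBorel.polyElem (qUnit k) n (Q n) with hx
    have hxM : x ∈ annihilator (qPairing k) (tangentQ k J) := by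
      refine Submodule.sum_mem _ fun n _ => ?_
      rw [isMonomialPairing_qPairing.polyElem_mem_annihilator]
      intro j hj hn
      exact hQ0 n j (Finset.mem_filter.2 ⟨hj, hn⟩)
    have hcoeff : ∀ i : ℤ, (expand (QBorel.coord _ (qUnit k) x)).coeff i =
        ∑ n ∈ r.support, UBorel.polyElem n ((substExp k (Q n)).coeff i) := by
      intro i
      rw [hx, map_sum, expand_sum, HahnSeries.coeff_sum]
      refine Finset.sum_congr rfl fun n _ => ?_
      rw [expand_coord_polyElem]
      rfl
    have hneg : ∀ i < 0, (expand (QBorel.coord _ (qUnit k) x)).coeff i = 0 := by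
      intro i hi
      rw [hcoeff]
      refine Finset.sum_eq_zero fun n _ => ?_
      obtain ⟨z, hz, -⟩ := hQ n
      rw [hz, PowerSeries.coeff_coe, if_pos hi, map_zero]
    have hzero : (expand (QBorel.coord _ (qUnit k) x)).coeff 0 = y := by
      rw [hcoeff, hr]
      refine Finset.sum_congr rfl fun n _ => ?_
      obtain ⟨z, hz, hz0⟩ := hQ n
      rw [hz, PowerSeries.coeff_coe, if_neg (lt_irrefl _), ← hz0]
      simp
    rcases eq_or_ne y 0 with h0 | h0
    · refine ⟨0, ?_, ?_⟩
      · rw [ofCoeffs_eq, map_zero]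
        exact Submodule.zero_mem _
      · rw [expand_zero, HahnSeries.leadingCoeff_zero, h0]
    · refine ⟨QBorel.coord _ (qUnit k) x, by rwa [ofCoeffs_coord], ?_⟩
      rw [leadingCoeff_eq_coeff_zero hneg (by rwa [hzero]), hzero]

end LimitU

/-! ### The limits of the coirreducible calculi -/

open Coalgebra

section Final

variable {k : Type u} [Field k]

lemma finrank_tangentC (J : Finset ℕ) :
    Module.finrank k (tangentC k J) = Module.finrank (RatFunc k) (tangentQ k J) := by
  have h1 := QBorel.finrank_tangent (K := k) (q := 1) J
  have h2 := QBorel.finrank_tangent (K := RatFunc k) (q := qUnit k) J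
  exact Nat.succ_injective (h1.trans h2.symm)

lemma finrank_tangentQ_singleton {j : ℕ} (hj : j ≠ 0) :
    Module.finrank (RatFunc k) (tangentQ k {j}) = j + 1 := by
  have h2 := QBorel.finrank_tangent (K := RatFunc k) (q := qUnit k) {j}
  rw [card_indexSet_singleton hj] at h2
  exact Nat.succ_injective h2

lemma isLimit_iff [CharZero k] {Γq : BicovariantCalculus (RatFunc k) (Uq k)} {J : Finset ℕ}
    (hJ : Γq.ideal = annihilator (qPairing k) (tangentQ k J))
    {Γ : BicovariantCalculus k (UBorel k)} :
    IsLimit Γq Γ ↔ Γ.ideal = annihilator (pairing k) (tangentC k J) := by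
  rw [IsLimit, hJ, limitU_annihilator, SetLike.coe_set_eq]

section Coirreducible

variable (k) in
/-- The representatives `H / (-j), X, X ^ 2, …` of a right invariant basis. -/
def invariantRep (j i : ℕ) : UBorel k :=
  if i = 0 then (-(j : k))⁻¹ • UBorel.H k else UBorel.X k ^ i

variable (k) in
/-- The basis `g ^ (-j) - 1, X g ^ (-j), X ^ 2 g ^ (-j) / 2!, …` of a quantum tangent space. -/
def dualRep (j i : ℕ) : CB k :=
  ((i.factorial : k)⁻¹) • QBorel.monomial k 1 (i, -(j : ℤ)) - if i = 0 then 1 else 0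

lemma pairing_dualRep (j i : ℕ) {a : UBorel k} (ha : counit (R := k) a = 0) :
    pairing k (dualRep k j i) a =
      (i.factorial : k)⁻¹ * pairing k (QBorel.monomial k 1 (i, -(j : ℤ))) a := by
  rw [dualRep, map_sub, map_smul, LinearMap.sub_apply, LinearMap.smul_apply, smul_eq_mul]
  split_ifs
  · rw [pairing_one_left, ha, sub_zero]
  · rw [map_zero, LinearMap.zero_apply, sub_zero]

lemma counit_invariantRep (j i : ℕ) : counit (R := k) (invariantRep k j i) = 0 := by
  rw [invariantRep]
  split_ifs with h
  · rw [map_smul, UBorel.counit_H, smul_zero]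
  · rw [Bialgebra.counit_pow, UBorel.counit_X, zero_pow h]

lemma pairing_dualRep_invariantRep [CharZero k] {j : ℕ} (hj : j ≠ 0) (i i' : ℕ) :
    pairing k (dualRep k j i') (invariantRep k j i) = if i = i' then 1 else 0 := by
  rw [pairing_dualRep _ _ (counit_invariantRep j i), invariantRep]
  have hf : (i'.factorial : k) ≠ 0 := Nat.cast_ne_zero.2 i'.factorial_ne_zero
  have hj' : (j : k) ≠ 0 := Nat.cast_ne_zero.2 hj
  split_ifs with h h1 h1
  · subst h h1
    have := pairing_monomial k (0, -(j : ℤ)) 0 1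
    rw [pow_zero, pow_one, one_mul] at this
    rw [map_smul, this]
    simp [hj']
  · subst h
    have := pairing_monomial k (i', -(j : ℤ)) 0 1
    rw [pow_zero, pow_one, one_mul, if_neg (Ne.symm h1)] at this
    rw [map_smul, this, smul_zero, mul_zero]
  · have := pairing_monomial k (i', -(j : ℤ)) i 0
    rw [pow_zero, mul_one, if_pos h1.symm] at this
    rw [this, pow_zero, mul_one, inv_mul_cancel₀ hf]
  · have := pairing_monomial k (i', -(j : ℤ)) i 0
    rw [pow_zero, mul_one, if_neg (Ne.symm h1)] at this
    rw [this, mul_zero]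

lemma pairing_dualRep_H_mul (j i : ℕ) {a : UBorel k} (ha : counit (R := k) a = 0) :
    pairing k (dualRep k j i) (UBorel.H k * a) = (-j + i : k) * pairing k (dualRep k j i) a := by
  rw [pairing_dualRep j i ha, pairing_dualRep j i (by rw [Bialgebra.counit_mul, ha, mul_zero]),
    pairing_H_mul]
  push_cast
  ring

lemma pairing_dualRep_X_mul [CharZero k] (j i : ℕ) {a : UBorel k} (ha : counit (R := k) a = 0) :
    pairing k (dualRep k j (i + 1)) (UBorel.X k * a) = pairing k (dualRep k j i) a := by
  rw [pairing_dualRep j i ha, pairing_dualRep j (i + 1) (by rw [Bialgebra.counit_mul, ha, mul_zero]),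
    pairing_X_mul, Nat.factorial_succ]
  have h1 : (i.factorial : k) ≠ 0 := Nat.cast_ne_zero.2 i.factorial_ne_zero
  have h2 : (i + 1 : k) ≠ 0 := by exact_mod_cast Nat.succ_ne_zero i
  push_cast
  field_simp

lemma pairing_dualRep_X_mul_zero (j : ℕ) {a : UBorel k} (ha : counit (R := k) a = 0) :
    pairing k (dualRep k j 0) (UBorel.X k * a) = 0 := by
  rw [pairing_dualRep j 0 (by rw [Bialgebra.counit_mul, ha, mul_zero]), pairing_X_mul_zero, mul_zero]

lemma span_dualRep [CharZero k] (j : ℕ) :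
    Submodule.span k (Set.range fun i : Fin (j + 1) => dualRep k j i) = tangentC k {j} := by
  have hsub : ∀ i : ℕ, dualRep k j i = ((i.factorial : k)⁻¹) •
      (QBorel.monomial k 1 (i, -(j : ℤ)) -
        counit (R := k) (QBorel.monomial k 1 (i, -(j : ℤ))) • (1 : CB k)) := by
    intro i
    rw [dualRep, QBorel.counit_monomial, smul_sub]
    congr 1
    rcases eq_or_ne i 0 with rfl | h
    · simp
    · simp [h]
  refine le_antisymm ?_ ?_
  · rw [Submodule.span_le]
    rintro _ ⟨i, rfl⟩
    simp only [hsub]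
    refine Submodule.smul_mem _ _ (QBorel.sub_counit_mem_tangent ?_)
    rw [QBorel.monomial_mem_monomialSpan, mk_neg_mem_indexSet]
    exact ⟨by simp, Nat.lt_succ_iff.1 i.2⟩
  · rintro x ⟨hx0, hx⟩
    have h1 := QBorel.map_mem_of_mem_monomialSpan
      (LinearMap.id - (counit (R := k) (A := CB k)).smulRight 1)
      (Submodule.span k (Set.range fun i : Fin (j + 1) => dualRep k j i)) (fun p hp => by
        obtain ⟨i, m⟩ := p
        obtain ⟨j', hj', h1, rfl⟩ := mem_indexSet.1 hp
        simp only at h1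
        rcases Finset.mem_insert.1 hj' with rfl | h2
        · obtain rfl : i = 0 := by omega
          rw [Nat.cast_zero, neg_zero, QBorel.monomial_zero]
          simp
        · rw [Finset.mem_singleton] at h2
          subst h2
          have h2 : (i.factorial : k) • dualRep k j' i ∈ _ := Submodule.smul_mem _ _
            (Submodule.subset_span (R := k) (s := Set.range fun i : Fin (j' + 1) => dualRep k j' i)
              ⟨⟨i, by omega⟩, rfl⟩)
          rw [hsub i, smul_smul, mul_inv_cancel₀ (Nat.cast_ne_zero.2 i.factorial_ne_zero), one_smul] at h2
          exact h2) hx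
    simpa [LinearMap.mem_ker.1 hx0] using h1

lemma braidedDerivation_dualRep (j i : ℕ) (hi : 1 ≤ i) (f : MvPolynomial (Fin 2) k) :
    braidedDerivation (pairing k) (dualRep k j i) (normalOrder f) =
      normalOrder (shiftH (-j + i : k) ((i.factorial : k)⁻¹ • (MvPolynomial.pderiv 0)^[i] f)) := by
  have h : braidedDerivation (pairing k) (dualRep k j i) =
      (i.factorial : k)⁻¹ • contractLeft (pairing k (QBorel.monomial k 1 (i, -(j : ℤ)))) := by
    rw [braidedDerivation, dualRep, if_neg (by omega), sub_zero, map_smul]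
    simp [contractLeft, LinearMap.rTensor_smul, LinearMap.comp_smul, LinearMap.smul_comp]
  rw [h, LinearMap.smul_apply, contractLeft_pairing_normalOrder, map_smul, map_smul, Int.cast_neg,
    Int.cast_natCast]

lemma braidedDerivation_dualRep_zero (j : ℕ) (f : MvPolynomial (Fin 2) k) :
    braidedDerivation (pairing k) (dualRep k j 0) (normalOrder f) =
      normalOrder (shiftH (-j : k) f - f) := by
  have h : braidedDerivation (pairing k) (dualRep k j 0) =
      contractLeft (pairing k (QBorel.monomial k 1 (0, -(j : ℤ)))) - LinearMap.id := by
    have h1 : contractLeft (pairing k 1) = LinearMap.id := by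
      have : pairing k 1 = counit := LinearMap.ext pairing_one_left
      rw [this]
      ext a
      simp [contractLeft]
    rw [← h1, braidedDerivation, dualRep, if_pos rfl, Nat.factorial_zero, Nat.cast_one, inv_one,
      one_smul, map_sub]
    simp [contractLeft, LinearMap.rTensor_sub, LinearMap.comp_sub, LinearMap.sub_comp]
  rw [h, LinearMap.sub_apply, contractLeft_pairing_normalOrder, map_sub, Int.cast_neg,
    Int.cast_natCast, Nat.cast_zero, add_zero]
  rfl

/-- The bases of the limit of a coirreducible calculus and of its tangent space. The factor `-1 / j` in
`invariantRep` compensates the derivative `-j` of `e ^ (-j H)` at `0`. -/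
lemma basis_of_limit [CharZero k] {j : ℕ} (hj : j ≠ 0) {Γ : BicovariantCalculus k (UBorel k)}
    (hΓ : Γ.ideal = annihilator (pairing k) (tangentC k {j})) :
    Γ.IsRightInvariantBasis (j + 1) (fun i => Γ.maurerCartan (invariantRep k j i)) ∧
      IsDualBasis (pairing k) Γ (tangentC k {j}) (j + 1)
        (fun i => Γ.maurerCartan (invariantRep k j i)) (dualRep k j) :=
  Γ.isRightInvariantBasis_of_dual (fun i _ => counit_invariantRep j i)
    (fun i _ i' _ => pairing_dualRep_invariantRep hj i i') (span_dualRep j) hΓ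

end Coirreducible

end Final

end BorelCalculi

end

theorem mainTheorem7 {k : Type*} [Field k] [CharZero k] :
    -- (a) Finite dimensional calculi on `U_q(b₊)` have a limit on `U(b₊)`,
    (∀ Γq : BicovariantCalculus (RatFunc k) (Uq k), Γq.IsFiniteDimensional →
      ∃ Γ : BicovariantCalculus k (UBorel k), IsLimit Γq Γ) ∧
    -- the limit is finite dimensional of the same dimension,
    (∀ (Γq : BicovariantCalculus (RatFunc k) (Uq k)) (Γ : BicovariantCalculus k (UBorel k)),
      Γq.IsFiniteDimensional → IsLimit Γq Γ → Γ.IsFiniteDimensional ∧ Γ.dim = Γq.dim) ∧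
    -- the limiting process is well defined and injective up to isomorphism,
    (∀ (Γq Γq' : BicovariantCalculus (RatFunc k) (Uq k))
        (Γ Γ' : BicovariantCalculus k (UBorel k)),
      Γq.IsFiniteDimensional → Γq'.IsFiniteDimensional → IsLimit Γq Γ → IsLimit Γq' Γ' →
        (Γ.Iso Γ' ↔ Γq.Iso Γq')) ∧
    -- and it preserves intersections (of the defining crossed submodules).
    (∀ (Γq Γq' : BicovariantCalculus (RatFunc k) (Uq k))
        (Γ Γ' : BicovariantCalculus k (UBorel k)),
      Γq.IsFiniteDimensional → Γq'.IsFiniteDimensional → IsLimit Γq Γ → IsLimit Γq' Γ' →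
        ∃ (Γq'' : BicovariantCalculus (RatFunc k) (Uq k))
          (Γ'' : BicovariantCalculus k (UBorel k)),
          Γq''.IsFiniteDimensional ∧ IsLimit Γq'' Γ'' ∧
            Γq''.ideal = Γq.ideal ⊓ Γq'.ideal ∧ Γ''.ideal = Γ.ideal ⊓ Γ'.ideal) ∧
    -- Finite dimensional quantum tangent spaces in the `q`-deformed setting have a limit in
    -- `C(B₊)`, which is a quantum tangent space of the same dimension,
    (∀ Lq : Submodule (RatFunc k) (Uq k), IsQuantumTangentSpace (qPairing k) Lq →
      FiniteDimensional (RatFunc k) Lq →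
        ∃ L : Submodule k (CB k), (L : Set (CB k)) = limitC Lq ∧
          IsQuantumTangentSpace (pairing k) L ∧ FiniteDimensional k L ∧
          Module.finrank k L = Module.finrank (RatFunc k) Lq) ∧
    -- and this limiting process is injective and preserves intersections.
    (∀ Lq Lq' : Submodule (RatFunc k) (Uq k), IsQuantumTangentSpace (qPairing k) Lq →
      IsQuantumTangentSpace (qPairing k) Lq' → FiniteDimensional (RatFunc k) Lq →
      FiniteDimensional (RatFunc k) Lq' →
        (limitC Lq = limitC Lq' → Lq = Lq') ∧
          limitC (Lq ⊓ Lq') = limitC Lq ∩ limitC Lq') ∧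
    -- In the `q`-deformed setting finite dimensional calculi up to isomorphism correspond
    -- one-to-one to finite dimensional quantum tangent spaces by duality,
    (∀ Γq : BicovariantCalculus (RatFunc k) (Uq k), Γq.IsFiniteDimensional →
      IsQuantumTangentSpace (qPairing k) (Γq.tangentSpace (qPairing k)) ∧
        FiniteDimensional (RatFunc k) (Γq.tangentSpace (qPairing k)) ∧
        Module.finrank (RatFunc k) (Γq.tangentSpace (qPairing k)) = Γq.dim) ∧
    (∀ Lq : Submodule (RatFunc k) (Uq k), IsQuantumTangentSpace (qPairing k) Lq →
      FiniteDimensional (RatFunc k) Lq →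
        ∃ Γq : BicovariantCalculus (RatFunc k) (Uq k),
          Γq.IsFiniteDimensional ∧ Γq.tangentSpace (qPairing k) = Lq) ∧
    (∀ Γq Γq' : BicovariantCalculus (RatFunc k) (Uq k),
      Γq.IsFiniteDimensional → Γq'.IsFiniteDimensional →
        (Γq.tangentSpace (qPairing k) = Γq'.tangentSpace (qPairing k) ↔ Γq.Iso Γq')) ∧
    -- and the two limiting processes are compatible with this duality.
    (∀ (Γq : BicovariantCalculus (RatFunc k) (Uq k)) (Γ : BicovariantCalculus k (UBorel k)),
      Γq.IsFiniteDimensional → IsLimit Γq Γ →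
        (Γ.tangentSpace (pairing k) : Set (CB k)) = limitC (Γq.tangentSpace (qPairing k))) ∧
    -- (b) Coirreducible calculi exist in every dimension `n ≥ 2`, and coirreducible calculi
    -- correspond to irreducible quantum tangent spaces.
    (∀ n : ℕ, 2 ≤ n → ∃ Γq : BicovariantCalculus (RatFunc k) (Uq k),
      Γq.IsFiniteDimensional ∧ Γq.dim = n ∧ Γq.IsCoirreducible) ∧
    (∀ Γq : BicovariantCalculus (RatFunc k) (Uq k), Γq.IsFiniteDimensional →
      (Γq.IsCoirreducible ↔
        IsIrreducibleTangentSpace (qPairing k) (Γq.tangentSpace (qPairing k)))) ∧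
    -- The limits of the coirreducible ones are given explicitly.
    (∀ (n : ℕ) (Γq : BicovariantCalculus (RatFunc k) (Uq k))
        (Γ : BicovariantCalculus k (UBorel k)),
      Γq.IsFiniteDimensional → Γq.IsCoirreducible → Γq.dim = n → IsLimit Γq Γ →
        2 ≤ n ∧ ∃ (η : ℕ → Γ.Form) (φ : ℕ → CB k),
          Γ.IsRightInvariantBasis n η ∧
          IsDualBasis (pairing k) Γ (Γ.tangentSpace (pairing k)) n η φ ∧
          Γ.d (UBorel.X k) = η 1 ∧
          Γ.d (UBorel.H k) = (1 - n : k) • η 0 ∧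
          (∀ i < n, UBorel.H k • η i - MulOpposite.op (UBorel.H k) • η i =
            (1 - n + i : k) • η i) ∧
          (∀ i < n, UBorel.X k • η i - MulOpposite.op (UBorel.X k) • η i =
            if i < n - 1 then η (i + 1) else 0) ∧
          (∀ i, 1 ≤ i → i < n → ∀ f : MvPolynomial (Fin 2) k,
            braidedDerivation (pairing k) (φ i) (normalOrder f) =
              normalOrder (shiftH (1 - n + i : k)
                ((i.factorial : k)⁻¹ • (MvPolynomial.pderiv 0)^[i] f))) ∧
          ∀ f : MvPolynomial (Fin 2) k,
            braidedDerivation (pairing k) (φ 0) (normalOrder f) =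
              normalOrder (shiftH (1 - n : k) f - f)) := by
  have hex : ∀ Γq : BicovariantCalculus (RatFunc k) (Uq k), Γq.IsFiniteDimensional →
      ∃ J : Finset ℕ, 0 ∉ J ∧ Γq.ideal = annihilator (qPairing k) (tangentQ k J) :=
    fun Γq hfd => exists_ideal_eq hfd le_rfl
  have hts : ∀ {Γ : BicovariantCalculus k (UBorel k)} {J : Finset ℕ},
      Γ.ideal = annihilator (pairing k) (tangentC k J) →
        Γ.tangentSpace (pairing k) = tangentC k J := fun h =>
    BicovariantCalculus.tangentSpace_eq pairing_injective pairing_one_right (QBorel.tangent_le _) h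
  refine ⟨?_, ?_, ?_, ?_, ?_, ?_, ?_, ?_, ?_, ?_, ?_, ?_, ?_⟩
  · intro Γq hfd
    obtain ⟨J, -, hJ⟩ := hex Γq hfd
    obtain ⟨Γ, hΓ⟩ := exists_calculus_tangentC (k := k) J
    exact ⟨Γ, (isLimit_iff hJ).2 hΓ⟩
  · intro Γq Γ hfd hlim
    obtain ⟨J, -, hJ⟩ := hex Γq hfd
    obtain ⟨h1, h2⟩ := BicovariantCalculus.finrank_rightInvariant pairing_injective
      pairing_one_right (QBorel.tangent_le _) ((isLimit_iff hJ).1 hlim)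
    exact ⟨h1, by rw [h2, (isFiniteDimensional_of_ideal_eq hJ).2, finrank_tangentC]⟩
  · intro Γq Γq' Γ Γ' hfd hfd' hlim hlim'
    obtain ⟨J, h0, hJ⟩ := hex Γq hfd
    obtain ⟨J', h0', hJ'⟩ := hex Γq' hfd'
    rw [BicovariantCalculus.iso_iff, BicovariantCalculus.iso_iff]
    have hΓ := (isLimit_iff hJ).1 hlim
    have hΓ' := (isLimit_iff hJ').1 hlim'
    constructor
    · intro h
      rw [hJ, hJ', QBorel.annihilator_tangent_injective pairing_injective pairing_one_right h0 h0'
        hΓ (h.trans hΓ')]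
    · intro h
      rw [hΓ, hΓ', QBorel.annihilator_tangent_injective qPairing_injective
        isMonomialPairing_qPairing.one_right h0 h0' hJ (h.trans hJ')]
  · intro Γq Γq' Γ Γ' hfd hfd' hlim hlim'
    obtain ⟨J, h0, hJ⟩ := hex Γq hfd
    obtain ⟨J', h0', hJ'⟩ := hex Γq' hfd'
    obtain ⟨Γq'', hq⟩ := exists_calculus_tangentQ (k := k) (J ∪ J')
    obtain ⟨Γ'', hΓ''⟩ := exists_calculus_tangentC (k := k) (J ∪ J')
    refine ⟨Γq'', Γ'', (isFiniteDimensional_of_ideal_eq hq).1, (isLimit_iff hq).2 hΓ'', ?_, ?_⟩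
    · rw [hq, hJ, hJ', QBorel.annihilator_tangent_union isMonomialPairing_qPairing.one_left]
    · rw [hΓ'', (isLimit_iff hJ).1 hlim, (isLimit_iff hJ').1 hlim',
        QBorel.annihilator_tangent_union pairing_one_left]
  · intro Lq hL hfd
    obtain ⟨J, h0, rfl⟩ := QBorel.exists_eq_tangent qUnit_zpow_eq_one isMonomialPairing_qPairing
      hL hfd
    exact ⟨tangentC k J, (limitC_tangentQ J).symm, QBorel.isQuantumTangentSpace_tangent _ _,
      inferInstance, finrank_tangentC J⟩
  · intro Lq Lq' hL hL' hfd hfd'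
    obtain ⟨J, h0, rfl⟩ := QBorel.exists_eq_tangent qUnit_zpow_eq_one isMonomialPairing_qPairing
      hL hfd
    obtain ⟨J', h0', rfl⟩ := QBorel.exists_eq_tangent qUnit_zpow_eq_one
      isMonomialPairing_qPairing hL' hfd'
    refine ⟨fun h => ?_, ?_⟩
    · have h1 := (limitC_tangentQ J).symm.trans (h.trans (limitC_tangentQ J'))
      rw [QBorel.tangent_injective h0 h0' (SetLike.coe_injective h1)]
    · rw [QBorel.tangent_inf]
      refine (limitC_tangentQ _).trans ?_
      rw [tangentC, ← QBorel.tangent_inf]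
      exact (congrArg₂ (· ∩ ·) (limitC_tangentQ J) (limitC_tangentQ J')).symm
  · intro Γq hfd
    obtain ⟨J, -, hJ⟩ := hex Γq hfd
    rw [tangentSpace_eq_of_ideal_eq hJ, (isFiniteDimensional_of_ideal_eq hJ).2]
    exact ⟨QBorel.isQuantumTangentSpace_tangent _ _, inferInstance, rfl⟩
  · intro Lq hL hfd
    obtain ⟨J, -, rfl⟩ := QBorel.exists_eq_tangent qUnit_zpow_eq_one isMonomialPairing_qPairing
      hL hfd
    obtain ⟨Γq, hq⟩ := exists_calculus_tangentQ (k := k) J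
    exact ⟨Γq, (isFiniteDimensional_of_ideal_eq hq).1, tangentSpace_eq_of_ideal_eq hq⟩
  · intro Γq Γq' hfd hfd'
    obtain ⟨J, h0, hJ⟩ := hex Γq hfd
    obtain ⟨J', h0', hJ'⟩ := hex Γq' hfd'
    rw [BicovariantCalculus.iso_iff]
    constructor
    · rw [tangentSpace_eq_of_ideal_eq hJ, tangentSpace_eq_of_ideal_eq hJ', hJ, hJ']
      intro h
      rw [h]
    · intro h
      rw [tangentSpace_eq_of_ideal_eq hJ, tangentSpace_eq_of_ideal_eq (h.symm.trans hJ)]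
  · intro Γq Γ hfd hlim
    obtain ⟨J, -, hJ⟩ := hex Γq hfd
    rw [hts ((isLimit_iff hJ).1 hlim), tangentSpace_eq_of_ideal_eq hJ]
    exact (limitC_tangentQ J).symm
  · intro n hn
    obtain ⟨Γq, hq⟩ := exists_calculus_tangentQ (k := k) {n - 1}
    obtain ⟨h1, h2⟩ := isFiniteDimensional_of_ideal_eq hq
    refine ⟨Γq, h1, ?_, (isCoirreducible_iff_card ?_ hq).2 ⟨_, rfl⟩⟩
    · rw [h2, finrank_tangentQ_singleton (by omega)]
      omega
    · rw [Finset.mem_singleton]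
      omega
  · intro Γq hfd
    obtain ⟨J, h0, hJ⟩ := hex Γq hfd
    rw [isCoirreducible_iff_card h0 hJ, tangentSpace_eq_of_ideal_eq hJ]
    exact (isIrreducibleTangentSpace_iff h0).symm
  · intro n Γq Γ hfd hco hdim hlim
    obtain ⟨J, h0, hJ⟩ := hex Γq hfd
    obtain ⟨j, rfl⟩ := (isCoirreducible_iff_card h0 hJ).1 hco
    have hj : j ≠ 0 := by
      rintro rfl
      exact h0 (Finset.mem_singleton_self 0)
    rw [(isFiniteDimensional_of_ideal_eq hJ).2, finrank_tangentQ_singleton hj] at hdim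
    subst hdim
    have hΓ := (isLimit_iff hJ).1 hlim
    obtain ⟨hb, hd⟩ := basis_of_limit hj hΓ
    have hn : ∀ x : k, (1 - ((j + 1 : ℕ) : k) + x) = -(j : k) + x := by
      intro x
      push_cast
      ring
    have hn0 : (1 - ((j + 1 : ℕ) : k)) = -(j : k) := by
      push_cast
      ring
    refine ⟨by omega, _, _, hb, by rwa [hts hΓ], ?_, ?_, ?_, ?_, ?_, ?_⟩
    · rw [Γ.d_primitive (UBorel.comul_X k), invariantRep, if_neg one_ne_zero, pow_one]
    · rw [Γ.d_primitive (UBorel.comul_H k), invariantRep, if_pos rfl, hn0, map_smul, smul_smul,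
        mul_inv_cancel₀ (neg_ne_zero.2 (Nat.cast_ne_zero.2 hj)), one_smul]
    · intro i hi
      have hε := counit_invariantRep (k := k) j i
      rw [Γ.commutator_primitive (UBorel.comul_H k) hε,
        hd.2.2 _ (by rw [Bialgebra.counit_mul, hε, mul_zero]), Finset.sum_eq_single i]
      · rw [pairing_dualRep_H_mul j i hε, pairing_dualRep_invariantRep hj, if_pos rfl, mul_one, hn]
      · intro i' _ hi'
        rw [pairing_dualRep_H_mul j i' hε, pairing_dualRep_invariantRep hj, if_neg (Ne.symm hi'),
          mul_zero, zero_smul]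
      · intro h
        exact absurd (Finset.mem_range.2 hi) h
    · intro i hi
      have hε := counit_invariantRep (k := k) j i
      have hcoef : ∀ i', pairing k (dualRep k j i') (UBorel.X k * invariantRep k j i) =
          if i' = i + 1 then 1 else 0 := by
        intro i'
        cases i' with
        | zero => rw [pairing_dualRep_X_mul_zero j hε, if_neg (by omega)]
        | succ i' =>
          rw [pairing_dualRep_X_mul j i' hε, pairing_dualRep_invariantRep hj]
          exact if_congr (by omega) rfl rfl
      rw [Γ.commutator_primitive (UBorel.comul_X k) hε,
        hd.2.2 _ (by rw [Bialgebra.counit_mul, hε, mul_zero])]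
      simp only [hcoef, ite_smul, one_smul, zero_smul, Finset.sum_ite_eq', Finset.mem_range]
      exact if_congr (by omega) rfl rfl
    · intro i hi _ f
      rw [braidedDerivation_dualRep j i hi, hn]
    · intro f
      rw [braidedDerivation_dualRep_zero, hn0]
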